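/- For $d\ge 1$ and even integers $2\le n_1\le n_2\le\dots\le n_d$ let $G=\mathbb{Z}_{n_1}\times\dots\times\mathbb{Z}_{n_d}$ be the torus, i.e. the Cartesian product of the cycle graphs of lengths $n_1,\dots,n_d$ (simple graphs; $\mathbb{Z}_2$ is a single edge). Let $V[G]$ be its vertex set, $\Delta(G)$ the common degree of its vertices, $(V^{\mathrm{even}},V^{\mathrm{odd}})$ a bipartition of $G$, and $\alpha:=\prod_{i=1}^{d-1}n_i$. For $x,b\in V[G]$, a minimal edge cutset separating $x$ and $b$ is a set $\Gamma$ of edges of $G$ such that every path from $x$ to $b$ crosses an edge of $\Gamma$, while no proper subset of $\Gamma$ has this property. For such $\Gamma$ let $\mathrm{comp}(\Gamma,x)$ be the connected component of $x$ in $G$ after the edges of $\Gamma$ are removed, let $P_\Gamma(v)$ be the number of edges of $\Gamma$ incident to the vertex $v$, let $E_1(\Gamma):=\{v\in\mathrm{comp}(\Gamma,x) : P_\Gamma(v)>0\}$ be the interior boundary, and let $E_{1,e}(\Gamma):=\{v\in E_1(\Gamma) : P_\Gamma(v)\ge\Delta(G)-\sqrt d\}$ be the set of exposed vertices. Let $\mathrm{OMCut}(x,b)$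 be the set of odd minimal cutsets, i.e. those minimal edge cutsets $\Gamma$ separating $x$ and $b$ with $E_1(\Gamma)\subseteq V^{\mathrm{odd}}$. A set $E\subseteq V[G]$ is an interior approximation to $\Gamma\in\mathrm{OMCut}(x,b)$ if $$E_1(\Gamma)\setminus E_{1,e}(\Gamma)\subseteq E\subseteq\mathrm{comp}(\Gamma,x).$$ Theorem. There exist $d_0\in\mathbb{N}$, $d_0>0$, and a real $C>0$ such that for all $d\ge d_0$, all even integers $2\le n_1\le\dots\le n_d$, every bipartition $(V^{\mathrm{even}},V^{\mathrm{odd}})$ of the torus $G$, all integers $L\ge 0$ and all $x,b\in V[G]$, there exists a family $\mathcal{E}$ of subsets of $V[G]$ satisfying $$|\mathcal{E}|\le 2\,n_d^{\lfloor L/\alpha\rfloor}\exp\left(\frac{C\log^2 d}{d^{3/2}}L\right)$$ and such that for every $\Gamma\in\mathrm{OMCut}(x,b)$ with $|\Gamma|=L$ there is an $E\in\mathcal{E}$ which is an interior approximation to $\Gamma$. -/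

import Mathlib

namespace OddCutset

/-- The vertices of the torus with side lengths `n`: all `(x₁, …, x_d)` with `0 ≤ xᵢ ≤ nᵢ - 1`. -/
abbrev TorusVertex {d : ℕ} (n : Fin d → ℕ) : Type := ∀ i : Fin d, Fin (n i)

/-- The torus `ℤ_{n₁} × ⋯ × ℤ_{n_d}`: the Cartesian (box) product of the cycle graphs of lengths
`nᵢ`. All graphs are simple, so the cycle of length `2` is a single edge. -/
def torus {d : ℕ} (n : Fin d → ℕ) : SimpleGraph (TorusVertex n) where
  Adj x y := ∃ i, (SimpleGraph.cycleGraph (n i)).Adj (x i) (y i) ∧ ∀ j, j ≠ i → x j = y j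
  symm := by
    constructor
    rintro x y ⟨i, h, h'⟩
    exact ⟨i, h.symm, fun j hj => (h' j hj).symm⟩
  loopless := by
    constructor
    rintro x ⟨i, h, -⟩
    exact h.ne rfl

/-- Admissible side lengths: even integers `2 ≤ n₁ ≤ n₂ ≤ ⋯ ≤ n_d`. -/
structure IsSideLengths {d : ℕ} (n : Fin d → ℕ) : Prop where
  mono : Monotone n
  even : ∀ i, Even (n i)
  two_le : ∀ i, 2 ≤ n i

/-- The size `α = n₁ n₂ ⋯ n_{d-1}` of the smallest section of the torus; `⊤` is the last index. -/
def sectionSize {d : ℕ} [NeZero d] (n : Fin d → ℕ) : ℕ := ∏ i ∈ Finset.Iio (⊤ : Fin d), n i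

section Graph

variable {V : Type*} (G : SimpleGraph V)

/-- Every walk in `G` from `x` to `b` crosses an edge of `Γ`. -/
def Separates (Γ : Set (Sym2 V)) (x b : V) : Prop :=
  ∀ p : G.Walk x b, ∃ e ∈ p.edges, e ∈ Γ

/-- The minimal edge cutsets separating `x` and `b`. -/
def MCut (x b : V) : Set (Set (Sym2 V)) :=
  {Γ | Γ ⊆ G.edgeSet ∧ Separates G Γ x b ∧ ∀ Γ' : Set (Sym2 V), Γ' ⊂ Γ → ¬ Separates G Γ' x b}

/-- The connected component of `v` in `G` after the edges of `Γ` are removed. -/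
def comp (Γ : Set (Sym2 V)) (v : V) : Set V := {w | (G.deleteEdges Γ).Reachable v w}

/-- The number of edges of `Γ` that are incident to `v`. -/
noncomputable def plaquettes (Γ : Set (Sym2 V)) (v : V) : ℕ := {e ∈ Γ | v ∈ e}.ncard

/-- The inner vertex boundary of the component of `v`. -/
def innerBoundary (Γ : Set (Sym2 V)) (v : V) : Set V := {w ∈ comp G Γ v | 0 < plaquettes Γ w}

/-- The odd minimal edge cutsets separating `x` and `b`: the inner boundary of the component of
`x` lies in the class `Vodd` of the bipartition. -/
def OMCut (Vodd : Set V) (x b : V) : Set (Set (Sym2 V)) :=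
  {Γ ∈ MCut G x b | innerBoundary G Γ x ⊆ Vodd}

/-- The exposed vertices of the interior boundary: those incident to at least `deg v - √d` edges
of `Γ`, where `d` is the dimension (the torus is regular, so `deg v` is the degree of the graph). -/
def exposed (d : ℕ) (Γ : Set (Sym2 V)) (x : V) : Set V :=
  {v ∈ innerBoundary G Γ x | ((G.neighborSet v).ncard : ℝ) - √(d : ℝ) ≤ (plaquettes Γ v : ℝ)}

/-- `E` contains every non-exposed vertex of the interior boundary of `Γ` and is contained in the
component of `x`. -/
def IsInteriorApproximation (d : ℕ) (Γ : Set (Sym2 V)) (x : V) (E : Set V) : Prop :=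
  innerBoundary G Γ x \ exposed G d Γ x ⊆ E ∧ E ⊆ comp G Γ x

end Graph

end OddCutset

/-! Let `A` be the component of `x`, `Δ` the degree and `L` the size of the cutset. An even vertex
of `A` has all its neighbours in `A`, and an odd vertex outside `A` has all its neighbours outside.
A non-exposed boundary vertex has more than `√d` neighbours in `A`, so it suffices to find `E ⊆ A`
containing every odd vertex of `A` with more than `√d` neighbours in `A`. Each such `E` is encoded
by about `L log d / d^(3/2)` marked vertices that can be visited by bounded jumps from a few roots.
Each jump and its marks cost a factor polynomial in `d`, which gives the exponent `L log² d /
d^(3/2)`.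

Coarse approximation. Three Hamming codes on disjoint blocks of coordinates, each with `N` of order
`d` syndromes, split the torus into `N³` level sets, and at most three steps project any vertex to a
given level. Averaged over the levels, the projection changes the side of `A` for `O(L/N)` vertices,
while the boundary of `A` inside a level has `O(L(Δ+N)/N³) = O(L/d²)` vertices
(`Syndrome.exists_level`). Three codes are used so that this is below `L/d^(3/2)`. The boundary on
the level, with one bit, determines the coarse approximation (`Syndrome.eq_of_inner_eq`).

Refinement. With threshold `t = √d/2`, the `O(L/d)` errors are repaired by two sets of correcting
vertices of size at most `O(L log d / d^(3/2))`, chosen greedily (`exists_greedy`,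
`exists_dominating`, `IsOddSet.exists_refined`).

Connectivity. If both sides have at least two vertices, there are at least `Δ²/4` boundary edges
near every boundary vertex (`IsOddSet.sq_card_le`), so the boundary has a net of size `O(L/Δ²)`. The
net links all marked vertices by bounded jumps within each component of the boundary
(`IsOddSet.exists_decode`).

Roots. On a torus the boundary need not be connected. A mod 2 cohomology argument shows that, when
there are several components, each has at least `α` edges (`sectionSize_le_card_component`). Hence
at most `max(1, ⌊L/α⌋)` roots are needed. For `L ≥ α` they cost `(α n_d)^⌊L/α⌋`, and the power of
`α` is absorbed in the exponential since `α ≥ d³`. For `L < α` a single root from a short explicit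
list suffices.

If one side is a single vertex, `∅` or `{b}ᶜ` is an approximation; these two sets account for the
factor `2`. -/

namespace OddCutset

open scoped Pointwise

/-! ### Odd sets in Cayley graphs: local boundary size and nets. -/

section Cayley

variable {V : Type*} [AddCommGroup V] [DecidableEq V]

/-- The boundary of `A` in the Cayley graph with generators `S`: the pairs `(v, s)` such that the
edge from `v` to `v + s` leaves `A`. -/
def bdry (S A : Finset V) : Finset (V × V) := (A ×ˢ S).filter fun p => p.1 + p.2 ∉ A

/-- The number of neighbours of `v` outside `A`. -/
def outDeg (S A : Finset V) (v : V) : ℕ := (S.filter fun s => v + s ∉ A).card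

/-- The number of neighbours of `v` in `A`. -/
def inDeg (S A : Finset V) (v : V) : ℕ := (S.filter fun s => v + s ∈ A).card

/-- `A` is a set whose inner boundary is odd, in a bipartite Cayley graph with class `Ev` of even
vertices. -/
structure IsOddSet (S A : Finset V) (Ev : V → Prop) : Prop where
  neg_mem : ∀ s ∈ S, -s ∈ S
  flip : ∀ v, ∀ s ∈ S, (Ev (v + s) ↔ ¬ Ev v)
  inner : ∀ v ∈ A, Ev v → ∀ s ∈ S, v + s ∈ A

set_option linter.unusedSectionVars false

variable {S A : Finset V} {Ev : V → Prop}

theorem mem_bdry {p : V × V} : p ∈ bdry S A ↔ p.1 ∈ A ∧ p.2 ∈ S ∧ p.1 + p.2 ∉ A := by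
  simp [bdry, and_assoc]

theorem inDeg_add_outDeg (v : V) : inDeg S A v + outDeg S A v = S.card :=
  Finset.card_filter_add_card_filter_not _

namespace IsOddSet

theorem odd_of_bdry (h : IsOddSet S A Ev) {v s : V} (hv : v ∈ A) (hs : s ∈ S) (hvs : v + s ∉ A) :
    ¬ Ev v := fun he => hvs (h.inner v hv he s hs)

/-- A neighbour of `v` is even; were it in `A`, all its neighbours would be, `v` among them. -/
theorem outer (h : IsOddSet S A Ev) {v s : V} (hv : v ∉ A) (he : ¬ Ev v) (hs : s ∈ S) :
    v + s ∉ A := fun hm => hv <| by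
  have := h.inner (v + s) hm ((h.flip v s hs).2 he) (-s) (h.neg_mem s hs)
  simpa using this

/-- The two endpoints of a boundary edge see together at least as many boundary edges as the
degree. -/
theorem card_le_outDeg_add_inDeg (h : IsOddSet S A Ev) {v s : V} (hv : v ∈ A) (hs : s ∈ S)
    (hvs : v + s ∉ A) : S.card ≤ outDeg S A v + inDeg S A (v + s) := by
  rw [← inDeg_add_outDeg (S := S) (A := A) v, add_comm]
  -- Since `v` is odd, a neighbour `v + t` in `A` is even, so `v + t + s` is in `A` too: every
  -- direction into `A` at `v` is one at `v + s`.
  refine Nat.add_le_add_left (Finset.card_le_card fun t ht => ?_) _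
  rw [Finset.mem_filter] at ht ⊢
  refine ⟨ht.1, ?_⟩
  rw [add_right_comm]
  exact h.inner _ ht.2 ((h.flip v t ht.1).2 (h.odd_of_bdry hv hs hvs)) s hs

end IsOddSet

/-- The ball of radius `k` around `0`. -/
def ball (S : Finset V) (k : ℕ) : Finset V := k • (insert 0 S)

theorem ball_add {a b : V} {j k : ℕ} (ha : a ∈ ball S j) (hb : b ∈ ball S k) :
    a + b ∈ ball S (j + k) := by
  rw [ball, add_nsmul]; exact Finset.add_mem_add ha hb

theorem zero_mem_ball (k : ℕ) : (0 : V) ∈ ball S k :=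
  Finset.zero_mem_nsmul (Finset.mem_insert_self _ _)

theorem ball_mono {j k : ℕ} (h : j ≤ k) : ball S j ⊆ ball S k := fun a ha => by
  obtain ⟨i, rfl⟩ := Nat.exists_eq_add_of_le h
  simpa using ball_add ha (zero_mem_ball (S := S) i)

theorem mem_ball_one {s : V} (hs : s ∈ S) : s ∈ ball S 1 := by
  simp [ball, hs]

theorem neg_mem_ball (hS : ∀ s ∈ S, -s ∈ S) {k : ℕ} : ∀ {a : V}, a ∈ ball S k → -a ∈ ball S k := by
  induction k with
  | zero => intro a ha; simpa [ball] using ha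
  | succ k ih =>
    intro a ha
    rw [ball, succ_nsmul, Finset.mem_add] at ha
    obtain ⟨b, hb, c, hc, rfl⟩ := ha
    rw [neg_add]
    refine ball_add (ih hb) ?_
    rcases Finset.mem_insert.1 hc with rfl | hc
    · simpa using zero_mem_ball 1
    · exact mem_ball_one (hS c hc)

theorem sub_mem_ball_comm (hS : ∀ s ∈ S, -s ∈ S) {k : ℕ} {a b : V} (h : a - b ∈ ball S k) :
    b - a ∈ ball S k := by
  simpa using neg_mem_ball hS h

theorem sub_mem_ball_trans {j k : ℕ} {a b c : V} (h : a - b ∈ ball S j) (h' : b - c ∈ ball S k) :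
    a - c ∈ ball S (j + k) := by
  simpa using ball_add h h'

theorem card_ball_le (k : ℕ) : (ball S k).card ≤ (S.card + 1) ^ k :=
  Finset.card_nsmul_le.trans (Nat.pow_le_pow_left (Finset.card_insert_le _ _) _)

/-- The boundary edges whose inner endpoint is at distance at most `k` from `v`. -/
def bdryNear (S A : Finset V) (k : ℕ) (v : V) : Finset (V × V) :=
  (bdry S A).filter fun p => p.1 - v ∈ ball S k

theorem sum_outDeg_le {O : Finset V} {a v : V} {k : ℕ}
    (hO : ∀ s ∈ O, a + s ∈ A ∧ a + s - v ∈ ball S k) :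
    ∑ s ∈ O, outDeg S A (a + s) ≤ (bdryNear S A k v).card := by
  simp only [outDeg]
  rw [← Finset.card_sigma]
  refine Finset.card_le_card_of_injOn (fun p => (a + p.1, p.2)) ?_ ?_
  · rintro ⟨s, t⟩ hp
    simp only [Finset.coe_sigma, Set.mem_sigma_iff, Finset.mem_coe, Finset.mem_filter] at hp
    simp only [bdryNear, Finset.coe_filter, mem_bdry, Set.mem_ofPred_eq]
    exact ⟨⟨(hO s hp.1).1, hp.2.1, hp.2.2⟩, (hO s hp.1).2⟩
  · rintro ⟨s, t⟩ _ ⟨s', t'⟩ _ h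
    simp only [Prod.mk.injEq, add_right_inj] at h
    obtain ⟨rfl, rfl⟩ := h
    rfl

theorem sum_inDeg_le (hS : ∀ s ∈ S, -s ∈ S) {O : Finset V} {a v : V} {k : ℕ}
    (hO : ∀ s ∈ O, a + s ∉ A ∧ a + s - v ∈ ball S k) :
    ∑ s ∈ O, inDeg S A (a + s) ≤ (bdryNear S A (k + 1) v).card := by
  simp only [inDeg]
  rw [← Finset.card_sigma]
  refine Finset.card_le_card_of_injOn (fun p => (a + p.1 + p.2, -p.2)) ?_ ?_
  · rintro ⟨s, t⟩ hp
    simp only [Finset.coe_sigma, Set.mem_sigma_iff, Finset.mem_coe, Finset.mem_filter] at hp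
    simp only [bdryNear, Finset.coe_filter, mem_bdry, Set.mem_ofPred_eq]
    refine ⟨⟨hp.2.2, hS t hp.2.1, by simpa using (hO s hp.1).1⟩, ?_⟩
    rw [add_sub_right_comm]
    exact ball_add (hO s hp.1).2 (mem_ball_one hp.2.1)
  · rintro ⟨s, t⟩ _ ⟨s', t'⟩ _ h
    simp only [Prod.mk.injEq, neg_inj] at h
    obtain ⟨h, rfl⟩ := h
    simp only [add_left_inj, add_right_inj] at h
    rw [h]

/-- In the neighbourhood of every boundary vertex there are at least quadratically many boundary
edges. -/
theorem IsOddSet.sq_card_le (h : IsOddSet S A Ev) (hin : ∀ v ∈ A, ∃ s ∈ S, v + s ∈ A)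
    (hout : ∀ v ∉ A, ∃ s ∈ S, v + s ∉ A) {v s₀ : V} (hv : v ∈ A) (hs₀ : s₀ ∈ S)
    (hvs : v + s₀ ∉ A) : S.card ^ 2 ≤ 4 * (bdryNear S A 4 v).card := by
  have hvo := h.odd_of_bdry hv hs₀ hvs
  have hmono : ∀ {k}, k ≤ 4 → (bdryNear S A k v).card ≤ (bdryNear S A 4 v).card := fun hk =>
    Finset.card_le_card fun p hp => by
      rw [bdryNear, Finset.mem_filter] at hp ⊢
      exact ⟨hp.1, ball_mono hk hp.2⟩
  have hL := h.card_le_outDeg_add_inDeg hv hs₀ hvs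
  -- One endpoint of the edge sees at least `S.card / 2` boundary edges. Translating these by a step
  -- to a neighbour on the same side gives a family of parallel boundary edges, whose endpoints
  -- together see at least `S.card` boundary edges for each direction.
  rcases le_total (inDeg S A (v + s₀)) (outDeg S A v) with hc | hc
  · obtain ⟨x, hx, hvx⟩ := hin v hv
    have hvxe : Ev (v + x) := (h.flip v x hx).2 hvo
    have h1 : ∀ s ∈ S.filter (fun s => v + s ∉ A),
        S.card ≤ outDeg S A (v + x + s) + inDeg S A (v + s) := fun s hs => by
      rw [Finset.mem_filter] at hs
      have := h.card_le_outDeg_add_inDeg (h.inner _ hvx hvxe s hs.1) (h.neg_mem x hx)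
      rw [show v + x + s + -x = v + s by abel] at this
      exact this hs.2
    have h2 := Finset.card_nsmul_le_sum _ _ _ h1
    rw [Finset.sum_add_distrib, smul_eq_mul, ← outDeg] at h2
    have h3 := (sum_outDeg_le (S := S) (A := A) (O := S.filter (fun s => v + s ∉ A)) (a := v + x)
      (v := v) (k := 2) fun s hs => by
        rw [Finset.mem_filter] at hs
        refine ⟨h.inner _ hvx hvxe s hs.1, ?_⟩
        rw [show v + x + s - v = x + s by abel]
        exact ball_add (mem_ball_one hx) (mem_ball_one hs.1)).trans (hmono (by norm_num))
    have h4 := (sum_inDeg_le (S := S) (A := A) h.neg_mem (O := S.filter (fun s => v + s ∉ A))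
      (a := v) (v := v) (k := 1) fun s hs => by
        rw [Finset.mem_filter] at hs
        refine ⟨hs.2, ?_⟩
        rw [add_sub_cancel_left]
        exact mem_ball_one hs.1).trans (hmono (by norm_num))
    nlinarith
  · obtain ⟨r, hr, hwr⟩ := hout _ hvs
    have hwe : Ev (v + s₀) := (h.flip v s₀ hs₀).2 hvo
    have hro : ¬ Ev (v + s₀ + r) := by rw [h.flip _ r hr]; exact not_not.2 hwe
    have h1 : ∀ s ∈ S.filter (fun s => v + s₀ + s ∈ A),
        S.card ≤ outDeg S A (v + s₀ + s) + inDeg S A (v + s₀ + r + s) := fun s hs => by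
      rw [Finset.mem_filter] at hs
      have := h.card_le_outDeg_add_inDeg hs.2 hr
      rw [add_right_comm _ s r] at this
      exact this (h.outer hwr hro hs.1)
    have h2 := Finset.card_nsmul_le_sum _ _ _ h1
    rw [Finset.sum_add_distrib, smul_eq_mul, ← inDeg] at h2
    have h3 := (sum_outDeg_le (S := S) (A := A) (O := S.filter (fun s => v + s₀ + s ∈ A))
      (a := v + s₀) (v := v) (k := 2) fun s hs => by
        rw [Finset.mem_filter] at hs
        refine ⟨hs.2, ?_⟩
        rw [show v + s₀ + s - v = s₀ + s by abel]
        exact ball_add (mem_ball_one hs₀) (mem_ball_one hs.1)).trans (hmono (by norm_num))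
    have h4 := (sum_inDeg_le (S := S) (A := A) h.neg_mem
      (O := S.filter (fun s => v + s₀ + s ∈ A)) (a := v + s₀ + r) (v := v) (k := 3) fun s hs => by
        rw [Finset.mem_filter] at hs
        refine ⟨h.outer hwr hro hs.1, ?_⟩
        rw [show v + s₀ + r + s - v = s₀ + r + s by abel]
        exact ball_add (ball_add (mem_ball_one hs₀) (mem_ball_one hr)) (mem_ball_one hs.1))
    nlinarith

/-- The inner boundary of `A`. -/
def innerBdry (S A : Finset V) : Finset V := A.filter fun v => ∃ s ∈ S, v + s ∉ A

theorem mem_innerBdry {v : V} : v ∈ innerBdry S A ↔ v ∈ A ∧ ∃ s ∈ S, v + s ∉ A := by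
  simp [innerBdry]

/-- A small net of the inner boundary. -/
theorem IsOddSet.exists_net (h : IsOddSet S A Ev) (hin : ∀ v ∈ A, ∃ s ∈ S, v + s ∈ A)
    (hout : ∀ v ∉ A, ∃ s ∈ S, v + s ∉ A) :
    ∃ N ⊆ innerBdry S A, N.card * S.card ^ 2 ≤ 4 * (bdry S A).card ∧
      ∀ v ∈ innerBdry S A, ∃ a ∈ N, v - a ∈ ball S 8 := by
  classical
  -- A maximal 8-separated subset is an 8-net, and the edge sets `bdryNear` of radius 4 around its
  -- points are disjoint.
  let F : Finset (Finset V) := (innerBdry S A).powerset.filter fun N =>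
    ∀ a ∈ N, ∀ b ∈ N, a ≠ b → a - b ∉ ball S 8
  obtain ⟨N, hN, hmax⟩ := F.exists_max_image Finset.card ⟨∅, by simp [F]⟩
  rw [Finset.mem_filter, Finset.mem_powerset] at hN
  refine ⟨N, hN.1, ?_, fun v hv => ?_⟩
  · have hdis : (N : Set V).PairwiseDisjoint (bdryNear S A 4) := by
      intro a ha b hb hab
      rw [Function.onFun, Finset.disjoint_left]
      intro p hp hq
      rw [bdryNear, Finset.mem_filter] at hp hq
      exact hN.2 a ha b hb hab
        (sub_mem_ball_trans (sub_mem_ball_comm h.neg_mem hp.2) hq.2)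
    have h1 : ∑ a ∈ N, S.card ^ 2 ≤ ∑ a ∈ N, 4 * (bdryNear S A 4 a).card :=
      Finset.sum_le_sum fun a ha => by
        obtain ⟨ha, s, hs, has⟩ := mem_innerBdry.1 (hN.1 ha)
        exact h.sq_card_le hin hout ha hs has
    rw [← Finset.mul_sum, ← Finset.card_biUnion hdis, Finset.sum_const, smul_eq_mul] at h1
    refine h1.trans (Nat.mul_le_mul_left _ (Finset.card_le_card ?_))
    exact Finset.biUnion_subset.2 fun a _ => Finset.filter_subset _ _
  · by_contra! hcon
    have hvN : v ∉ N := fun hvN => hcon v hvN (by simpa using zero_mem_ball 8)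
    have := hmax (insert v N) (by
      simp only [F, Finset.mem_filter, Finset.mem_powerset]
      refine ⟨Finset.insert_subset hv hN.1, ?_⟩
      intro a ha b hb hab
      rw [Finset.mem_insert] at ha hb
      rcases ha with rfl | ha <;> rcases hb with rfl | hb
      · exact (hab rfl).elim
      · exact hcon b hb
      · exact fun hm => hcon a ha (sub_mem_ball_comm h.neg_mem hm)
      · exact hN.2 a ha b hb hab)
    rw [Finset.card_insert_of_notMem hvN] at this
    omega

end Cayley

/-! ### Coarse approximation through the level sets of three Hamming codes. -/

section Coarse

variable {V : Type*} [AddCommGroup V] [DecidableEq V]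

set_option linter.unusedSectionVars false

variable {S A : Finset V} {Ev : V → Prop}

/-- A walk of `k` steps whose ends are on different sides crosses the boundary. This places errors
and level boundaries close to the boundary of `A`. -/
theorem exists_innerBdry_near (hS : ∀ s ∈ S, -s ∈ S) {k : ℕ} : ∀ {z b : V}, b ∈ ball S k →
    ¬ (z ∈ A ↔ z + b ∈ A) → ∃ v ∈ innerBdry S A, z - v ∈ ball S k := by
  induction k with
  | zero =>
    intro z b hb h
    simp only [ball, zero_nsmul, Finset.mem_zero] at hb
    simp [hb] at h
  | succ k ih =>
    intro z b hb h
    rw [ball, succ_nsmul, Finset.mem_add] at hb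
    obtain ⟨b, hb, c, hc, rfl⟩ := hb
    by_cases h' : z ∈ A ↔ z + b ∈ A
    · rcases Finset.mem_insert.1 hc with rfl | hc
      · simp [h'] at h
      · rw [h', ← add_assoc] at h
        by_cases hz : z + b ∈ A
        · refine ⟨z + b, mem_innerBdry.2 ⟨hz, c, hc, fun h2 => h (by simp [hz, h2])⟩, ?_⟩
          rw [sub_add_cancel_left]
          exact ball_mono (Nat.le_succ k) (neg_mem_ball hS hb)
        · have h2 : z + b + c ∈ A := by
            by_contra h2
            exact h (by simp [hz, h2])
          refine ⟨z + b + c, mem_innerBdry.2 ⟨h2, -c, hS c hc, by simpa using hz⟩, ?_⟩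
          rw [show z - (z + b + c) = -(b + c) by abel]
          exact neg_mem_ball hS (ball_add hb (mem_ball_one hc))
    · obtain ⟨v, hv, hzv⟩ := ih hb h'
      exact ⟨v, hv, ball_mono (Nat.le_succ k) hzv⟩

/-- A syndrome map on the Cayley graph with generators `S`: a homomorphism to three copies of a
group `K` of exponent two, with a generator `g b a` for every value `a` of the `b`-th copy. -/
structure Syndrome (S : Finset V) (K : Type*) [AddCommGroup K] where
  Φ : V →+ (Fin 3 → K)
  g : Fin 3 → K → V
  g_zero : ∀ b, g b 0 = 0
  g_mem : ∀ b a, a ≠ 0 → g b a ∈ S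
  Φ_g : ∀ b a, Φ (g b a) = Pi.single b a
  Φ_mem : ∀ s ∈ S, ∃ b c, Φ s = Pi.single b c
  add_self : ∀ a : K, a + a = 0

namespace Syndrome

variable {K : Type*} [AddCommGroup K] (C : Syndrome S K)

theorem g_injective (b : Fin 3) : Function.Injective (C.g b) := fun a a' h => by
  have := congrArg C.Φ h
  rw [C.Φ_g, C.Φ_g] at this
  exact Pi.single_injective b this

theorem g_mem_ball (b : Fin 3) (a : K) : C.g b a ∈ ball S 1 := by
  by_cases h : a = 0
  · rw [h, C.g_zero]; exact zero_mem_ball 1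
  · exact mem_ball_one (C.g_mem b a h)

/-- The projection to the level set `κ` of the syndrome. -/
def proj (κ : Fin 3 → K) (z : V) : V := z + ∑ b, C.g b (C.Φ z b + κ b)

theorem Φ_proj (κ : Fin 3 → K) (z : V) : C.Φ (C.proj κ z) = κ := by
  rw [proj, map_add, map_sum]
  simp only [C.Φ_g]
  rw [Finset.univ_sum_single (fun b => C.Φ z b + κ b)]
  funext b
  rw [Pi.add_apply, ← add_assoc, C.add_self, zero_add]

theorem proj_eq_self {κ : Fin 3 → K} {r : V} (h : C.Φ r = κ) : C.proj κ r = r := by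
  subst h
  simp [proj, C.add_self, C.g_zero]

theorem proj_sub_mem (κ : Fin 3 → K) (z : V) : ∑ b, C.g b (C.Φ z b + κ b) ∈ ball S 3 := by
  rw [Fin.sum_univ_three]
  exact ball_add (ball_add (C.g_mem_ball _ _) (C.g_mem_ball _ _)) (C.g_mem_ball _ _)

/-- Adjacency inside the level sets of the syndrome. -/
def Adj (r r' : V) : Prop := C.Φ r = C.Φ r' ∧ ∃ b a a', r' + C.g b a' - (r + C.g b a) ∈ S

theorem Adj.symm {C : Syndrome S K} (hS : ∀ s ∈ S, -s ∈ S) {r r' : V} (h : C.Adj r r') :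
    C.Adj r' r := by
  obtain ⟨h, b, a, a', hs⟩ := h
  exact ⟨h.symm, b, a', a, by simpa using hS _ hs⟩

theorem Adj.sub_mem {C : Syndrome S K} (hS : ∀ s ∈ S, -s ∈ S) {r r' : V} (h : C.Adj r r') :
    r' - r ∈ ball S 3 := by
  obtain ⟨h, b, a, a', hs⟩ := h
  rw [show r' - r = (r' + C.g b a' - (r + C.g b a)) + C.g b a + -C.g b a' by abel]
  exact ball_add (ball_add (mem_ball_one hs) (C.g_mem_ball _ _))
    (neg_mem_ball hS (C.g_mem_ball _ _))

/-- A generator changes the syndrome in at most one block, so the corrections in the other two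
blocks agree for `z` and `z + s` and cancel. -/
theorem adj_proj (κ : Fin 3 → K) (z : V) {s : V} (hs : s ∈ S) :
    C.Adj (C.proj κ z) (C.proj κ (z + s)) := by
  refine ⟨by rw [C.Φ_proj, C.Φ_proj], ?_⟩
  obtain ⟨b, c, hbc⟩ := C.Φ_mem s hs
  refine ⟨b, C.Φ z b + c + κ b, C.Φ z b + κ b, ?_⟩
  have h1 : ∀ f : Fin 3 → V, ∑ i, f i = f b + ∑ i ∈ Finset.univ.erase b, f i := fun f =>
    (Finset.add_sum_erase _ _ (Finset.mem_univ b)).symm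
  rw [proj, proj, h1, h1 fun i => C.g i (C.Φ z i + κ i)]
  have h2 : ∑ i ∈ Finset.univ.erase b, C.g i (C.Φ (z + s) i + κ i)
      = ∑ i ∈ Finset.univ.erase b, C.g i (C.Φ z i + κ i) := by
    refine Finset.sum_congr rfl fun i hi => ?_
    rw [map_add, hbc, Pi.add_apply, Pi.single_eq_of_ne (Finset.ne_of_mem_erase hi), add_zero]
  rw [h2, map_add, hbc, Pi.add_apply, Pi.single_eq_same]
  convert hs using 1
  abel

/-- Level sets are connected for `Adj`: a path in the whole graph projects to a path in the level,
and the projection fixes the level. -/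
theorem iff_of_adj (hgen : ∀ Q : V → Prop, (∀ z, ∀ s ∈ S, (Q z ↔ Q (z + s))) → ∀ z z', Q z ↔ Q z')
    {κ : Fin 3 → K} {P : V → Prop} (hP : ∀ r r', C.Φ r = κ → C.Adj r r' → (P r ↔ P r')) {r r' : V}
    (hr : C.Φ r = κ) (hr' : C.Φ r' = κ) : P r ↔ P r' := by
  have := hgen (fun z => P (C.proj κ z)) (fun z s hs => hP _ _ (C.Φ_proj κ z) (C.adj_proj κ z hs))
    r r'
  rwa [C.proj_eq_self hr, C.proj_eq_self hr'] at this

variable [Fintype V]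

open Classical in
/-- The vertices of `A` on the level set `κ` with a neighbour outside `A`. -/
noncomputable def inner (A : Finset V) (κ : Fin 3 → K) : Finset V :=
  Finset.univ.filter fun r => C.Φ r = κ ∧ r ∈ A ∧ ∃ r' ∉ A, C.Adj r r'

open Classical in
/-- The vertices outside `A` on the level set `κ` with a neighbour in `A`. -/
noncomputable def outer (A : Finset V) (κ : Fin 3 → K) : Finset V :=
  Finset.univ.filter fun r' => C.Φ r' = κ ∧ r' ∉ A ∧ ∃ r ∈ A, C.Adj r r'

theorem mem_inner {κ : Fin 3 → K} {r : V} :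
    r ∈ C.inner A κ ↔ C.Φ r = κ ∧ r ∈ A ∧ ∃ r' ∉ A, C.Adj r r' := by
  simp [inner]

theorem mem_outer {κ : Fin 3 → K} {r' : V} :
    r' ∈ C.outer A κ ↔ C.Φ r' = κ ∧ r' ∉ A ∧ ∃ r ∈ A, C.Adj r r' := by
  simp [outer]

/-- The vertices that are on a different side of `A` than their projections. -/
def err (A : Finset V) (κ : Fin 3 → K) : Finset V :=
  Finset.univ.filter fun z => ¬ (z ∈ A ↔ C.proj κ z ∈ A)

/-- The two boundaries on a level set determine a set on the level set, up to a complement. -/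
theorem eq_of_inner_eq (hS : ∀ s ∈ S, -s ∈ S)
    (hgen : ∀ Q : V → Prop, (∀ z, ∀ s ∈ S, (Q z ↔ Q (z + s))) → ∀ z z', Q z ↔ Q z')
    {A B : Finset V} {κ : Fin 3 → K} (hi : C.inner A κ = C.inner B κ)
    (ho : C.outer A κ = C.outer B κ) (h0 : C.proj κ 0 ∈ A ↔ C.proj κ 0 ∈ B) (z : V) :
    C.proj κ z ∈ A ↔ C.proj κ z ∈ B := by
  -- The ends of a level edge leaving `A` lie in the shared boundaries, so the edge leaves `B` in
  -- the same direction. Hence agreement of `A` and `B` propagates along level edges.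
  have key : ∀ {A B : Finset V}, C.inner A κ = C.inner B κ → C.outer A κ = C.outer B κ →
      ∀ r r', C.Φ r = κ → C.Adj r r' → r ∈ A → r' ∉ A → r ∈ B ∧ r' ∉ B := by
    intro A B hi ho r r' hr hrr' hrA hrA'
    have h1 : r ∈ C.inner A κ := C.mem_inner.2 ⟨hr, hrA, r', hrA', hrr'⟩
    have h2 : r' ∈ C.outer A κ :=
      C.mem_outer.2 ⟨hrr'.1.symm.trans hr, hrA', r, hrA, hrr'⟩
    rw [hi, mem_inner] at h1
    rw [ho, mem_outer] at h2
    exact ⟨h1.2.1, h2.2.1⟩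
  have := C.iff_of_adj hgen (P := fun r => r ∈ A ↔ r ∈ B) (κ := κ) (fun r r' hr hrr' => by
    have k1 := key hi ho r r' hr hrr'
    have k2 := key hi ho r' r (hrr'.1.symm.trans hr) (hrr'.symm hS)
    have k3 := key hi.symm ho.symm r r' hr hrr'
    have k4 := key hi.symm ho.symm r' r (hrr'.1.symm.trans hr) (hrr'.symm hS)
    clear key hi ho h0 hgen
    by_cases a1 : r ∈ A <;> by_cases a2 : r' ∈ A <;> by_cases a3 : r ∈ B <;>
      by_cases a4 : r' ∈ B <;> simp_all) (C.Φ_proj κ 0) (C.Φ_proj κ z)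
  exact this.1 h0

variable [Fintype K]

open Classical in
/-- The triples parametrizing the edges inside the level sets, in the `b`-th copy, that leave
`A`. -/
noncomputable def crossing (A : Finset V) (b : Fin 3) : Finset (V × K × V) :=
  (Finset.univ ×ˢ Finset.univ ×ˢ S).filter fun p =>
    p.1 ∈ A ∧ p.1 + C.g b p.2.1 + p.2.2 - C.g b (p.2.1 + C.Φ p.2.2 b) ∉ A

/-- A level edge is a path of at most three edges: a correction, a generator, a reversed correction.
One of them leaves `A`. If it is a correction, it leaves only `s` free, giving a factor `S.card` in
two cases; if it is the generator, only the value in `K` is free. -/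
theorem card_crossing_le (hS : ∀ s ∈ S, -s ∈ S) (b : Fin 3) :
    (C.crossing A b).card ≤ (bdry S A).card * (2 * S.card + Fintype.card K) := by
  classical
  let T₁ : Finset (V × K × V) := (Finset.univ ×ˢ Finset.univ ×ˢ S).filter fun p =>
    (p.1, C.g b p.2.1) ∈ bdry S A
  let T₂ : Finset (V × K × V) := (Finset.univ ×ˢ Finset.univ ×ˢ S).filter fun p =>
    (p.1 + C.g b p.2.1, p.2.2) ∈ bdry S A
  let T₃ : Finset (V × K × V) := (Finset.univ ×ˢ Finset.univ ×ˢ S).filter fun p =>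
    (p.1 + C.g b p.2.1 + p.2.2, -C.g b (p.2.1 + C.Φ p.2.2 b)) ∈ bdry S A
  have hg : ∀ {v : V} {a : K}, v ∈ A → v + C.g b a ∉ A → (v, C.g b a) ∈ bdry S A :=
    fun {v a} hv hva => mem_bdry.2 ⟨hv, C.g_mem b a (by
      rintro rfl; rw [C.g_zero, add_zero] at hva; exact hva hv), hva⟩
  have hg' : ∀ {v : V} {a : K}, v ∈ A → v + -C.g b a ∉ A → (v, -C.g b a) ∈ bdry S A :=
    fun {v a} hv hva => mem_bdry.2 ⟨hv, hS _ (C.g_mem b a (by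
      rintro rfl; rw [C.g_zero, neg_zero, add_zero] at hva; exact hva hv)), hva⟩
  have hsub : C.crossing A b ⊆ T₁ ∪ T₂ ∪ T₃ := by
    rintro ⟨r, a, s⟩ hp
    rw [crossing, Finset.mem_filter] at hp
    obtain ⟨hm, h1, h2⟩ := hp
    have hs : s ∈ S := by simpa using hm
    simp only [T₁, T₂, T₃, Finset.mem_union, Finset.mem_filter, hm, true_and]
    dsimp only at h1 h2 ⊢
    by_cases h3 : r + C.g b a ∈ A
    · by_cases h4 : r + C.g b a + s ∈ A
      · right; exact hg' h4 (by rwa [← sub_eq_add_neg])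
      · left; right; exact mem_bdry.2 ⟨h3, hs, h4⟩
    · left; left; exact hg h1 h3
  have h₁ : T₁.card ≤ (bdry S A ×ˢ S).card := by
    refine Finset.card_le_card_of_injOn (fun p => ((p.1, C.g b p.2.1), p.2.2)) ?_ ?_
    · rintro ⟨r, a, s⟩ hp
      simp only [T₁, Finset.coe_filter, Set.mem_ofPred_eq, Finset.mem_product] at hp
      simp only [Finset.coe_product, Set.mem_prod, Finset.mem_coe]
      exact ⟨hp.2, hp.1.2.2⟩
    · rintro ⟨r, a, s⟩ _ ⟨r', a', s'⟩ _ h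
      simp only [Prod.mk.injEq] at h
      obtain ⟨⟨rfl, h⟩, rfl⟩ := h
      rw [C.g_injective b h]
  have h₂ : T₂.card ≤ (bdry S A ×ˢ (Finset.univ : Finset K)).card := by
    refine Finset.card_le_card_of_injOn (fun p => ((p.1 + C.g b p.2.1, p.2.2), p.2.1)) ?_ ?_
    · rintro ⟨r, a, s⟩ hp
      simp only [T₂, Finset.coe_filter, Set.mem_ofPred_eq, Finset.mem_product] at hp
      simp only [Finset.coe_product, Set.mem_prod, Finset.mem_coe]
      exact ⟨hp.2, Finset.mem_univ _⟩
    · rintro ⟨r, a, s⟩ _ ⟨r', a', s'⟩ _ h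
      simp only [Prod.mk.injEq] at h
      obtain ⟨⟨h, rfl⟩, rfl⟩ := h
      rw [add_left_inj] at h
      rw [h]
  have h₃ : T₃.card ≤ (bdry S A ×ˢ S).card := by
    refine Finset.card_le_card_of_injOn
      (fun p => ((p.1 + C.g b p.2.1 + p.2.2, -C.g b (p.2.1 + C.Φ p.2.2 b)), p.2.2)) ?_ ?_
    · rintro ⟨r, a, s⟩ hp
      simp only [T₃, Finset.coe_filter, Set.mem_ofPred_eq, Finset.mem_product] at hp
      simp only [Finset.coe_product, Set.mem_prod, Finset.mem_coe]
      exact ⟨hp.2, hp.1.2.2⟩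
    · rintro ⟨r, a, s⟩ _ ⟨r', a', s'⟩ _ h
      simp only [Prod.mk.injEq, neg_inj] at h
      obtain ⟨⟨h, h'⟩, rfl⟩ := h
      have := C.g_injective b h'
      rw [add_left_inj] at this
      subst this
      simp only [add_left_inj] at h
      rw [h]
  have := (Finset.card_le_card hsub).trans ((Finset.card_union_le _ _).trans
    (Nat.add_le_add_right (Finset.card_union_le _ _) _))
  rw [Finset.card_product] at h₁ h₂ h₃
  rw [Finset.card_univ] at h₂
  nlinarith

theorem Adj.exists_crossing {C : Syndrome S K} {r r' : V} (h : C.Adj r r') (hr : r ∈ A)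
    (hr' : r' ∉ A) : ∃ b, ∃ p ∈ C.crossing A b, p.1 = r ∧
      p.1 + C.g b p.2.1 + p.2.2 - C.g b (p.2.1 + C.Φ p.2.2 b) = r' := by
  obtain ⟨h, b, a, a', hs⟩ := h
  have h1 : a + C.Φ (r' + C.g b a' - (r + C.g b a)) b = a' := by
    rw [map_sub, map_add, map_add, h, C.Φ_g, C.Φ_g]
    simp
  have h2 : r + C.g b a + (r' + C.g b a' - (r + C.g b a)) - C.g b a' = r' := by abel
  refine ⟨b, (r, a, r' + C.g b a' - (r + C.g b a)), ?_, rfl, ?_⟩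
  · simp only [crossing, Finset.mem_filter, Finset.mem_product, Finset.mem_univ, true_and]
    rw [h1, h2]
    exact ⟨hs, hr, hr'⟩
  · dsimp only
    rw [h1, h2]

theorem sum_card_level [DecidableEq K] (F : (Fin 3 → K) → Finset V) (T : Finset V)
    (h : ∀ κ, ∀ r ∈ F κ, C.Φ r = κ ∧ r ∈ T) : ∑ κ, (F κ).card ≤ T.card := by
  rw [← Finset.card_biUnion]
  · exact Finset.card_le_card (Finset.biUnion_subset.2 fun κ _ r hr => (h κ r hr).2)
  · intro κ _ κ' _ hne
    rw [Function.onFun, Finset.disjoint_left]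
    intro r hr hr'
    exact hne ((h κ r hr).1.symm.trans (h κ' r hr').1)

theorem sum_inner_le [DecidableEq K] (hS : ∀ s ∈ S, -s ∈ S) :
    ∑ κ, (C.inner A κ).card ≤ 3 * ((bdry S A).card * (2 * S.card + Fintype.card K)) := by
  refine (C.sum_card_level (fun κ => C.inner A κ)
    (Finset.univ.biUnion fun b => (C.crossing A b).image fun p => p.1) fun κ r hr => ?_).trans ?_
  · obtain ⟨hκ, hrA, r', hr', hrr'⟩ := C.mem_inner.1 hr
    obtain ⟨b, p, hp, hpr, -⟩ := hrr'.exists_crossing hrA hr'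
    exact ⟨hκ, Finset.mem_biUnion.2 ⟨b, Finset.mem_univ _, Finset.mem_image.2 ⟨p, hp, hpr⟩⟩⟩
  · refine (Finset.card_biUnion_le_card_mul _ _ _ fun b _ =>
      Finset.card_image_le.trans (C.card_crossing_le hS b)).trans ?_
    simp

theorem sum_outer_le [DecidableEq K] (hS : ∀ s ∈ S, -s ∈ S) :
    ∑ κ, (C.outer A κ).card ≤ 3 * ((bdry S A).card * (2 * S.card + Fintype.card K)) := by
  refine (C.sum_card_level (fun κ => C.outer A κ)
    (Finset.univ.biUnion fun b => (C.crossing A b).image fun p =>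
      p.1 + C.g b p.2.1 + p.2.2 - C.g b (p.2.1 + C.Φ p.2.2 b)) fun κ r hr => ?_).trans ?_
  · obtain ⟨hκ, hrA, r', hr', hrr'⟩ := C.mem_outer.1 hr
    obtain ⟨b, p, hp, -, hpr⟩ := hrr'.exists_crossing hr' hrA
    exact ⟨hκ, Finset.mem_biUnion.2 ⟨b, Finset.mem_univ _, Finset.mem_image.2 ⟨p, hp, hpr⟩⟩⟩
  · refine (Finset.card_biUnion_le_card_mul _ _ _ fun b _ =>
      Finset.card_image_le.trans (C.card_crossing_le hS b)).trans ?_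
    simp

/-- The pairs of a vertex `y` and a vector `a` for which the step from `y` along `g b (a b)`
changes the side of `A`. -/
def stepCross (A : Finset V) (b : Fin 3) : Finset (V × (Fin 3 → K)) :=
  Finset.univ.filter fun p => ¬ (p.1 ∈ A ↔ p.1 + C.g b (p.2 b) ∈ A)

/-- The step traverses a boundary edge in one of two directions. By injectivity of `g b`, that edge
fixes `y` and `a b`, and the two remaining entries of `a` are free. -/
theorem card_stepCross_le [DecidableEq K] (hS : ∀ s ∈ S, -s ∈ S) (b : Fin 3) :
    (C.stepCross A b).card ≤ 2 * (Fintype.card K ^ 2 * (bdry S A).card) := by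
  let R := {i : Fin 3 // i ≠ b} → K
  have hR : Fintype.card R = Fintype.card K ^ 2 := by
    rw [Fintype.card_fun]
    congr 1
    rw [Fintype.card_subtype_compl, Fintype.card_subtype_eq]
    rfl
  let T₁ : Finset (V × (Fin 3 → K)) :=
    Finset.univ.filter fun p => (p.1, C.g b (p.2 b)) ∈ bdry S A
  let T₂ : Finset (V × (Fin 3 → K)) :=
    Finset.univ.filter fun p => (p.1 + C.g b (p.2 b), -C.g b (p.2 b)) ∈ bdry S A
  have hsub : C.stepCross A b ⊆ T₁ ∪ T₂ := by
    rintro ⟨y, a⟩ hp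
    simp only [stepCross, Finset.mem_filter, Finset.mem_univ, true_and] at hp
    have h0 : a b ≠ 0 := fun h0 => hp (by simp [h0, C.g_zero])
    simp only [T₁, T₂, Finset.mem_union, Finset.mem_filter, Finset.mem_univ, true_and, mem_bdry,
      C.g_mem b _ h0, hS _ (C.g_mem b _ h0), add_neg_cancel_right]
    tauto
  have hfun : ∀ a a' : Fin 3 → K, a b = a' b →
      (fun i : {i : Fin 3 // i ≠ b} => a i) = (fun i : {i : Fin 3 // i ≠ b} => a' i) → a = a' := fun a a' h h' => by
    funext i
    by_cases hi : i = b
    · rw [hi, h]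
    · exact congrFun h' ⟨i, hi⟩
  have h₁ : T₁.card ≤ (bdry S A ×ˢ (Finset.univ : Finset R)).card := by
    refine Finset.card_le_card_of_injOn (fun p => ((p.1, C.g b (p.2 b)), fun i => p.2 i)) ?_ ?_
    · rintro ⟨y, a⟩ hp
      simpa [T₁] using hp
    · rintro ⟨y, a⟩ _ ⟨y', a'⟩ _ h
      simp only [Prod.mk.injEq] at h
      obtain ⟨⟨rfl, h⟩, h'⟩ := h
      rw [hfun a a' (C.g_injective b h) h']
  have h₂ : T₂.card ≤ (bdry S A ×ˢ (Finset.univ : Finset R)).card := by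
    refine Finset.card_le_card_of_injOn
      (fun p => ((p.1 + C.g b (p.2 b), -C.g b (p.2 b)), fun i => p.2 i)) ?_ ?_
    · rintro ⟨y, a⟩ hp
      simpa [T₂] using hp
    · rintro ⟨y, a⟩ _ ⟨y', a'⟩ _ h
      simp only [Prod.mk.injEq, neg_inj] at h
      obtain ⟨⟨h1, h⟩, h'⟩ := h
      obtain rfl := hfun a a' (C.g_injective b h) h'
      rw [add_left_inj] at h1
      rw [h1]
  have := (Finset.card_le_card hsub).trans (Finset.card_union_le _ _)
  rw [Finset.card_product, Finset.card_univ, hR] at h₁ h₂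
  linarith

/-- For fixed `z`, the level `κ` is encoded by the correction vector `a = Φ z + κ`. The projection
moves `z` by three successive steps along `a`, and an erroneous `z` changes side at one of them. -/
theorem sum_err_le [DecidableEq K] (hS : ∀ s ∈ S, -s ∈ S) :
    ∑ κ, (C.err A κ).card ≤ 6 * (Fintype.card K ^ 2 * (bdry S A).card) := by
  let y : Fin 3 → V × (Fin 3 → K) → V := ![fun p => p.1, fun p => p.1 + C.g 0 (p.2 0),
    fun p => p.1 + C.g 0 (p.2 0) + C.g 1 (p.2 1)]
  let T : Fin 3 → Finset (V × (Fin 3 → K)) := fun b => Finset.univ.filter fun p =>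
    (y b p, p.2) ∈ C.stepCross A b
  have hT : ∀ b, (T b).card ≤ (C.stepCross A b).card := fun b => by
    refine Finset.card_le_card_of_injOn (fun p => (y b p, p.2)) (fun p hp => ?_) ?_
    · simpa [T] using hp
    · rintro ⟨z, a⟩ _ ⟨z', a'⟩ _ h
      simp only [Prod.mk.injEq] at h
      obtain ⟨h, rfl⟩ := h
      fin_cases b <;> simp [y] at h <;> rw [h]
  have hTm : ∀ b p, p ∈ T b ↔ ¬ (y b p ∈ A ↔ y b p + C.g b (p.2 b) ∈ A) := fun b p => by
    simp [T, stepCross]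
  have h1 : ∑ κ, (C.err A κ).card ≤ (T 0 ∪ T 1 ∪ T 2).card := by
    rw [← Finset.card_sigma]
    refine Finset.card_le_card_of_injOn (fun p => (p.2, C.Φ p.2 + p.1)) ?_ ?_
    · rintro ⟨κ, z⟩ hp
      simp only [Finset.coe_sigma, Set.mem_sigma_iff, Finset.mem_coe, Finset.mem_univ, true_and,
        err, Finset.mem_filter, proj, Fin.sum_univ_three] at hp
      rw [Finset.mem_coe, Finset.mem_union, Finset.mem_union, hTm, hTm, hTm]
      simp only [y, Pi.add_apply, Matrix.cons_val]
      simp only [← add_assoc] at hp ⊢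
      tauto
    · rintro ⟨κ, z⟩ _ ⟨κ', z'⟩ _ h
      simp only [Prod.mk.injEq] at h
      obtain ⟨rfl, h⟩ := h
      rw [add_right_inj] at h
      rw [h]
  have h2 := (Finset.card_union_le (T 0 ∪ T 1) (T 2)).trans
    (Nat.add_le_add_right (Finset.card_union_le _ _) _)
  have h3 := fun b => (hT b).trans (C.card_stepCross_le (A := A) hS b)
  have := h3 0; have := h3 1; have := h3 2
  linarith

/-- There is a level set on which the coarse approximation is good and cheap. -/
theorem exists_level (hS : ∀ s ∈ S, -s ∈ S) : ∃ κ,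
    Fintype.card K * (C.err A κ).card ≤ 12 * (bdry S A).card ∧
    Fintype.card K ^ 3 * ((C.inner A κ).card + (C.outer A κ).card) ≤
      12 * (2 * S.card + Fintype.card K) * (bdry S A).card := by
  classical
  set k := Fintype.card K
  have hk : 0 < k := Fintype.card_pos
  set M := 2 * S.card + k
  have hM : 0 < M := by omega
  set L := (bdry S A).card
  have h1 := C.sum_err_le (A := A) hS
  have h2 := C.sum_inner_le (A := A) hS
  have h3 := C.sum_outer_le (A := A) hS
  -- With these weights the two terms have the same bound `6 * M * L` on average over the `k ^ 3`
  -- levels, so one level is good for both.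
  have hsum : ∑ κ, (M * k * (C.err A κ).card + k ^ 3 * ((C.inner A κ).card + (C.outer A κ).card))
      ≤ ∑ κ : Fin 3 → K, 12 * M * L := by
    rw [Finset.sum_add_distrib, ← Finset.mul_sum, ← Finset.mul_sum, Finset.sum_add_distrib,
      Finset.sum_const, Finset.card_univ, Fintype.card_fun, Fintype.card_fin, smul_eq_mul]
    calc _ ≤ M * k * (6 * (k ^ 2 * L)) + k ^ 3 * (3 * (L * M) + 3 * (L * M)) := by gcongr
      _ = _ := by ring
  obtain ⟨κ, -, hκ⟩ := Finset.exists_le_of_sum_le ⟨0, Finset.mem_univ _⟩ hsum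
  refine ⟨κ, ?_, ?_⟩
  · have : M * (k * (C.err A κ).card) ≤ M * (12 * L) := by
      rw [← mul_assoc, ← mul_assoc, mul_comm M 12]; omega
    exact Nat.le_of_mul_le_mul_left this hM
  · omega

end Syndrome

end Coarse

/-! ### Greedy dominating sets. -/

section Domination

open scoped Classical in
/-- Greedy domination: if every element of `X` has at least `t` neighbours in `Y` and every element
of `Y` has at most `D` neighbours in `X`, then a small part of `Y` dominates `X`. -/
theorem exists_dominating {α β : Type*} (X : Finset α) (Y : Finset β) (r : α → β → Prop) {t : ℝ}
    (ht : 0 < t) (D : ℕ) (hX : ∀ x ∈ X, t ≤ ((Y.filter fun y => r x y).card : ℝ))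
    (hY : ∀ y ∈ Y, (X.filter fun x => r x y).card ≤ D) :
    ∃ Y₀ ⊆ Y, (Y₀.card : ℝ) ≤ Y.card / t * (Real.log D + 1) + 1 ∧ ∀ x ∈ X, ∃ y ∈ Y₀, r x y := by
  rcases X.eq_empty_or_nonempty with rfl | ⟨x₀, hx₀⟩
  · refine ⟨∅, Finset.empty_subset _, ?_, by simp⟩
    have := Real.log_natCast_nonneg D
    rw [Finset.card_empty, Nat.cast_zero]
    positivity
  have htN : t ≤ (Y.card : ℝ) := (hX x₀ hx₀).trans (by
    exact_mod_cast Finset.card_le_card (Finset.filter_subset _ _))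
  have hN : (0 : ℝ) < Y.card := ht.trans_le htN
  have hdc : ∀ X' ⊆ X, t * X'.card ≤ ∑ y ∈ Y, ((X'.filter fun x => r x y).card : ℝ) := by
    intro X' hX'
    have h1 : ∑ y ∈ Y, ((X'.filter fun x => r x y).card : ℝ)
        = ∑ x ∈ X', ((Y.filter fun y => r x y).card : ℝ) := by
      have := Finset.sum_card_bipartiteAbove_eq_sum_card_bipartiteBelow (s := X') (t := Y) r
      simp only [Finset.bipartiteAbove, Finset.bipartiteBelow] at this
      exact_mod_cast this.symm
    rw [h1, mul_comm, ← nsmul_eq_mul]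
    exact Finset.card_nsmul_le_sum _ _ _ fun x hx => hX x (hX' hx)
  -- By double counting, some vertex of `Y` dominates at least the fraction `t / Y.card` of what
  -- remains undominated.
  have hstep : ∀ k : ℕ, ∃ Y₀ ⊆ Y, Y₀.card ≤ k ∧
      ((X.filter fun x => ∀ y ∈ Y₀, ¬ r x y).card : ℝ) ≤ X.card * (1 - t / Y.card) ^ k := by
    intro k
    induction k with
    | zero =>
      refine ⟨∅, Finset.empty_subset _, le_rfl, ?_⟩
      simp
    | succ k ih =>
      obtain ⟨Y₀, hY₀, hc, hu⟩ := ih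
      set X' := X.filter fun x => ∀ y ∈ Y₀, ¬ r x y with hX'
      have hsum : ∑ y ∈ Y, (t * X'.card / Y.card) ≤ ∑ y ∈ Y, ((X'.filter fun x => r x y).card : ℝ) := by
        rw [Finset.sum_const, nsmul_eq_mul, mul_div_cancel₀ _ hN.ne']
        exact hdc X' (Finset.filter_subset _ _)
      obtain ⟨y, hy, hyl⟩ := Finset.exists_le_of_sum_le
        (Finset.card_pos.1 (by exact_mod_cast hN)) hsum
      refine ⟨insert y Y₀, Finset.insert_subset hy hY₀, (Finset.card_insert_le _ _).trans (by omega),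
        ?_⟩
      have h2 : (X.filter fun x => ∀ y' ∈ insert y Y₀, ¬ r x y') = X'.filter fun x => ¬ r x y := by
        ext x
        simp only [hX', Finset.mem_filter, Finset.mem_insert, forall_eq_or_imp]
        tauto
      have h3 := Finset.card_filter_add_card_filter_not (s := X') (fun x => r x y)
      have h4 : ((X'.filter fun x => ¬ r x y).card : ℝ)
          = X'.card - (X'.filter fun x => r x y).card := by
        rw [← h3]; push_cast; ring
      rw [h2, h4, pow_succ, ← mul_assoc]
      have h5 : (0 : ℝ) ≤ 1 - t / Y.card := by
        rw [sub_nonneg, div_le_one hN]; exact htN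
      calc (X'.card : ℝ) - (X'.filter fun x => r x y).card ≤ X'.card * (1 - t / Y.card) := by
            have : t * X'.card / Y.card = X'.card * (t / Y.card) := by ring
            linarith
        _ ≤ _ := mul_le_mul_of_nonneg_right hu h5
  have hD : 1 ≤ D := by
    have h1 : 0 < (Y.filter fun y => r x₀ y).card := by
      exact_mod_cast ht.trans_le (hX x₀ hx₀)
    obtain ⟨y, hy⟩ := Finset.card_pos.1 h1
    rw [Finset.mem_filter] at hy
    exact (Finset.card_pos.2 ⟨x₀, Finset.mem_filter.2 ⟨hx₀, hy.2⟩⟩).trans_le (hY y hy.1)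
  have hD' : (0 : ℝ) < D := by exact_mod_cast hD
  have hXD : (X.card : ℝ) / D ≤ Y.card / t := by
    rw [div_le_div_iff₀ hD' ht, mul_comm]
    refine (hdc X subset_rfl).trans ?_
    rw [← nsmul_eq_mul]
    exact Finset.sum_le_card_nsmul _ _ _ fun y hy => by exact_mod_cast hY y hy
  -- After this many greedy steps at most `X.card / D ≤ Y.card / t` elements are undominated; each
  -- of these then receives a neighbour of its own.
  obtain ⟨Y₀, hY₀, hc, hu⟩ := hstep ⌈Y.card / t * Real.log D⌉₊
  set X' := X.filter fun x => ∀ y ∈ Y₀, ¬ r x y with hX'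
  have hlog := Real.log_natCast_nonneg D
  have hu' : (X'.card : ℝ) ≤ Y.card / t := by
    refine hu.trans (le_trans ?_ hXD)
    rw [div_eq_mul_inv]
    refine mul_le_mul_of_nonneg_left ?_ (Nat.cast_nonneg _)
    have h1 : 1 - t / Y.card ≤ Real.exp (-(t / Y.card)) := by
      have := Real.add_one_le_exp (-(t / Y.card)); linarith
    have h5 : (0 : ℝ) ≤ 1 - t / Y.card := by
      rw [sub_nonneg, div_le_one hN]; exact htN
    refine (pow_le_pow_left₀ h5 h1 _).trans ?_
    rw [← Real.exp_nat_mul, ← Real.exp_log hD', ← Real.exp_neg, Real.exp_le_exp, Real.exp_log hD']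
    have h2 := Nat.le_ceil (Y.card / t * Real.log D)
    have h3 : Real.log D = Y.card / t * Real.log D * (t / Y.card) := by
      field_simp
    have h4 := mul_le_mul_of_nonneg_right h2 (div_pos ht hN).le
    linarith
  have hex : ∀ x ∈ X, ∃ y ∈ Y, r x y := fun x hx => by
    have h1 : 0 < (Y.filter fun y => r x y).card := by
      exact_mod_cast ht.trans_le (hX x hx)
    obtain ⟨y, hy⟩ := Finset.card_pos.1 h1
    rw [Finset.mem_filter] at hy
    exact ⟨y, hy⟩
  have : Nonempty β := ⟨(hex x₀ hx₀).choose⟩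
  choose! f hfY hfr using hex
  refine ⟨Y₀ ∪ X'.image f, Finset.union_subset hY₀ ?_, ?_, fun x hx => ?_⟩
  · intro y hy
    obtain ⟨x, hx, rfl⟩ := Finset.mem_image.1 hy
    exact hfY x (Finset.mem_filter.1 hx).1
  · have h1 : ((Y₀ ∪ X'.image f).card : ℝ) ≤ Y₀.card + X'.card := by
      exact_mod_cast (Finset.card_union_le _ _).trans (Nat.add_le_add_left Finset.card_image_le _)
    have h2 : (Y₀.card : ℝ) ≤ Y.card / t * Real.log D + 1 :=
      (Nat.cast_le.2 hc).trans (Nat.ceil_lt_add_one (by positivity)).le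
    linarith
  · by_cases h : ∃ y ∈ Y₀, r x y
    · obtain ⟨y, hy, hr⟩ := h
      exact ⟨y, Finset.mem_union_left _ hy, hr⟩
    · push Not at h
      exact ⟨f x, Finset.mem_union_right _ (Finset.mem_image_of_mem f
        (Finset.mem_filter.2 ⟨hx, h⟩)), hfr x hx⟩

end Domination

/-! ### Correcting a coarse approximation. -/

section Refine

variable {V : Type*} [AddCommGroup V] [DecidableEq V]

set_option linter.unusedSectionVars false

variable {S A : Finset V} {Ev : V → Prop}

open Classical in
/-- The number of neighbours of `v` in `B` that are not neighbours of `U₀`. -/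
noncomputable def freeDeg (S : Finset V) (B : Set V) (U₀ : Finset V) (v : V) : ℕ :=
  (S.filter fun s => v + s ∈ B ∧ ∀ u ∈ U₀, v + s - u ∉ S).card

/-- The approximation reconstructed from a coarse approximation `B` and from correcting sets `U₀`
and `Y₀`. -/
def refined (S : Finset V) (Ev : V → Prop) (t : ℝ) (B : Set V) (U₀ Y₀ : Finset V) : Set V :=
  {v | (∃ y ∈ Y₀, v - y ∈ S) ∨ (¬ Ev v ∧ t < freeDeg S B U₀ v)}

variable [Fintype V]

open Classical in
-- Odd vertices `u` outside `A` are added to `U₀` as long as each covers more than `t` new errors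
-- (vertices of `B` outside `A`). This bounds `U₀`, and by maximality no such `u` retains more than
-- `t` uncovered neighbours in `B`.
theorem exists_greedy (S A : Finset V) (Ev : V → Prop) (B : Set V) {t : ℝ} (ht : 0 < t) :
    ∃ U₀ : Finset V, (∀ u ∈ U₀, u ∉ A ∧ ¬ Ev u ∧ ∃ s ∈ S, u + s ∉ A ∧ u + s ∈ B) ∧
      U₀.card * t ≤ ((Finset.univ.filter fun w => w ∉ A ∧ w ∈ B).card : ℝ) ∧
      ∀ u ∉ A, ¬ Ev u → (∀ s ∈ S, u + s ∉ A) → (freeDeg S B U₀ u : ℝ) ≤ t := by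
  let cov : Finset V → Finset V := fun U₀ =>
    Finset.univ.filter fun w => (w ∉ A ∧ w ∈ B) ∧ ∃ u ∈ U₀, w - u ∈ S
  let F : Finset (Finset V) := Finset.univ.filter fun U₀ =>
    (∀ u ∈ U₀, u ∉ A ∧ ¬ Ev u ∧ ∃ s ∈ S, u + s ∉ A ∧ u + s ∈ B) ∧
      U₀.card * t ≤ ((cov U₀).card : ℝ)
  obtain ⟨U₀, hU₀, hmax⟩ := F.exists_max_image Finset.card ⟨∅, by simp [F]⟩
  simp only [F, Finset.mem_filter, Finset.mem_univ, true_and] at hU₀ hmax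
  refine ⟨U₀, hU₀.1, hU₀.2.trans ?_, fun u hu hue hus => ?_⟩
  · refine Nat.cast_le.2 (Finset.card_le_card fun w hw => ?_)
    simp only [cov, Finset.mem_filter, Finset.mem_univ, true_and] at hw ⊢
    exact hw.1
  by_contra! hcon
  rw [freeDeg] at hcon
  obtain ⟨T, hT⟩ : ∃ T, T = S.filter fun s => u + s ∈ B ∧ ∀ u' ∈ U₀, u + s - u' ∉ S := ⟨_, rfl⟩
  replace hcon : t < (T.card : ℝ) := by refine hcon.trans_eq ?_; rw [hT]; congr!
  have hTpos : 0 < T.card := by exact_mod_cast ht.trans hcon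
  obtain ⟨s₀, hs₀⟩ := Finset.card_pos.1 hTpos
  rw [hT, Finset.mem_filter] at hs₀
  have huU : u ∉ U₀ := fun h => hs₀.2.2 u h (by simpa using hs₀.1)
  have h1 := hmax (insert u U₀) ⟨fun u' hu' => by
    rcases Finset.mem_insert.1 hu' with rfl | hu'
    · exact ⟨hu, hue, s₀, hs₀.1, hus s₀ hs₀.1, hs₀.2.1⟩
    · exact hU₀.1 u' hu', ?_⟩
  · rw [Finset.card_insert_of_notMem huU] at h1
    omega
  · rw [Finset.card_insert_of_notMem huU]
    have h2 : (cov U₀).card + T.card ≤ (cov (insert u U₀)).card := by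
      rw [← Finset.card_image_of_injective T (add_right_injective u), ← Finset.card_union_of_disjoint]
      · refine Finset.card_le_card (Finset.union_subset ?_ ?_)
        · intro w hw
          simp only [cov, Finset.mem_filter, Finset.mem_univ, true_and] at hw ⊢
          obtain ⟨hw, u', hu', hwu⟩ := hw
          exact ⟨hw, u', Finset.mem_insert_of_mem hu', hwu⟩
        · intro w hw
          obtain ⟨s, hs, rfl⟩ := Finset.mem_image.1 hw
          rw [hT, Finset.mem_filter] at hs
          simp only [cov, Finset.mem_filter, Finset.mem_univ, true_and]
          exact ⟨⟨hus s hs.1, hs.2.1⟩, u, Finset.mem_insert_self _ _, by simpa using hs.1⟩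
      · rw [Finset.disjoint_right]
        intro w hw hw'
        obtain ⟨s, hs, rfl⟩ := Finset.mem_image.1 hw
        rw [hT, Finset.mem_filter] at hs
        simp only [cov, Finset.mem_filter, Finset.mem_univ, true_and] at hw'
        obtain ⟨-, u', hu', hwu⟩ := hw'
        exact hs.2.2 u' hu' hwu
    have h3 : ((cov U₀).card : ℝ) + T.card ≤ (cov (insert u U₀)).card := by exact_mod_cast h2
    push_cast
    linarith [hU₀.2]

open Classical in
/-- A coarse approximation can be corrected by few vertices. -/
theorem IsOddSet.exists_refined (h : IsOddSet S A Ev) (B : Set V) {t : ℝ} (ht : 0 < t) :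
    ∃ U₀ Y₀ : Finset V, (∀ u ∈ U₀, ∃ s ∈ S, ¬ (u + s ∈ A ↔ u + s ∈ B)) ∧
      (∀ y ∈ Y₀, ¬ (y ∈ A ↔ y ∈ B)) ∧
      (U₀.card : ℝ) ≤ (Finset.univ.filter fun z => ¬ (z ∈ A ↔ z ∈ B)).card / t ∧
      (Y₀.card : ℝ) ≤ (Finset.univ.filter fun z => ¬ (z ∈ A ↔ z ∈ B)).card / t *
        (Real.log S.card + 1) + 1 ∧
      refined S Ev t B U₀ Y₀ ⊆ A ∧
      ∀ v ∈ A, ¬ Ev v → 2 * t < inDeg S A v → v ∈ refined S Ev t B U₀ Y₀ := by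
  obtain ⟨U₀, hU₁, hU₂, hU₃⟩ := exists_greedy S A Ev B ht
  -- The even vertices that the coarse approximation misses. Any of them may safely be revealed,
  -- since all its neighbours are in `A`.
  let Y : Finset V := Finset.univ.filter fun y => y ∈ A ∧ Ev y ∧ y ∉ B
  let X : Finset V := Finset.univ.filter fun v =>
    t ≤ ((Y.filter fun y => v - y ∈ S).card : ℝ)
  have hYX : ∀ y ∈ Y, (X.filter fun x => x - y ∈ S).card ≤ S.card := fun y _ => by
    refine Finset.card_le_card_of_injOn (fun x => x - y) (fun x hx => ?_)
      (sub_left_injective.injOn)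
    simpa using (Finset.mem_filter.1 hx).2
  obtain ⟨Y₀, hY₁, hY₂, hY₃⟩ := exists_dominating X Y (fun x y => x - y ∈ S) ht S.card
    (fun x hx => by convert (Finset.mem_filter.1 hx).2) (fun y hy => by convert hYX y hy)
  have hYm : ∀ y ∈ Y₀, y ∈ A ∧ Ev y ∧ y ∉ B := fun y hy => by
    simpa [Y] using hY₁ hy
  refine ⟨U₀, Y₀, fun u hu => ?_, fun y hy => ?_, ?_, ?_, ?_, fun v hv hve hvd => ?_⟩
  · obtain ⟨-, -, s, hs, hsA, hsB⟩ := hU₁ u hu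
    exact ⟨s, hs, by tauto⟩
  · have := hYm y hy
    tauto
  · rw [le_div_iff₀ ht]
    refine hU₂.trans (Nat.cast_le.2 (Finset.card_le_card fun w hw => ?_))
    simp only [Finset.mem_filter, Finset.mem_univ, true_and] at hw ⊢
    tauto
  · refine hY₂.trans ?_
    have h1 : (Y.card : ℝ) ≤ (Finset.univ.filter fun z => ¬ (z ∈ A ↔ z ∈ B)).card :=
      Nat.cast_le.2 (Finset.card_le_card fun w hw => by
        simp only [Y, Finset.mem_filter, Finset.mem_univ, true_and] at hw ⊢
        tauto)
    have h2 := Real.log_natCast_nonneg S.card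
    gcongr
  · rintro v (⟨y, hy, hvy⟩ | ⟨hve, hvt⟩)
    · obtain ⟨hyA, hye, -⟩ := hYm y hy
      have := h.inner y hyA hye _ hvy
      rwa [add_sub_cancel] at this
    · by_contra hvA
      exact absurd hvt (not_lt.2 (hU₃ v hvA hve fun s hs => h.outer hvA hve hs))
  -- Of more than `2 * t` neighbours in `A`, either at least `t` are missed by `B`, and `Y₀`
  -- dominates `v`, or more than `t` are in `B`. In the latter case none is adjacent to `U₀`, whose
  -- vertices are odd and outside `A`, so all of them count in `freeDeg`.
  · by_cases hvX : t ≤ ((Y.filter fun y => v - y ∈ S).card : ℝ)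
    · exact Or.inl (hY₃ v (Finset.mem_filter.2 ⟨Finset.mem_univ _, hvX⟩))
    · refine Or.inr ⟨hve, ?_⟩
      push Not at hvX
      have h1 : inDeg S A v ≤ (Y.filter fun y => v - y ∈ S).card + freeDeg S B U₀ v := by
        rw [inDeg, freeDeg, ← Finset.card_filter_add_card_filter_not (fun s => v + s ∈ B), add_comm]
        refine Nat.add_le_add ?_ ?_
        · refine Finset.card_le_card_of_injOn (fun s => v + s) (fun s hs => ?_)
            (add_right_injective v).injOn
          simp only [Finset.coe_filter, Finset.mem_filter, Set.mem_ofPred_eq] at hs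
          simp only [Y, Finset.coe_filter, Finset.mem_filter, Set.mem_ofPred_eq, Finset.mem_univ,
            true_and]
          refine ⟨⟨hs.1.2, (h.flip v s hs.1.1).2 hve, hs.2⟩, ?_⟩
          simpa using h.neg_mem s hs.1.1
        · refine Finset.card_le_card fun s hs => ?_
          simp only [Finset.mem_filter] at hs ⊢
          refine ⟨hs.1.1, hs.2, fun u hu hus => ?_⟩
          obtain ⟨huA, hue, -⟩ := hU₁ u hu
          have := h.outer huA hue hus
          rw [add_sub_cancel] at this
          exact this hs.1.2
      have h2 : (inDeg S A v : ℝ) ≤ (Y.filter fun y => v - y ∈ S).card + freeDeg S B U₀ v := by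
        exact_mod_cast h1
      linarith

end Refine

/-! ### Encoding of marked vertex sets by words. -/

section Words

variable {V : Type*} [AddCommGroup V]

/-- The vertices visited while following a word: a letter `some g` is a step by `g`, and `none` is a
jump to the next root. -/
def trace (β : ℕ → V) : ℕ → V → List (Option V) → List V
  | _, _, [] => []
  | j, v, some g :: w => v :: trace β j (v + g) w
  | j, v, none :: w => v :: trace β (j + 1) (β (j + 1)) w

variable {β : ℕ → V}

theorem length_trace (w : List (Option V)) : ∀ j v, (trace β j v w).length = w.length := by
  induction w with
  | nil => intro j v; rfl
  | cons x w ih =>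
    intro j v
    cases x <;> simp [trace, ih]

/-- At the first visit to `p` the walk goes to `z` and back, which costs two letters and does not
disturb what follows. -/
theorem exists_detour {p : V} (z : V) (w : List (Option V)) : ∀ j v, p ∈ trace β j v w →
    ∃ w' : List (Option V), w'.length = w.length + 2 ∧
      (∀ x ∈ w', x ∈ w ∨ x = some (z - p) ∨ x = some (p - z)) ∧
      ∀ y, y ∈ trace β j v w' ↔ y = z ∨ y ∈ trace β j v w := by
  induction w with
  | nil => intro j v h; simp [trace] at h
  | cons x w ih =>
    intro j v h
    by_cases hp : p = v
    · subst hp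
      refine ⟨some (z - p) :: some (p - z) :: x :: w, by simp, ?_, fun y => ?_⟩
      · intro y hy
        simp only [List.mem_cons] at hy ⊢
        tauto
      · have hz : ∀ w', trace β j p (some (z - p) :: some (p - z) :: w')
            = p :: z :: trace β j p w' := fun w' => by
          simp [trace]
        have hpm : p ∈ trace β j p (x :: w) := by cases x <;> simp [trace]
        rw [hz]
        simp only [List.mem_cons]
        constructor
        · rintro (rfl | h | h)
          · exact Or.inr hpm
          · exact Or.inl h
          · exact Or.inr h
        · tauto
    · cases x with
      | none =>
        simp only [trace, List.mem_cons, hp, false_or] at h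
        obtain ⟨w', h1, h2, h3⟩ := ih _ _ h
        refine ⟨none :: w', by simp [h1], ?_, fun y => ?_⟩
        · intro y hy
          rcases List.mem_cons.1 hy with rfl | hy
          · simp
          · rcases h2 y hy with h | h
            · exact Or.inl (List.mem_cons_of_mem _ h)
            · exact Or.inr h
        · simp only [trace, List.mem_cons, h3]
          tauto
      | some g =>
        simp only [trace, List.mem_cons, hp, false_or] at h
        obtain ⟨w', h1, h2, h3⟩ := ih _ _ h
        refine ⟨some g :: w', by simp [h1], ?_, fun y => ?_⟩
        · intro y hy
          rcases List.mem_cons.1 hy with rfl | hy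
          · simp
          · rcases h2 y hy with h | h
            · exact Or.inl (List.mem_cons_of_mem _ h)
            · exact Or.inr h
        · simp only [trace, List.mem_cons, h3]
          tauto

/-- A vertex is recorded before its letter is read, so a final letter `some 0` is needed to record
the last root. -/
theorem mem_trace_roots (k : ℕ) : ∀ j y, y ∈ trace β j (β j) (List.replicate k none ++ [some 0]) ↔
    ∃ i ≤ k, y = β (j + i) := by
  induction k with
  | zero => intro j y; simp [trace]
  | succ k ih =>
    intro j y
    rw [List.replicate_succ, List.cons_append, trace, List.mem_cons, ih]
    constructor
    · rintro (rfl | ⟨i, hi, rfl⟩)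
      · exact ⟨0, by omega, rfl⟩
      · exact ⟨i + 1, by omega, by congr 1; omega⟩
    · rintro ⟨i, hi, rfl⟩
      rcases i with _ | i
      · exact Or.inl rfl
      · exact Or.inr ⟨i, by omega, by congr 1; omega⟩

variable [DecidableEq V]

/-- Starting from a word that visits the roots, one detour per missing vertex is inserted; `hconn`
always supplies a missing vertex within one jump of a visited one. -/
theorem exists_trace_eq {N Z : Finset V} (hneg : ∀ g ∈ N, -g ∈ N) {R : Finset V}
    (hconn : ∀ T ⊆ Z, R ⊆ T → T ≠ Z → ∃ p ∈ T, ∃ z ∈ Z \ T, z - p ∈ N) (m : ℕ) :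
    ∀ (T : Finset V) (w : List (Option V)), R ⊆ T → T ⊆ Z → (Z \ T).card = m →
      (∀ x ∈ w, ∀ g, x = some g → g ∈ N) → (∀ y, y ∈ trace β 0 (β 0) w ↔ y ∈ T) →
      ∃ w' : List (Option V), w'.length = w.length + 2 * m ∧ (∀ x ∈ w', ∀ g, x = some g → g ∈ N) ∧
        ∀ y, y ∈ trace β 0 (β 0) w' ↔ y ∈ Z := by
  induction m with
  | zero =>
    intro T w _ hTZ hc hw hT
    have : T = Z := Finset.Subset.antisymm hTZ
      (Finset.sdiff_eq_empty_iff_subset.1 (Finset.card_eq_zero.1 hc))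
    subst this
    exact ⟨w, by simp, hw, hT⟩
  | succ m ih =>
    intro T w hRT hTZ hc hw hT
    obtain ⟨p, hp, z, hz, hzp⟩ := hconn T hTZ hRT (by rintro rfl; simp at hc)
    obtain ⟨w', h1, h2, h3⟩ := exists_detour z w 0 (β 0) ((hT p).2 hp)
    have hzZ := Finset.mem_sdiff.1 hz
    obtain ⟨w'', h4, h5, h6⟩ := ih (insert z T) w' (hRT.trans (Finset.subset_insert _ _))
      (Finset.insert_subset hzZ.1 hTZ) (by
        rw [Finset.sdiff_insert, Finset.card_erase_of_mem hz, hc, Nat.add_sub_cancel]) (fun x hx g hg => by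
        rcases h2 x hx with h | rfl | rfl
        · exact hw x h g hg
        · rw [Option.some.injEq] at hg; exact hg ▸ hzp
        · rw [Option.some.injEq] at hg
          rw [← hg, ← neg_sub]
          exact hneg _ hzp) (fun y => by rw [h3, hT, Finset.mem_insert])
    exact ⟨w'', by omega, h5, h6⟩

/-- A set that is connected, in the Cayley graph with generators `N`, after joining the roots, is
visited by following a short word. -/
theorem exists_word {N Z : Finset V} (h0 : 0 ∈ N) (hneg : ∀ g ∈ N, -g ∈ N) {k q : ℕ}
    (hβ : ∀ i ≤ k, β i ∈ Z) (hq : Z.card ≤ q)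
    (hconn : ∀ T ⊆ Z, (∀ i ≤ k, β i ∈ T) → T ≠ Z → ∃ p ∈ T, ∃ z ∈ Z \ T, z - p ∈ N) :
    ∃ w : Fin (k + 1 + 2 * q) → Option N,
      ∀ y, y ∈ trace β 0 (β 0) (List.ofFn fun i => (w i).map Subtype.val) ↔ y ∈ Z := by
  let R : Finset V := (Finset.range (k + 1)).image β
  have hR : ∀ {T : Finset V}, R ⊆ T ↔ ∀ i ≤ k, β i ∈ T := fun {T} => by
    simp only [R, Finset.image_subset_iff, Finset.mem_range, Nat.lt_succ_iff]
  obtain ⟨w, h1, h2, h3⟩ := exists_trace_eq (β := β) hneg (R := R)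
    (fun T hT hRT => hconn T hT (hR.1 hRT)) _ R (List.replicate k none ++ [some 0]) subset_rfl
    (hR.2 hβ) rfl (fun x hx g hg => by
      subst hg
      simp only [List.mem_append, List.mem_replicate, reduceCtorEq, and_false, List.mem_singleton,
        Option.some.injEq, false_or] at hx
      exact hx ▸ h0) (fun y => by
      rw [mem_trace_roots]
      simp only [R, Finset.mem_image, Finset.mem_range, Nat.lt_succ_iff, zero_add]
      exact exists_congr fun i => and_congr_right fun _ => eq_comm)
  have hlen : w.length ≤ k + 1 + 2 * q := by
    have := (Finset.card_le_card (Finset.sdiff_subset (s := Z) (t := R)))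
    rw [h1]
    simp
    omega
  obtain ⟨e, he⟩ := Nat.exists_eq_add_of_le' hlen
  -- Idle steps at the first root pad all words to a common length, so that they can be counted as
  -- functions on one `Fin`.
  have hpad : ∀ e, ∀ y, y ∈ trace β 0 (β 0) (List.replicate e (some 0) ++ w) ↔ y ∈ Z := by
    intro e
    induction e with
    | zero => simpa using h3
    | succ e ih =>
      intro y
      rw [List.replicate_succ, List.cons_append, trace, add_zero, List.mem_cons, ih]
      exact or_iff_right_of_imp fun h => h ▸ hβ 0 (Nat.zero_le _)
  set w' := List.replicate e (some 0) ++ w with hw'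
  have hlen' : w'.length = k + 1 + 2 * q := by rw [he, hw']; simp
  have hmem : ∀ x ∈ w', ∀ g, x = some g → g ∈ N := by
    intro x hx g hg
    rcases List.mem_append.1 hx with hx | hx
    · rw [List.eq_of_mem_replicate hx, Option.some.injEq] at hg
      exact hg ▸ h0
    · exact h2 x hx g hg
  have hlift : ∀ i : Fin (k + 1 + 2 * q), ∃ o : Option N,
      ∀ h : (i : ℕ) < w'.length, o.map Subtype.val = w'[(i : ℕ)] := fun i => by
    have hi : (i : ℕ) < w'.length := by rw [hlen']; exact i.2
    have hm := hmem _ (List.getElem_mem hi)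
    rcases hx : w'[(i : ℕ)] with _ | g
    · exact ⟨none, fun _ => by rw [hx]; rfl⟩
    · exact ⟨some ⟨g, hm g hx⟩, fun _ => by rw [hx]; rfl⟩
  choose f hf using hlift
  refine ⟨f, fun y => ?_⟩
  have : (List.ofFn fun i => (f i).map Subtype.val) = w' := by
    refine List.ext_getElem (by simp [hlen']) fun i h h' => ?_
    rw [List.getElem_ofFn, hf]
  rw [this]
  exact hpad e y

open Classical in
/-- The visited vertices that carry the `i`-th mark. -/
noncomputable def marked [Fintype V] {ι : Type*} (l : List V) (m : ℕ → ι → Bool) (i : ι) :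
    Finset V :=
  Finset.univ.filter fun v => ∃ j, l[j]? = some v ∧ m j i = true

set_option linter.unusedSectionVars false in
-- Subsets of the visited vertices are recorded by one bit per position of the walk. Positions
-- beyond the length carry `false`.
theorem exists_marks [Fintype V] {ι : Type*} {l : List V} {ℓ : ℕ} (hl : l.length = ℓ)
    (X : ι → Finset V) (hX : ∀ i, ∀ v ∈ X i, v ∈ l) :
    ∃ m : Fin ℓ → ι → Bool,
      ∀ i, marked l (fun j i => if h : j < ℓ then m ⟨j, h⟩ i else false) i = X i := by
  classical
  refine ⟨fun j i => decide (l[(j : ℕ)]'(hl ▸ j.2) ∈ X i), fun i => ?_⟩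
  ext v
  simp only [marked, Finset.mem_filter, Finset.mem_univ, true_and]
  constructor
  · rintro ⟨j, hj, hm⟩
    obtain ⟨hjl, rfl⟩ := List.getElem?_eq_some_iff.1 hj
    rw [dif_pos (hl ▸ hjl)] at hm
    simpa using hm
  · intro hv
    obtain ⟨j, hj, hjv⟩ := List.getElem_of_mem (hX i v hv)
    refine ⟨j, by rw [List.getElem?_eq_getElem hj, hjv], ?_⟩
    rw [dif_pos (hl ▸ hj)]
    simpa [hjv] using hv

end Words

/-! ### The family of approximations and its size. -/

section Family

variable {V : Type*} [AddCommGroup V] [DecidableEq V] [Fintype V]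

variable {S A : Finset V} {Ev : V → Prop} {K : Type*} [AddCommGroup K]

/-- The coarse approximation determined by the two boundaries on a level set of the syndrome. -/
def levelApprox (C : Syndrome S K) (κ : Fin 3 → K) (I O : Finset V) (o : Bool) : Set V :=
  {z | ∃ B : Finset V, C.inner B κ = I ∧ C.outer B κ = O ∧ (C.proj κ 0 ∈ B ↔ o = true) ∧
    C.proj κ z ∈ B}

/-- The definition quantifies over every `B` with the given data; by `eq_of_inner_eq` they all agree
with `A` on the level, so the decoder needs no knowledge of `A`. -/
theorem mem_levelApprox (C : Syndrome S K) (hS : ∀ s ∈ S, -s ∈ S)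
    (hgen : ∀ Q : V → Prop, (∀ z, ∀ s ∈ S, (Q z ↔ Q (z + s))) → ∀ z z', Q z ↔ Q z')
    (κ : Fin 3 → K) (z : V) :
    z ∈ levelApprox C κ (C.inner A κ) (C.outer A κ) (decide (C.proj κ 0 ∈ A)) ↔
      C.proj κ z ∈ A := by
  constructor
  · rintro ⟨B, hi, ho, h0, hz⟩
    rw [decide_eq_true_iff] at h0
    exact (C.eq_of_inner_eq hS hgen hi ho h0 z).1 hz
  · intro hz
    exact ⟨A, rfl, rfl, by simp, hz⟩

/-- The approximation encoded by a marked sequence of vertices, a level and a bit. -/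
noncomputable def decode (Ev : V → Prop) (t : ℝ) (C : Syndrome S K) (l : List V)
    (m : ℕ → Fin 4 → Bool) (κ : Fin 3 → K) (o : Bool) : Set V :=
  refined S Ev t (levelApprox C κ (marked l m 0) (marked l m 1) o) (marked l m 2) (marked l m 3)

/-- `R` meets every component of the inner boundary of `A`, two vertices being adjacent if they are
at distance at most two. -/
def IsRootSet (S A : Finset V) (R : Set V) : Prop :=
  ∀ T ⊆ innerBdry S A, (∀ v ∈ R, v ∈ T) →
    (∀ v ∈ T, ∀ v' ∈ innerBdry S A, v' - v ∈ ball S 2 → v' ∈ T) → T = innerBdry S A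

set_option maxHeartbeats 1000000 in
-- Everything needed to rebuild an approximation (net, roots, both level boundaries, `U₀`, `Y₀`)
-- forms a set `Z` of at most `q` vertices near the boundary of `A`. It is connected from the roots
-- by jumps in `ball S 18`, hence encoded by a word with four marks per letter. The net carries no
-- mark and serves only connectivity.
theorem IsOddSet.exists_decode [Fintype K] (h : IsOddSet S A Ev)
    (hin : ∀ v ∈ A, ∃ s ∈ S, v + s ∈ A) (hout : ∀ v ∉ A, ∃ s ∈ S, v + s ∉ A)
    (hgen : ∀ Q : V → Prop, (∀ z, ∀ s ∈ S, (Q z ↔ Q (z + s))) → ∀ z z', Q z ↔ Q z')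
    (C : Syndrome S K) {t : ℝ} (ht : 0 < t) {k q : ℕ} {β : ℕ → V}
    (hβ : ∀ i ≤ k, β i ∈ innerBdry S A) (hroot : IsRootSet S A (β '' Set.Iic k))
    (hpos : 0 < S.card)
    (hq : 4 * (bdry S A).card / (S.card : ℝ) ^ 2 + (k + 1) +
      12 * (2 * S.card + Fintype.card K) * (bdry S A).card / (Fintype.card K : ℝ) ^ 3 +
      12 * (bdry S A).card / Fintype.card K / t +
      (12 * (bdry S A).card / Fintype.card K / t * (Real.log S.card + 1) + 1) ≤ q) :
    ∃ (w : Fin (k + 1 + 2 * q) → Option (ball S 18)) (m : Fin (k + 1 + 2 * q) → Fin 4 → Bool)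
      (κ : Fin 3 → K) (o : Bool),
      let E := decode Ev t C (trace β 0 (β 0) (List.ofFn fun i => (w i).map Subtype.val))
        (fun j i => if h : j < k + 1 + 2 * q then m ⟨j, h⟩ i else false) κ o
      E ⊆ A ∧ ∀ v ∈ A, ¬ Ev v → 2 * t < inDeg S A v → v ∈ E := by
  classical
  have hS := h.neg_mem
  obtain ⟨N, hN, hNc, hNn⟩ := h.exists_net hin hout
  obtain ⟨κ, hκ₁, hκ₂⟩ := C.exists_level (A := A) hS
  set o : Bool := decide (C.proj κ 0 ∈ A) with ho
  set B := levelApprox C κ (C.inner A κ) (C.outer A κ) o with hB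
  have hBm : ∀ z, z ∈ B ↔ C.proj κ z ∈ A := fun z => mem_levelApprox C hS hgen κ z
  obtain ⟨U₀, Y₀, hU, hY, hUc, hYc, hE₁, hE₂⟩ := h.exists_refined B ht
  have herr : (Finset.univ.filter fun z => ¬ (z ∈ A ↔ z ∈ B)) = C.err A κ := by
    ext z; simp [Syndrome.err, hBm]
  have hk : (0 : ℝ) < Fintype.card K := by exact_mod_cast Fintype.card_pos
  have hec : (((Finset.univ.filter fun z => ¬ (z ∈ A ↔ z ∈ B)).card : ℕ) : ℝ) ≤
      12 * (bdry S A).card / Fintype.card K := by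
    rw [herr, le_div_iff₀ hk, mul_comm]
    exact_mod_cast hκ₁
  have hnear : ∀ z, ¬ (z ∈ A ↔ z ∈ B) → ∃ v ∈ innerBdry S A, z - v ∈ ball S 3 := fun z hz =>
    exists_innerBdry_near hS (C.proj_sub_mem κ z) (by rw [hBm] at hz; exact hz)
  set R : Finset V := (Finset.range (k + 1)).image β with hR
  have hRm : ∀ {v}, v ∈ R ↔ ∃ i ≤ k, β i = v := fun {v} => by
    simp [hR]
  have hRb : R ⊆ innerBdry S A := fun v hv => by
    obtain ⟨i, hi, rfl⟩ := hRm.1 hv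
    exact hβ i hi
  let X : Fin 4 → Finset V := ![C.inner A κ, C.outer A κ, U₀, Y₀]
  set Z : Finset V := N ∪ R ∪ C.inner A κ ∪ C.outer A κ ∪ U₀ ∪ Y₀ with hZ
  have hZm : ∀ z, z ∈ Z ↔ z ∈ N ∨ z ∈ R ∨ z ∈ C.inner A κ ∨ z ∈ C.outer A κ ∨ z ∈ U₀ ∨ z ∈ Y₀ :=
    fun z => by simp only [hZ, Finset.mem_union, or_assoc]
  have hZnear : ∀ z ∈ Z, ∃ v ∈ innerBdry S A, z - v ∈ ball S 4 := by
    intro z hz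
    rcases (hZm z).1 hz with hz | hz | hz | hz | hz | hz
    · exact ⟨z, hN hz, by simpa using zero_mem_ball 4⟩
    · exact ⟨z, hRb hz, by simpa using zero_mem_ball 4⟩
    · obtain ⟨-, hzA, r', hr', hzr⟩ := C.mem_inner.1 hz
      obtain ⟨v, hv, hzv⟩ := exists_innerBdry_near (A := A) hS (z := z) (hzr.sub_mem hS)
        (by rw [add_sub_cancel]; simp [hzA, hr'])
      exact ⟨v, hv, ball_mono (by norm_num) hzv⟩
    · obtain ⟨-, hzA, r', hr', hzr⟩ := C.mem_outer.1 hz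
      obtain ⟨v, hv, hzv⟩ := exists_innerBdry_near (A := A) hS (z := z)
        ((hzr.symm hS).sub_mem hS) (by rw [add_sub_cancel]; simp [hzA, hr'])
      exact ⟨v, hv, ball_mono (by norm_num) hzv⟩
    · obtain ⟨s, hs, hus⟩ := hU z hz
      obtain ⟨v, hv, hzv⟩ := hnear _ hus
      refine ⟨v, hv, ?_⟩
      rw [show z - v = (z + s - v) + -s by abel]
      exact ball_add hzv (mem_ball_one (hS s hs))
    · obtain ⟨v, hv, hzv⟩ := hnear _ (hY z hz)
      exact ⟨v, hv, ball_mono (by norm_num) hzv⟩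
  have hZc : Z.card ≤ q := by
    have h1 : Z.card ≤ N.card + R.card + (C.inner A κ).card + (C.outer A κ).card + U₀.card
        + Y₀.card := by
      refine (Finset.card_union_le _ _).trans (Nat.add_le_add_right ?_ _)
      refine (Finset.card_union_le _ _).trans (Nat.add_le_add_right ?_ _)
      refine (Finset.card_union_le _ _).trans (Nat.add_le_add_right ?_ _)
      refine (Finset.card_union_le _ _).trans (Nat.add_le_add_right ?_ _)
      exact Finset.card_union_le _ _
    have h2 : (N.card : ℝ) ≤ 4 * (bdry S A).card / (S.card : ℝ) ^ 2 := by
      rw [le_div_iff₀ (by positivity)]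
      exact_mod_cast hNc
    have h3 : (R.card : ℝ) ≤ k + 1 := by
      have : R.card ≤ k + 1 := Finset.card_image_le.trans (by simp)
      exact_mod_cast this
    have h4 : ((C.inner A κ).card : ℝ) + (C.outer A κ).card ≤
        12 * (2 * S.card + Fintype.card K) * (bdry S A).card / (Fintype.card K : ℝ) ^ 3 := by
      rw [le_div_iff₀ (by positivity), mul_comm]
      exact_mod_cast hκ₂
    have h5 : (U₀.card : ℝ) ≤ 12 * (bdry S A).card / Fintype.card K / t :=
      hUc.trans (div_le_div_of_nonneg_right hec ht.le)
    have h6 : (Y₀.card : ℝ) ≤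
        12 * (bdry S A).card / Fintype.card K / t * (Real.log S.card + 1) + 1 := by
      refine hYc.trans ?_
      have := Real.log_natCast_nonneg S.card
      gcongr
    have h7 : (Z.card : ℝ) ≤ N.card + R.card + (C.inner A κ).card + (C.outer A κ).card + U₀.card
        + Y₀.card := by exact_mod_cast h1
    have h8 : (Z.card : ℝ) ≤ q := by linarith
    exact_mod_cast h8
  -- Net points near boundary vertices at distance at most two are within `8 + 2 + 8 = 18` of each
  -- other; any other vertex of `Z` is within `4 + 8` of a net point or root.
  have hconn : ∀ T ⊆ Z, (∀ i ≤ k, β i ∈ T) → T ≠ Z → ∃ p ∈ T, ∃ z ∈ Z \ T, z - p ∈ ball S 18 := by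
    intro T hTZ hβT hne
    by_contra! hcon
    have hstep : ∀ p ∈ T, ∀ z ∈ Z, z - p ∈ ball S 18 → z ∈ T := fun p hp z hz hzp => by
      by_contra hzT
      exact hcon p hp z (Finset.mem_sdiff.2 ⟨hz, hzT⟩) hzp
    have hNZ : ∀ {a}, a ∈ N ∪ R → a ∈ Z := fun {a} ha => by
      rw [hZm]; rcases Finset.mem_union.1 ha with ha | ha <;> simp [ha]
    let D : Finset V := (innerBdry S A).filter fun v => ∃ a ∈ T, a ∈ N ∪ R ∧ v - a ∈ ball S 8
    have hD : D = innerBdry S A := by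
      refine hroot D (Finset.filter_subset _ _) ?_ ?_
      · rintro v ⟨i, hi, rfl⟩
        exact Finset.mem_filter.2 ⟨hβ i hi, β i, hβT i hi,
          Finset.mem_union_right _ (hRm.2 ⟨i, hi, rfl⟩), by simpa using zero_mem_ball 8⟩
      · intro v hv v' hv' hvv'
        obtain ⟨-, a, haT, haN, hva⟩ := Finset.mem_filter.1 hv
        obtain ⟨a', ha', hva'⟩ := hNn v' hv'
        refine Finset.mem_filter.2 ⟨hv', a', ?_, Finset.mem_union_left _ ha', hva'⟩
        refine hstep a haT a' (hNZ (Finset.mem_union_left _ ha')) ?_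
        exact sub_mem_ball_trans (sub_mem_ball_comm hS hva') (sub_mem_ball_trans hvv' hva)
    refine hne (Finset.Subset.antisymm hTZ fun z hz => ?_)
    obtain ⟨v, hv, hzv⟩ := hZnear z hz
    rw [← hD] at hv
    obtain ⟨-, a, haT, -, hva⟩ := Finset.mem_filter.1 hv
    exact hstep a haT z hz (ball_mono (by norm_num) (sub_mem_ball_trans hzv hva))
  have hXZ : ∀ i, ∀ v ∈ X i, v ∈ Z := fun i v hv => by
    rw [hZm]
    match i, hv with
    | 0, hv => exact Or.inr (Or.inr (Or.inl hv))
    | 1, hv => exact Or.inr (Or.inr (Or.inr (Or.inl hv)))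
    | 2, hv => exact Or.inr (Or.inr (Or.inr (Or.inr (Or.inl hv))))
    | 3, hv => exact Or.inr (Or.inr (Or.inr (Or.inr (Or.inr hv))))
  clear_value Z o
  obtain ⟨w, hw⟩ := exists_word (zero_mem_ball 18) (fun g hg => neg_mem_ball hS hg)
    (fun i hi => (hZm _).2 (Or.inr (Or.inl (hRm.2 ⟨i, hi, rfl⟩)))) hZc hconn
  obtain ⟨m, hm⟩ := exists_marks (ℓ := k + 1 + 2 * q) (by rw [length_trace]; simp) X
    (fun i v hv => (hw v).2 (hXZ i v hv))
  refine ⟨w, m, κ, o, ?_⟩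
  have hdec : decode Ev t C (trace β 0 (β 0) (List.ofFn fun i => (w i).map Subtype.val))
        (fun j i => if h : j < k + 1 + 2 * q then m ⟨j, h⟩ i else false) κ o
      = refined S Ev t B U₀ Y₀ := by
    have h0 := hm 0
    have h1 := hm 1
    have h2 := hm 2
    have h3 := hm 3
    simp only [X, Matrix.cons_val] at h0 h1 h2 h3
    rw [decode, h0, h1, h2, h3]
  rw [hdec]
  exact ⟨hE₁, hE₂⟩

/-- The family of approximations. -/
theorem exists_family [Fintype K] (S : Finset V) (Ev : V → Prop)
    (hgen : ∀ Q : V → Prop, (∀ z, ∀ s ∈ S, (Q z ↔ Q (z + s))) → ∀ z z', Q z ↔ Q z')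
    (C : Syndrome S K) {t : ℝ} (ht : 0 < t) (hpos : 0 < S.card) (k q L : ℕ) (P : Finset V)
    (hq : 4 * L / (S.card : ℝ) ^ 2 + (k + 1) +
      12 * (2 * S.card + Fintype.card K) * L / (Fintype.card K : ℝ) ^ 3 +
      12 * L / Fintype.card K / t +
      (12 * L / Fintype.card K / t * (Real.log S.card + 1) + 1) ≤ q) :
    ∃ 𝓔 : Finset (Set V),
      𝓔.card ≤ P.card ^ (k + 1) * (((S.card + 1) ^ 18 + 1) * 16) ^ (k + 1 + 2 * q) *
        (Fintype.card K ^ 3 * 2) ∧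
      ∀ A : Finset V, IsOddSet S A Ev → (∀ v ∈ A, ∃ s ∈ S, v + s ∈ A) →
        (∀ v ∉ A, ∃ s ∈ S, v + s ∉ A) → (bdry S A).card = L →
        (∃ b : Fin (k + 1) → V, (∀ i, b i ∈ P ∧ b i ∈ innerBdry S A) ∧
          IsRootSet S A (Set.range b)) →
        ∃ E ∈ 𝓔, E ⊆ A ∧ ∀ v ∈ A, ¬ Ev v → 2 * t < inDeg S A v → v ∈ E := by
  classical
  let ℓ := k + 1 + 2 * q
  let Param := (Fin (k + 1) → P) × (Fin ℓ → Option (ball S 18)) × (Fin ℓ → Fin 4 → Bool) ×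
    (Fin 3 → K) × Bool
  -- The value `0` beyond index `k` is a default; the required visits and the root-set condition use
  -- only indices up to `k`.
  let root : (Fin (k + 1) → P) → ℕ → V := fun b i => if h : i < k + 1 then b ⟨i, h⟩ else 0
  let F : Param → Set V := fun p =>
    decode Ev t C (trace (root p.1) 0 (root p.1 0) (List.ofFn fun i => (p.2.1 i).map Subtype.val))
      (fun j i => if h : j < ℓ then p.2.2.1 ⟨j, h⟩ i else false) p.2.2.2.1 p.2.2.2.2
  refine ⟨Finset.univ.image F, ?_, ?_⟩
  · refine Finset.card_image_le.trans ?_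
    rw [Finset.card_univ]
    simp only [Param, Fintype.card_prod, Fintype.card_fun, Fintype.card_fin, Fintype.card_coe,
      Fintype.card_option, Fintype.card_bool]
    have h1 : (ball S 18).card + 1 ≤ (S.card + 1) ^ 18 + 1 :=
      Nat.add_le_add_right (card_ball_le 18) 1
    -- Each letter is a jump in the ball or `none`, together with `2 ^ 4 = 16` possible marks.
    calc _ = P.card ^ (k + 1) * (((ball S 18).card + 1) * 16) ^ ℓ * (Fintype.card K ^ 3 * 2) := by
          rw [mul_pow]; norm_num; ring
      _ ≤ _ := by gcongr
  · rintro A hA hin hout rfl ⟨b, hb, hroot⟩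
    let b' : Fin (k + 1) → P := fun i => ⟨b i, (hb i).1⟩
    have hbr : ∀ i : Fin (k + 1), root b' i = b i := fun i => by
      simp only [root, b', dif_pos i.2, Fin.eta]
    have hr : ∀ i ≤ k, ∃ j, root b' i = b j := fun i hi =>
      ⟨⟨i, by omega⟩, hbr ⟨i, by omega⟩⟩
    obtain ⟨w, m, κ, o, hE⟩ := hA.exists_decode hin hout hgen C ht (k := k) (q := q)
      (β := root b') (fun i hi => by
        obtain ⟨j, hj⟩ := hr i hi
        rw [hj]; exact (hb j).2) (by
        convert hroot using 1
        ext v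
        constructor
        · rintro ⟨i, hi, rfl⟩
          obtain ⟨j, hj⟩ := hr i hi
          exact ⟨j, hj.symm⟩
        · rintro ⟨j, rfl⟩
          exact ⟨j, Nat.lt_succ_iff.1 j.2, hbr j⟩) hpos hq
    exact ⟨_, Finset.mem_image_of_mem F (Finset.mem_univ (b', w, m, κ, o)), hE⟩

end Family

/-! ### Arithmetic of a single cycle. -/

section FinLemmas

variable {m : ℕ} [NeZero m]

theorem val_nsmul_one (k : ℕ) : ((k • (1 : Fin m) : Fin m) : ℕ) = k % m := by
  induction k with
  | zero => simp
  | succ k ih =>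
    rw [succ_nsmul, Fin.val_add, ih, Fin.val_one', ← Nat.add_mod]

theorem val_nsmul_one_self (t : Fin m) : (t : ℕ) • (1 : Fin m) = t := by
  apply Fin.ext
  rw [val_nsmul_one, Nat.mod_eq_of_lt t.2]

theorem val_eq_one_iff (hm : 2 ≤ m) (t : Fin m) : (t : ℕ) = 1 ↔ t = 1 := by
  rw [Fin.ext_iff, Fin.val_one', Nat.mod_eq_of_lt (by omega)]

end FinLemmas

/-! ### The torus as a Cayley graph, its lines and sections. -/

section Torus

set_option linter.unusedSectionVars false

variable {d : ℕ} {n : Fin d → ℕ} [∀ i, NeZero (n i)]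

/-- The unit step in the direction `i`. -/
def unit (n : Fin d → ℕ) [∀ i, NeZero (n i)] (i : Fin d) : TorusVertex n := Pi.single i 1

/-- The generators of the torus as a Cayley graph. -/
def gens (n : Fin d → ℕ) [∀ i, NeZero (n i)] : Finset (TorusVertex n) :=
  Finset.univ.image (unit n) ∪ Finset.univ.image fun i => -unit n i

theorem mem_gens {s : TorusVertex n} : s ∈ gens n ↔ ∃ i, s = unit n i ∨ s = -unit n i := by
  simp only [gens, Finset.mem_union, Finset.mem_image, Finset.mem_univ, true_and, ← exists_or]
  exact exists_congr fun i => by rw [eq_comm, @eq_comm _ s]; tauto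

theorem unit_mem_gens (i : Fin d) : unit n i ∈ gens n := mem_gens.2 ⟨i, Or.inl rfl⟩

theorem neg_mem_gens : ∀ s ∈ gens n, -s ∈ gens n := by
  intro s hs
  obtain ⟨i, rfl | rfl⟩ := mem_gens.1 hs
  · exact mem_gens.2 ⟨i, Or.inr rfl⟩
  · exact mem_gens.2 ⟨i, Or.inl (neg_neg _)⟩

theorem unit_apply_self (i : Fin d) : unit n i i = 1 := Pi.single_eq_same _ _

theorem unit_apply_of_ne {i j : Fin d} (h : j ≠ i) : unit n i j = 0 := Pi.single_eq_of_ne h _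

theorem card_gens_le : (gens n).card ≤ 2 * d := by
  refine (Finset.card_union_le _ _).trans ?_
  have h1 := Finset.card_image_le (s := Finset.univ) (f := unit n)
  have h2 := Finset.card_image_le (s := Finset.univ) (f := fun i => -unit n i)
  rw [Finset.card_univ, Fintype.card_fin] at h1 h2
  omega

theorem le_card_gens (hn : ∀ i, 2 ≤ n i) : d ≤ (gens n).card := by
  have h1 : (Finset.univ.image (unit n)).card = d := by
    rw [Finset.card_image_of_injective, Finset.card_univ, Fintype.card_fin]
    intro i j hij
    by_contra hne
    have h2 := congrFun hij i
    rw [unit_apply_self, unit_apply_of_ne hne] at h2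
    have := (val_eq_one_iff (hn i) 1).2 rfl
    rw [h2] at this
    simp at this
  exact h1.symm.le.trans (Finset.card_le_card Finset.subset_union_left)

theorem torus_adj (hn : ∀ i, 2 ≤ n i) {x y : TorusVertex n} :
    (torus n).Adj x y ↔ y - x ∈ gens n := by
  rw [mem_gens]
  refine exists_congr fun i => ?_
  rw [SimpleGraph.cycleGraph_adj', val_eq_one_iff (hn i), val_eq_one_iff (hn i)]
  have key : ∀ {x y : TorusVertex n}, (y i - x i = 1 ∧ ∀ j, j ≠ i → x j = y j) ↔
      y - x = unit n i := fun {x y} => by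
    constructor
    · rintro ⟨h, h'⟩
      funext j
      by_cases hj : j = i
      · subst hj
        rw [Pi.sub_apply, h, unit_apply_self]
      · rw [Pi.sub_apply, h' j hj, sub_self, unit_apply_of_ne hj]
    · intro h
      refine ⟨?_, fun j hj => ?_⟩
      · rw [← Pi.sub_apply, h, unit_apply_self]
      · have := congrFun h j
        rw [Pi.sub_apply, unit_apply_of_ne hj, sub_eq_zero] at this
        exact this.symm
  have key' : y - x = -unit n i ↔ x - y = unit n i := by
    rw [← neg_sub x y, neg_inj]
  rw [key', ← key, ← key, or_and_right, or_comm]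
  simp only [eq_comm]

theorem nsmul_unit_apply_self (i : Fin d) (k : ℕ) : ((k • unit n i) i : ℕ) = k % n i := by
  rw [Pi.smul_apply, unit_apply_self, val_nsmul_one]

theorem nsmul_unit_apply_of_ne {i j : Fin d} (h : j ≠ i) (k : ℕ) : (k • unit n i) j = 0 := by
  rw [Pi.smul_apply, unit_apply_of_ne h, smul_zero]

theorem card_nsmul_unit (i : Fin d) : n i • unit n i = 0 := by
  funext j
  by_cases h : j = i
  · subst h
    apply Fin.ext
    rw [nsmul_unit_apply_self]
    simp
  · exact nsmul_unit_apply_of_ne h _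

theorem update_eq_add (z : TorusVertex n) (i : Fin d) (t : Fin (n i)) :
    Function.update z i t = z + ((t - z i : Fin (n i)) : ℕ) • unit n i := by
  funext j
  by_cases h : j = i
  · subst h
    rw [Function.update_self, Pi.add_apply, Pi.smul_apply, unit_apply_self, val_nsmul_one_self,
      add_sub_cancel]
  · rw [Function.update_of_ne h, Pi.add_apply, nsmul_unit_apply_of_ne h, add_zero]

theorem update_zero_add (z : TorusVertex n) (i : Fin d) :
    Function.update z i 0 + (z i : ℕ) • unit n i = z := by
  funext j
  by_cases h : j = i
  · subst h
    rw [Pi.add_apply, Function.update_self, Pi.smul_apply, unit_apply_self, val_nsmul_one_self,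
      zero_add]
  · rw [Pi.add_apply, Function.update_of_ne h, nsmul_unit_apply_of_ne h, add_zero]

theorem line_iff {Q : TorusVertex n → Prop} {z : TorusVertex n} {i : Fin d}
    (h : ∀ k : ℕ, Q (z + k • unit n i) ↔ Q (z + (k + 1) • unit n i)) (k : ℕ) :
    Q z ↔ Q (z + k • unit n i) := by
  induction k with
  | zero => simp
  | succ k ih => exact ih.trans (h k)

/-- The vertex whose first `j` coordinates are those of `y` and whose other coordinates are those
of `x`. -/
def hybrid (x y : TorusVertex n) (j : ℕ) : TorusVertex n := fun i => if (i : ℕ) < j then y i else x i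

theorem hybrid_succ (x y : TorusVertex n) (i : Fin d) :
    hybrid x y (i + 1) = Function.update (hybrid x y i) i (y i) := by
  funext j
  by_cases h : j = i
  · subst h; simp [hybrid]
  · rw [Function.update_of_ne h]
    have : (j : ℕ) ≠ i := fun h' => h (Fin.ext h')
    simp only [hybrid]
    congr 1
    exact propext ⟨fun _ => by omega, fun _ => by omega⟩

/-- The coordinates of `x` are replaced by those of `y` one at a time, each by positive steps along
its cycle. Restricting the hypothesis to these explicit lines is what later yields a short list of
root candidates. -/
theorem hybrid_iff {Q : TorusVertex n → Prop} {x y : TorusVertex n}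
    (h : ∀ i : Fin d, x i ≠ y i → ∀ k : ℕ,
      Q (hybrid x y i + k • unit n i) ↔ Q (hybrid x y i + (k + 1) • unit n i)) : Q x ↔ Q y := by
  have key : ∀ j ≤ d, Q x ↔ Q (hybrid x y j) := by
    intro j
    induction j with
    | zero => intro _; rfl
    | succ j ih =>
      intro hj
      rw [ih (by omega)]
      have h1 := hybrid_succ x y ⟨j, hj⟩
      simp only at h1
      rw [h1]
      by_cases hxy : x ⟨j, hj⟩ = y ⟨j, hj⟩
      · rw [← hxy]
        have : hybrid x y j ⟨j, hj⟩ = x ⟨j, hj⟩ := by simp [hybrid]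
        rw [← this, Function.update_eq_self]
      · rw [update_eq_add]
        exact line_iff (h ⟨j, hj⟩ hxy) _
  have h1 : hybrid x y d = y := by
    funext i; simp [hybrid]
  rw [key d le_rfl, h1]

theorem gens_connected (Q : TorusVertex n → Prop) (h : ∀ z, ∀ s ∈ gens n, (Q z ↔ Q (z + s)))
    (z z' : TorusVertex n) : Q z ↔ Q z' :=
  hybrid_iff fun i _ k => by
    rw [succ_nsmul, ← add_assoc]
    exact h _ _ (unit_mem_gens i)

variable {A : Finset (TorusVertex n)}

/-- If the two endpoints of an edge are on different sides of `A`, then one of them is in the inner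
boundary. -/
theorem exists_bdry_of_not_iff {z : TorusVertex n} {i : Fin d}
    (h : ¬ (z ∈ A ↔ z + unit n i ∈ A)) :
    ∃ p ∈ bdry (gens n) A, p.1 = z ∨ p.1 = z + unit n i := by
  by_cases hz : z ∈ A
  · exact ⟨(z, unit n i), mem_bdry.2 ⟨hz, unit_mem_gens i, fun h' => h (by simp [hz, h'])⟩,
      Or.inl rfl⟩
  · refine ⟨(z + unit n i, -unit n i), mem_bdry.2 ⟨?_, neg_mem_gens _ (unit_mem_gens i), ?_⟩,
      Or.inr rfl⟩
    · by_contra h'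
      exact h (by simp [hz, h'])
    · simpa using hz

theorem exists_bdry_line {x y : TorusVertex n} (h : ¬ (x ∈ A ↔ y ∈ A)) :
    ∃ p ∈ bdry (gens n) A, ∃ i, x i ≠ y i ∧ ∃ k : ℕ, p.1 = hybrid x y i + k • unit n i := by
  by_contra! hcon
  refine h (hybrid_iff fun i hi k => ?_)
  by_contra hne
  rw [succ_nsmul, ← add_assoc] at hne
  obtain ⟨p, hp, h1 | h1⟩ := exists_bdry_of_not_iff hne
  · exact hcon p hp i hi k h1
  · exact hcon p hp i hi (k + 1) (by rw [h1, succ_nsmul, ← add_assoc])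

/-- The hybrid path leaves unchanged every coordinate in which `x` and `y` agree, so a crossing can
be found in the smallest subtorus spanned by both. -/
theorem exists_bdry_between {x y : TorusVertex n} (h : ¬ (x ∈ A ↔ y ∈ A)) :
    ∃ p ∈ bdry (gens n) A, ∀ j, x j = y j → p.1 j = x j := by
  obtain ⟨p, hp, i, hi, k, hpk⟩ := exists_bdry_line h
  refine ⟨p, hp, fun j hj => ?_⟩
  have hji : j ≠ i := by rintro rfl; exact hi hj
  rw [hpk, Pi.add_apply, nsmul_unit_apply_of_ne hji, add_zero, hybrid]
  split_ifs
  · exact hj.symm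
  · rfl

variable [NeZero d]

theorem prod_eq_sectionSize_mul : ∏ i, n i = sectionSize n * n ⊤ := by
  rw [sectionSize, ← Finset.prod_mul_prod_compl (Finset.Iio (⊤ : Fin d))]
  congr 1
  have : (Finset.Iio (⊤ : Fin d))ᶜ = {⊤} := by
    ext i; simp
  rw [this, Finset.prod_singleton]

/-- A set of boundary edges that meets every line in some direction has at least as many elements as
the smallest section. -/
theorem sectionSize_le (hmono : Monotone n) (i : Fin d) (T : Finset (TorusVertex n × TorusVertex n))
    (h : ∀ z : TorusVertex n, ∃ p ∈ T, ∀ j, j ≠ i → p.1 j = z j) : sectionSize n ≤ T.card := by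
  have h1 : Fintype.card (∀ j : {j : Fin d // j ≠ i}, Fin (n j)) ≤ Fintype.card T := by
    refine Fintype.card_le_of_surjective (fun p j => p.1.1 j) fun f => ?_
    obtain ⟨p, hp, hpf⟩ := h fun j => if hj : j ≠ i then f ⟨j, hj⟩ else 0
    refine ⟨⟨p, hp⟩, funext fun j => ?_⟩
    have := hpf j j.2
    rw [dif_pos j.2] at this
    exact this
  rw [Fintype.card_coe, Fintype.card_pi] at h1
  simp only [Fintype.card_fin] at h1
  refine le_trans ?_ h1
  have h2 : ∏ j : {j : Fin d // j ≠ i}, n j = ∏ j ∈ Finset.univ.erase i, n j :=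
    (Finset.prod_subtype (Finset.univ.erase i) (by simp) n).symm
  rw [h2]
  have h3 := Finset.mul_prod_erase Finset.univ n (Finset.mem_univ i)
  rw [prod_eq_sectionSize_mul] at h3
  -- The last side is the longest, so a section orthogonal to it is the smallest.
  have h4 : sectionSize n * n i ≤ sectionSize n * n ⊤ := Nat.mul_le_mul_left _ (hmono le_top)
  rw [← h3, mul_comm] at h4
  exact Nat.le_of_mul_le_mul_left h4 (NeZero.pos (n i))

theorem card_torus : Fintype.card (TorusVertex n) = sectionSize n * n ⊤ := by
  rw [← prod_eq_sectionSize_mul, Fintype.card_pi]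
  simp

/-- If the boundary is shorter than the smallest section and the last side, then it is met by one of
two segments. -/
theorem exists_innerBdry_segment (hmono : Monotone n) {x b : TorusVertex n} (hx : x ∈ A)
    (hb : b ∉ A) (h1 : (bdry (gens n) A).card < sectionSize n)
    (h2 : (bdry (gens n) A).card < n ⊤) :
    ∃ j ≤ (bdry (gens n) A).card, x + j • unit n ⊤ ∈ innerBdry (gens n) A ∨
      b + j • unit n ⊤ ∈ innerBdry (gens n) A := by
  set L := (bdry (gens n) A).card with hL
  have hinner : ∀ {p}, p ∈ bdry (gens n) A → p.1 ∈ innerBdry (gens n) A := fun {p} hp =>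
    mem_innerBdry.2 ⟨(mem_bdry.1 hp).1, p.2, (mem_bdry.1 hp).2⟩
  -- There are fewer boundary edges than lines in the last direction, so some line stays on one side
  -- of `A`.
  have hfree : ∃ z : TorusVertex n, ∀ k : ℕ, z ∈ A ↔ z + k • unit n ⊤ ∈ A := by
    by_contra! hcon
    refine absurd (sectionSize_le hmono ⊤ (bdry (gens n) A) fun z => ?_) (not_le.2 h1)
    by_contra! hcon'
    obtain ⟨k, hk⟩ := hcon z
    have hk' : ¬ (z ∈ A ↔ z + k • unit n ⊤ ∈ A) := by tauto
    refine hk' (line_iff (fun k => ?_) k)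
    by_contra hne
    rw [succ_nsmul, ← add_assoc] at hne
    obtain ⟨p, hp, hpz⟩ := exists_bdry_of_not_iff hne
    obtain ⟨j, hj, hpj⟩ := hcon' p hp
    rcases hpz with hpz | hpz
    · rw [hpz, Pi.add_apply, nsmul_unit_apply_of_ne hj, add_zero] at hpj
      exact hpj rfl
    · rw [hpz, Pi.add_apply, Pi.add_apply, nsmul_unit_apply_of_ne hj, unit_apply_of_ne hj, add_zero,
        add_zero] at hpj
      exact hpj rfl
  obtain ⟨z, hz⟩ := hfree
  -- If a segment of `L + 1` vertices lay opposite to the free line, each of its heights would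
  -- contain the inner end of a boundary edge. The heights are distinct because `L < n ⊤`, so there
  -- would be more than `L` boundary edges.
  have hsegment : ∀ y : TorusVertex n,
      ¬ ∀ j ≤ L, ¬ (y + j • unit n ⊤ ∈ A ↔ z ∈ A) := by
    intro y hy
    have h3 : ∀ j : Fin (L + 1), ∃ p ∈ bdry (gens n) A, p.1 ⊤ = (y + (j : ℕ) • unit n ⊤) ⊤ := by
      intro j
      set y' := y + (j : ℕ) • unit n ⊤
      have h4 : ¬ (y' ∈ A ↔ Function.update z ⊤ (y' ⊤) ∈ A) := by
        rw [update_eq_add, ← hz]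
        exact hy j (Nat.lt_succ_iff.1 j.2)
      obtain ⟨p, hp, hpy⟩ := exists_bdry_between h4
      exact ⟨p, hp, hpy ⊤ (by simp)⟩
    choose f hf hf' using h3
    have hinj : Function.Injective f := by
      intro j j' hjj
      have h4 := (hf' j).symm.trans ((congrArg (fun p => p.1 ⊤) hjj).trans (hf' j'))
      rw [Pi.add_apply, Pi.add_apply, add_right_inj, Fin.ext_iff, nsmul_unit_apply_self,
        nsmul_unit_apply_self, Nat.mod_eq_of_lt (by omega), Nat.mod_eq_of_lt (by omega)] at h4
      exact Fin.ext h4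
    have h5 := Finset.card_le_card_of_injOn (s := Finset.univ) f (fun j _ => hf j) hinj.injOn
    rw [Finset.card_univ, Fintype.card_fin, ← hL] at h5
    omega
  by_contra! hcon
  -- The segment starts at whichever of `x`, `b` is opposite to the free line; without meeting the
  -- inner boundary it cannot change side.
  by_cases hzA : z ∈ A
  · refine hsegment b fun j hj => ?_
    have : b + j • unit n ⊤ ∉ A := by
      induction j with
      | zero => simpa using hb
      | succ j ih =>
        intro hm
        refine (hcon (j + 1) hj).2 (mem_innerBdry.2 ⟨hm, -unit n ⊤,
          neg_mem_gens _ (unit_mem_gens _), ?_⟩)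
        rw [succ_nsmul, ← add_assoc, add_neg_cancel_right]
        exact ih (by omega)
    simp [this, hzA]
  · refine hsegment x fun j hj => ?_
    have : x + j • unit n ⊤ ∈ A := by
      induction j with
      | zero => simpa using hx
      | succ j ih =>
        by_contra hm
        refine (hcon j (by omega)).1 (mem_innerBdry.2 ⟨ih (by omega), unit n ⊤,
          unit_mem_gens _, ?_⟩)
        rwa [add_assoc, ← succ_nsmul]
    simp [this, hzA]

end Torus

/-! ### Squares and mod 2 cochains: the components of the boundary. -/

section Square

variable {V : Type*} [AddCommGroup V] [DecidableEq V] {S : Finset V}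

/-- The corners of a square are within distance two of each other. -/
theorem exists_square_sub_mem_ball (hS : ∀ s ∈ S, -s ∈ S) {a b z : V} (ha : a ∈ S) (hb : b ∈ S)
    {T : Finset V} (h : z ∈ T ∨ z + a ∈ T ∨ z + b ∈ T ∨ z + a + b ∈ T) :
    ∃ p ∈ T, z - p ∈ ball S 2 ∧ z + a - p ∈ ball S 2 ∧ z + b - p ∈ ball S 2 ∧
      z + a + b - p ∈ ball S 2 := by
  have ba := mem_ball_one ha
  have bb := mem_ball_one hb
  have na := neg_mem_ball hS ba
  have nb := neg_mem_ball hS bb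
  have b0 : (0 : V) ∈ ball S 2 := zero_mem_ball 2
  have b1 : ∀ {a : V}, a ∈ ball S 1 → a ∈ ball S 2 := fun ha => ball_mono (by norm_num) ha
  rcases h with h | h | h | h
  · refine ⟨_, h, ?_, ?_, ?_, ?_⟩
    · simpa using b0
    · simpa using b1 ba
    · simpa using b1 bb
    · rw [show z + a + b - z = a + b by abel]
      exact ball_add ba bb
  · refine ⟨_, h, ?_, ?_, ?_, ?_⟩
    · simpa using b1 na
    · simpa using b0
    · rw [show z + b - (z + a) = b + -a by abel]
      exact ball_add bb na
    · simpa using b1 bb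
  · refine ⟨_, h, ?_, ?_, ?_, ?_⟩
    · simpa using b1 nb
    · rw [show z + a - (z + b) = a + -b by abel]
      exact ball_add ba nb
    · simpa using b0
    · rw [show z + a + b - (z + b) = a by abel]
      exact b1 ba
  · refine ⟨_, h, ?_, ?_, ?_, ?_⟩
    · rw [show z - (z + a + b) = -a + -b by abel]
      exact ball_add na nb
    · rw [show z + a - (z + a + b) = -b by abel]
      exact b1 nb
    · rw [show z + b - (z + a + b) = -a by abel]
      exact b1 na
    · simpa using b0

end Square

section Cochain

set_option linter.unusedSectionVars false

variable {d : ℕ} {n : Fin d → ℕ} [∀ i, NeZero (n i)]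

/-- The sum of a cochain along the closed line through `z` in the direction `i`. -/
def lineSum (g : Fin d → TorusVertex n → ZMod 2) (i : Fin d) (z : TorusVertex n) : ZMod 2 :=
  ∑ k ∈ Finset.range (n i), g i (z + k • unit n i)

/-- The sum of a cochain over every elementary square vanishes. -/
def IsClosedCochain (g : Fin d → TorusVertex n → ZMod 2) : Prop :=
  ∀ i j z, g i z + g j (z + unit n i) = g j z + g i (z + unit n j)

/-- Summing the square identity over the strip between two parallel lines leaves only the two end
terms, which coincide because the lines close up. -/
theorem IsClosedCochain.lineSum_add_unit {g : Fin d → TorusVertex n → ZMod 2}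
    (hg : IsClosedCochain g) (i j : Fin d) (z : TorusVertex n) :
    lineSum g i (z + unit n j) = lineSum g i z := by
  have key : ∀ m : ℕ, ∑ k ∈ Finset.range m, g i (z + unit n j + k • unit n i) + g j z
      = ∑ k ∈ Finset.range m, g i (z + k • unit n i) + g j (z + m • unit n i) := by
    intro m
    induction m with
    | zero => simp
    | succ m ih =>
      rw [Finset.sum_range_succ, Finset.sum_range_succ, succ_nsmul, ← add_assoc z,
        show z + unit n j + m • unit n i = z + m • unit n i + unit n j from add_right_comm _ _ _]
      have := hg i j (z + m • unit n i)
      linear_combination ih - this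
  have := key (n i)
  rw [card_nsmul_unit, add_zero, add_left_inj] at this
  exact this

theorem IsClosedCochain.lineSum_eq {g : Fin d → TorusVertex n → ZMod 2}
    (hg : IsClosedCochain g) (i : Fin d) (z z' : TorusVertex n) :
    lineSum g i z = lineSum g i z' := by
  have := gens_connected (fun y => lineSum g i y = lineSum g i z') (fun y s hs => by
    obtain ⟨j, rfl | rfl⟩ := mem_gens.1 hs
    · rw [hg.lineSum_add_unit]
    · rw [← hg.lineSum_add_unit i j (y + -unit n j), neg_add_cancel_right]) z z'
  exact this.2 rfl

/-- A closed cochain with vanishing line sums is exact. -/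
theorem IsClosedCochain.exact {g : Fin d → TorusVertex n → ZMod 2}
    (hg : IsClosedCochain g) (h0 : ∀ i z, lineSum g i z = 0) :
    ∃ φ : TorusVertex n → ZMod 2, ∀ i z, φ (z + unit n i) = φ z + g i z := by
  have h20 : (2 : ZMod 2) = 0 := rfl
  have key : ∀ s : Finset (Fin d),
      ∃ φ : TorusVertex n → ZMod 2, ∀ i ∈ s, ∀ z, φ (z + unit n i) = φ z + g i z := by
    intro s
    induction s using Finset.induction_on with
    | empty => exact ⟨0, by simp⟩
    | insert j s hj ih =>
      obtain ⟨φ, hφ⟩ := ih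
      -- The failure of `φ` in the new direction. It is invariant in the directions already treated
      -- and sums to zero on every `j`-line, so integrating it along `j` corrects `φ` without
      -- spoiling the earlier directions.
      let f : TorusVertex n → ZMod 2 := fun z => g j z + φ z + φ (z + unit n j)
      have hf : ∀ i ∈ s, ∀ z, f (z + unit n i) = f z := by
        intro i hi z
        have h1 := hg i j z
        have h2 := hφ i hi z
        have h3 := hφ i hi (z + unit n j)
        simp only [f]
        rw [add_right_comm z (unit n i) (unit n j), h3, h2]
        have h4 : g j (z + unit n i) = g j z + g i (z + unit n j) - g i z := by
          rw [← h1]; ring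
        rw [h4]
        linear_combination (g i (z + unit n j)) * h20
      have hfsum : ∀ z, ∑ k ∈ Finset.range (n j), f (z + k • unit n j) = 0 := by
        intro z
        have h1 : ∀ m, ∑ k ∈ Finset.range m, f (z + k • unit n j)
            = ∑ k ∈ Finset.range m, g j (z + k • unit n j) + φ z + φ (z + m • unit n j) := by
          intro m
          induction m with
          | zero => simp [CharTwo.add_self_eq_zero]
          | succ m ih =>
            rw [Finset.sum_range_succ, Finset.sum_range_succ, ih]
            simp only [f]
            rw [succ_nsmul, ← add_assoc z]
            linear_combination (φ (z + m • unit n j)) * h20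
        rw [h1, card_nsmul_unit, add_zero, ← lineSum, h0, zero_add, CharTwo.add_self_eq_zero]
      let base : TorusVertex n → TorusVertex n := fun z => Function.update z j 0
      let ψ : TorusVertex n → ZMod 2 := fun z =>
        ∑ k ∈ Finset.range (z j : ℕ), f (base z + k • unit n j)
      have hbase : ∀ z, base z + (z j : ℕ) • unit n j = z := fun z => update_zero_add z j
      have hbj : ∀ z, base (z + unit n j) = base z := fun z => by
        funext i
        by_cases hi : i = j
        · subst hi; simp [base]
        · simp [base, Function.update_of_ne hi, unit_apply_of_ne hi]
      have hψj : ∀ z, ψ (z + unit n j) = ψ z + f z := by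
        intro z
        have hz : f z = f (base z + (z j : ℕ) • unit n j) := by rw [hbase]
        simp only [ψ]
        rw [hbj, hz, ← Finset.sum_range_succ (fun k => f (base z + k • unit n j))]
        have h1 : ((z + unit n j) j : ℕ) = ((z j : ℕ) + 1) % n j := by
          rw [Pi.add_apply, unit_apply_self, Fin.val_add, Fin.val_one', Nat.add_mod_mod]
        rw [h1]
        -- Only the wrap-around step needs the vanishing of the line sum.
        rcases Nat.lt_or_ge ((z j : ℕ) + 1) (n j) with h2 | h2
        · rw [Nat.mod_eq_of_lt h2]
        · have h3 : (z j : ℕ) + 1 = n j := le_antisymm (z j).2 h2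
          rw [h3, Nat.mod_self, hfsum]
          simp
      have hψi : ∀ i ∈ s, ∀ z, ψ (z + unit n i) = ψ z := by
        intro i hi z
        have hij : i ≠ j := by rintro rfl; exact hj hi
        have h1 : base (z + unit n i) = base z + unit n i := by
          funext l
          by_cases hl : l = j
          · subst hl; simp [base, unit_apply_of_ne hij.symm]
          · simp [base, Function.update_of_ne hl]
        have h2 : (z + unit n i) j = z j := by
          rw [Pi.add_apply, unit_apply_of_ne hij.symm, add_zero]
        simp only [ψ]
        rw [h1, h2]
        refine Finset.sum_congr rfl fun k _ => ?_
        rw [add_right_comm, hf i hi]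
      refine ⟨fun z => φ z + ψ z, fun i hi z => ?_⟩
      change φ (z + unit n i) + ψ (z + unit n i) = φ z + ψ z + g i z
      rcases Finset.mem_insert.1 hi with rfl | hi
      · rw [hψj]
        simp only [f]
        linear_combination (φ (z + unit n i)) * h20
      · rw [hφ i hi, hψi i hi]
        ring
  obtain ⟨φ, hφ⟩ := key Finset.univ
  exact ⟨φ, fun i z => hφ i (Finset.mem_univ i) z⟩

variable {A : Finset (TorusVertex n)}

open Classical in
/-- The indicator of the boundary edges whose inner endpoint is in `T`. -/
noncomputable def edgeInd (A T : Finset (TorusVertex n)) (z z' : TorusVertex n) : ZMod 2 :=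
  if (z ∈ T ∧ z' ∉ A) ∨ (z ∉ A ∧ z' ∈ T) then 1 else 0

theorem edgeInd_comm (T : Finset (TorusVertex n)) (z z' : TorusVertex n) :
    edgeInd A T z z' = edgeInd A T z' z := by
  rw [edgeInd, edgeInd]
  congr 1
  exact propext ⟨fun h => by tauto, fun h => by tauto⟩

/-- Near a vertex of `T` every boundary vertex belongs to `T`, so there the cochain is the
coboundary of the indicator of `A`. -/
theorem edgeInd_eq {T : Finset (TorusVertex n)} (hTI : T ⊆ innerBdry (gens n) A)
    (hT : ∀ v ∈ T, ∀ v' ∈ innerBdry (gens n) A, v' - v ∈ ball (gens n) 2 → v' ∈ T)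
    {p z s : TorusVertex n} (hp : p ∈ T) (hs : s ∈ gens n) (hz : z - p ∈ ball (gens n) 2)
    (hz' : z + s - p ∈ ball (gens n) 2) :
    edgeInd A T z (z + s) = (if z ∈ A then 1 else 0) + (if z + s ∈ A then 1 else 0) := by
  have h1 : z ∈ T ∧ z + s ∉ A ↔ z ∈ A ∧ z + s ∉ A :=
    ⟨fun h => ⟨(mem_innerBdry.1 (hTI h.1)).1, h.2⟩, fun h =>
      ⟨hT p hp z (mem_innerBdry.2 ⟨h.1, s, hs, h.2⟩) hz, h.2⟩⟩
  have h2 : z ∉ A ∧ z + s ∈ T ↔ z ∉ A ∧ z + s ∈ A :=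
    ⟨fun h => ⟨h.1, (mem_innerBdry.1 (hTI h.2)).1⟩, fun h =>
      ⟨h.1, hT p hp (z + s) (mem_innerBdry.2 ⟨h.2, -s, neg_mem_gens s hs, by simpa using h.1⟩) hz'⟩⟩
  simp only [edgeInd, h1, h2]
  have h11 : (1 : ZMod 2) + 1 = 0 := rfl
  by_cases hzA : z ∈ A <;> by_cases hzA' : z + s ∈ A <;> simp [hzA, hzA', h11]

/-- If a square has a corner in `T`, all corners are within distance two of it, and the cochain is a
coboundary on the square; otherwise it vanishes on the square. -/
theorem isClosedCochain_edgeInd {T : Finset (TorusVertex n)} (hTI : T ⊆ innerBdry (gens n) A)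
    (hT : ∀ v ∈ T, ∀ v' ∈ innerBdry (gens n) A, v' - v ∈ ball (gens n) 2 → v' ∈ T) :
    IsClosedCochain fun i z => edgeInd A T z (z + unit n i) := by
  intro i j z
  dsimp only
  have hi := unit_mem_gens (n := n) i
  have hj := unit_mem_gens (n := n) j
  have h20 : (2 : ZMod 2) = 0 := rfl
  rw [add_right_comm z (unit n j) (unit n i)]
  by_cases h : z ∈ T ∨ z + unit n i ∈ T ∨ z + unit n j ∈ T ∨ z + unit n i + unit n j ∈ T
  · obtain ⟨p, hpT, h00, h10, h01, h11⟩ := exists_square_sub_mem_ball neg_mem_gens hi hj h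
    rw [edgeInd_eq hTI hT hpT hi h00 h10, edgeInd_eq hTI hT hpT hj h10 h11,
      edgeInd_eq hTI hT hpT hj h00 h01, add_right_comm z (unit n i),
      edgeInd_eq hTI hT hpT hi h01 (by rwa [add_right_comm])]
    linear_combination ((if z + unit n i ∈ A then 1 else 0) - (if z + unit n j ∈ A then 1 else 0)) * h20
  · push Not at h
    simp [edgeInd, h.1, h.2.1, h.2.2.1, h.2.2.2]

variable [NeZero d]

/-- If both sides of `A` are connected, then every component of the boundary but a single one has at
least as many edges as the smallest section. -/
theorem sectionSize_le_card_component (hmono : Monotone n)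
    (hA : ∀ D : TorusVertex n → Prop, (∀ v ∈ A, ∀ s ∈ gens n, v + s ∈ A → (D v ↔ D (v + s))) →
      ∀ v ∈ A, ∀ v' ∈ A, (D v ↔ D v'))
    (hA' : ∀ D : TorusVertex n → Prop, (∀ v ∉ A, ∀ s ∈ gens n, v + s ∉ A → (D v ↔ D (v + s))) →
      ∀ v ∉ A, ∀ v' ∉ A, (D v ↔ D v'))
    {T : Finset (TorusVertex n)} (hTI : T ⊆ innerBdry (gens n) A)
    (hT : ∀ v ∈ T, ∀ v' ∈ innerBdry (gens n) A, v' - v ∈ ball (gens n) 2 → v' ∈ T)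
    (hne : T.Nonempty) (hne' : T ≠ innerBdry (gens n) A) :
    sectionSize n ≤ ((bdry (gens n) A).filter fun p => p.1 ∈ T).card := by
  set g : Fin d → TorusVertex n → ZMod 2 := fun i z => edgeInd A T z (z + unit n i) with hg
  have hclosed : IsClosedCochain g := isClosedCochain_edgeInd hTI hT
  have hTA : ∀ {v}, v ∈ T → v ∈ A := fun hv => (mem_innerBdry.1 (hTI hv)).1
  by_cases h0 : ∀ i z, lineSum g i z = 0
  · exfalso
    obtain ⟨φ, hφ⟩ := hclosed.exact h0
    have hφs : ∀ z, ∀ s ∈ gens n, φ (z + s) = φ z + edgeInd A T z (z + s) := by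
      intro z s hs
      obtain ⟨i, rfl | rfl⟩ := mem_gens.1 hs
      · exact hφ i z
      · have h1 := hφ i (z + -unit n i)
        simp only [hg, neg_add_cancel_right] at h1
        rw [edgeInd_comm, h1, add_assoc, CharTwo.add_self_eq_zero, add_zero]
    have hφA : ∀ v ∈ A, ∀ v' ∈ A, φ v = φ v' := fun v hv v' hv' => by
      refine (hA (fun y => φ y = φ v') (fun y hy s hs hys => ?_) v hv v' hv').2 rfl
      rw [hφs y s hs, edgeInd, if_neg (by tauto), add_zero]
    have hφA' : ∀ v ∉ A, ∀ v' ∉ A, φ v = φ v' := fun v hv v' hv' => by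
      refine (hA' (fun y => φ y = φ v') (fun y hy s hs hys => ?_) v hv v' hv').2 rfl
      rw [hφs y s hs, edgeInd, if_neg, add_zero]
      rintro (h | h)
      · exact hy (hTA h.1)
      · exact hys (hTA h.2)
    -- `φ` is constant on `A` and on its complement, yet it jumps across a boundary edge at `T` and
    -- does not jump across one elsewhere.
    obtain ⟨v, hv⟩ := hne
    obtain ⟨hvA, s, hs, hvs⟩ := mem_innerBdry.1 (hTI hv)
    obtain ⟨v', hv', hvT'⟩ := Finset.exists_of_ssubset (hTI.ssubset_of_ne hne')
    obtain ⟨hvA', s', hs', hvs'⟩ := mem_innerBdry.1 hv'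
    have h1 := hφs v s hs
    have h2 := hφs v' s' hs'
    rw [edgeInd, if_pos (Or.inl ⟨hv, hvs⟩)] at h1
    rw [edgeInd, if_neg (by rintro (h | h); exacts [hvT' h.1, h.1 hvA']), add_zero,
      hφA' _ hvs' _ hvs, hφA _ hvA' _ hvA, h1, add_eq_left] at h2
    exact one_ne_zero h2
  · push Not at h0
    obtain ⟨i, z₀, hz₀⟩ := h0
    refine sectionSize_le hmono i _ fun z => ?_
    -- A closed cochain has the same sum on all parallel lines, so one odd line forces every line in
    -- the direction `i` to cross an edge of the component.
    have h1 : lineSum g i z ≠ 0 := by rwa [hclosed.lineSum_eq i z z₀]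
    obtain ⟨k, -, hk⟩ := Finset.exists_ne_zero_of_sum_ne_zero h1
    have hk' : (z + k • unit n i ∈ T ∧ z + k • unit n i + unit n i ∉ A) ∨
        (z + k • unit n i ∉ A ∧ z + k • unit n i + unit n i ∈ T) := by
      by_contra h2
      exact hk (by simp only [hg, edgeInd]; rw [if_neg h2])
    rcases hk' with ⟨h2, h3⟩ | ⟨h2, h3⟩
    · refine ⟨(z + k • unit n i, unit n i), Finset.mem_filter.2
        ⟨mem_bdry.2 ⟨hTA h2, unit_mem_gens i, h3⟩, h2⟩, fun j hj => ?_⟩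
      change (z + k • unit n i) j = z j
      rw [Pi.add_apply, nsmul_unit_apply_of_ne hj, add_zero]
    · refine ⟨(z + k • unit n i + unit n i, -unit n i), Finset.mem_filter.2
        ⟨mem_bdry.2 ⟨hTA h3, neg_mem_gens _ (unit_mem_gens i), by simpa using h2⟩, h3⟩,
        fun j hj => ?_⟩
      change (z + k • unit n i + unit n i) j = z j
      rw [Pi.add_apply, Pi.add_apply, nsmul_unit_apply_of_ne hj, unit_apply_of_ne hj, add_zero,
        add_zero]

end Cochain

/-! ### Root sets of the boundary components. -/

section Roots

variable {V : Type*} [AddCommGroup V] [DecidableEq V] {S A : Finset V}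

/-- If every component of the boundary but a single one has at least `a` edges, then any vertex of a
boundary shorter than `a` is a root. -/
theorem isRootSet_singleton {a : ℕ} (ha : (bdry S A).card < a)
    (hcomp : ∀ T ⊆ innerBdry S A,
      (∀ v ∈ T, ∀ v' ∈ innerBdry S A, v' - v ∈ ball S 2 → v' ∈ T) →
      T.Nonempty → T ≠ innerBdry S A → a ≤ ((bdry S A).filter fun p => p.1 ∈ T).card) (v : V) :
    IsRootSet S A {v} := by
  intro T hTI hvT hT
  by_contra hne
  have h1 := hcomp T hTI hT ⟨v, hvT v rfl⟩ hne
  have h2 := Finset.card_le_card (Finset.filter_subset (fun p : V × V => p.1 ∈ T) (bdry S A))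
  omega

/-- A boundary all of whose components but a single one have at least `a` edges has a set of roots
with few elements. -/
theorem exists_isRootSet (hS : ∀ s ∈ S, -s ∈ S) {a k : ℕ}
    (ha : (bdry S A).card < (k + 2) * a) (hI : (innerBdry S A).Nonempty)
    (hcomp : ∀ T ⊆ innerBdry S A,
      (∀ v ∈ T, ∀ v' ∈ innerBdry S A, v' - v ∈ ball S 2 → v' ∈ T) →
      T.Nonempty → T ≠ innerBdry S A → a ≤ ((bdry S A).filter fun p => p.1 ∈ T).card) :
    ∃ b : Fin (k + 1) → V, (∀ i, b i ∈ innerBdry S A) ∧ IsRootSet S A (Set.range b) := by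
  classical
  set I := innerBdry S A with hIdef
  let r : V → V → Prop := fun v v' => v ∈ I ∧ v' ∈ I ∧ v' - v ∈ ball S 2
  have hrsymm : ∀ {v v'}, r v v' → r v' v := fun h => ⟨h.2.1, h.1, sub_mem_ball_comm hS h.2.2⟩
  let c : V → Finset V := fun v => I.filter fun v' => Relation.ReflTransGen r v v'
  have hcself : ∀ {v}, v ∈ I → v ∈ c v := fun hv => Finset.mem_filter.2 ⟨hv, .refl⟩
  have hgsymm : ∀ {v v'}, Relation.ReflTransGen r v v' → Relation.ReflTransGen r v' v := by
    intro v v' h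
    induction h with
    | refl => exact .refl
    | tail _ h ih => exact .head (hrsymm h) ih
  have hceq : ∀ {v v'}, v' ∈ c v → c v' = c v := by
    intro v v' h
    have h1 := (Finset.mem_filter.1 h).2
    ext y
    simp only [c, Finset.mem_filter]
    exact and_congr_right fun _ => ⟨fun h2 => h1.trans h2, fun h2 => (hgsymm h1).trans h2⟩
  have hcclosed : ∀ v, ∀ y ∈ c v, ∀ y' ∈ I, y' - y ∈ ball S 2 → y' ∈ c v := by
    intro v y hy y' hy' hyy
    obtain ⟨hyI, hvy⟩ := Finset.mem_filter.1 hy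
    exact Finset.mem_filter.2 ⟨hy', hvy.tail ⟨hyI, hy', hyy⟩⟩
  let 𝓒 : Finset (Finset V) := I.image c
  have hdisj : (𝓒 : Set (Finset V)).PairwiseDisjoint
      (fun T => (bdry S A).filter fun p => p.1 ∈ T) := by
    intro T hT T' hT' hne
    obtain ⟨v, -, rfl⟩ := Finset.mem_image.1 hT
    obtain ⟨v', -, rfl⟩ := Finset.mem_image.1 hT'
    rw [Function.onFun, Finset.disjoint_left]
    intro p hp hp'
    exact hne ((hceq (Finset.mem_filter.1 hp).2).symm.trans (hceq (Finset.mem_filter.1 hp').2))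
  have hcard : 𝓒.card ≤ k + 1 := by
    by_contra! hlt
    have h1 : 𝓒.card * a ≤ ∑ T ∈ 𝓒, ((bdry S A).filter fun p => p.1 ∈ T).card := by
      rw [← smul_eq_mul]
      refine Finset.card_nsmul_le_sum _ _ _ fun T hT => ?_
      obtain ⟨v, hv, rfl⟩ := Finset.mem_image.1 hT
      -- More than `k + 1 ≥ 1` components means that none is the whole boundary, so the lower bound
      -- `a` applies to each.
      refine hcomp _ (Finset.filter_subset _ _) (hcclosed v) ⟨v, hcself hv⟩ fun heq => ?_
      have h2 : 𝓒 ⊆ {c v} := fun T' hT' => by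
        obtain ⟨v', hv', rfl⟩ := Finset.mem_image.1 hT'
        have : v' ∈ c v := heq ▸ hv'
        exact Finset.mem_singleton.2 (hceq this)
      have := Finset.card_le_card h2
      rw [Finset.card_singleton] at this
      omega
    rw [← Finset.card_biUnion hdisj] at h1
    have h2 : (𝓒.biUnion fun T => (bdry S A).filter fun p => p.1 ∈ T).card ≤ (bdry S A).card :=
      Finset.card_le_card (Finset.biUnion_subset.2 fun T _ => Finset.filter_subset _ _)
    have h3 : (k + 2) * a ≤ 𝓒.card * a := Nat.mul_le_mul_right a hlt
    omega
  have : Nonempty 𝓒 := by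
    obtain ⟨v, hv⟩ := hI
    exact ⟨⟨c v, Finset.mem_image_of_mem c hv⟩⟩
  obtain ⟨f⟩ : Nonempty (𝓒 ↪ Fin (k + 1)) :=
    Function.Embedding.nonempty_of_card_le (by simpa using hcard)
  have hrep : ∀ T : 𝓒, ∃ v ∈ I, c v = T := fun T => by
    obtain ⟨v, hv, h⟩ := Finset.mem_image.1 T.2
    exact ⟨v, hv, h⟩
  choose rep hrepI hrep using hrep
  refine ⟨fun i => rep (Function.invFun f i), fun i => hrepI _, ?_⟩
  intro T hTI hRT hT
  refine Finset.Subset.antisymm hTI fun v hv => ?_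
  -- When there are fewer than `k + 1` components, the left inverse of the embedding repeats some
  -- representatives.
  obtain ⟨i, hi⟩ := Function.invFun_surjective f.injective ⟨c v, Finset.mem_image_of_mem c hv⟩
  have h1 := hrep (Function.invFun f i)
  have h2 := hRT _ ⟨i, rfl⟩
  have h3 : v ∈ c (rep (Function.invFun f i)) := by
    rw [h1, hi]; exact hcself hv
  have h4 := (Finset.mem_filter.1 h3).2
  clear h1 h3 hi hv
  induction h4 with
  | refl => exact h2
  | tail _ h5 ih => exact hT _ ih _ h5.2.1 h5.2.2

end Roots

/-! ### Minimal cutsets and their two sides. -/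

section Cut

variable {V : Type*} {G : SimpleGraph V} {Γ : Set (Sym2 V)} {x b : V}

theorem self_mem_comp (v : V) : v ∈ comp G Γ v := SimpleGraph.Reachable.refl v

theorem mem_comp_of_adj {v u w : V} (hu : u ∈ comp G Γ v) (h : G.Adj u w) (hΓ : s(u, w) ∉ Γ) :
    w ∈ comp G Γ v :=
  SimpleGraph.Reachable.trans hu (SimpleGraph.deleteEdges_adj.2 ⟨h, hΓ⟩).reachable

/-- A predicate that is constant along the edges inside a component is constant on it. -/
theorem iff_of_mem_comp {v : V} {D : V → Prop}
    (hD : ∀ u ∈ comp G Γ v, ∀ w ∈ comp G Γ v, G.Adj u w → (D u ↔ D w)) {u w : V}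
    (hu : u ∈ comp G Γ v) (hw : w ∈ comp G Γ v) : (D u ↔ D w) := by
  have key : ∀ {u}, u ∈ comp G Γ v → (D v ↔ D u) := by
    intro u hu
    have hu' := (SimpleGraph.reachable_iff_reflTransGen _ _).1 hu
    clear hu
    induction hu' with
    | refl => exact Iff.rfl
    | tail h1 h2 ih =>
      have h3 := (SimpleGraph.reachable_iff_reflTransGen _ _).2 h1
      exact ih.trans (hD _ h3 _ (SimpleGraph.Reachable.trans h3 h2.reachable)
        (SimpleGraph.deleteEdges_adj.1 h2).1)
  exact (key hu).symm.trans (key hw)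

theorem Separates.notMem_comp (h : Separates G Γ x b) : b ∉ comp G Γ x := by
  rintro ⟨p⟩
  obtain ⟨e, he, heΓ⟩ := h (p.mapLe (SimpleGraph.deleteEdges_le Γ))
  rw [SimpleGraph.Walk.edges_mapLe_eq_edges] at he
  have := p.edges_subset_edgeSet he
  rw [SimpleGraph.edgeSet_deleteEdges] at this
  exact this.2 heΓ

/-- Every edge of a minimal cutset crosses every set that separates `x` from `b` and whose boundary
is contained in the cutset. -/
theorem crosses_of_mem_MCut (hΓ : Γ ∈ MCut G x b) {D : Set V} (hx : x ∈ D) (hb : b ∉ D)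
    (hD : ∀ v w, G.Adj v w → v ∈ D → w ∉ D → s(v, w) ∈ Γ) {v w : V} (h : s(v, w) ∈ Γ) :
    v ∈ D ↔ w ∉ D := by
  by_contra hvw
  -- The edges of `Γ` crossing `D` already separate, so by minimality none can be discarded.
  refine hΓ.2.2 {e ∈ Γ | ∃ v w, e = s(v, w) ∧ v ∈ D ∧ w ∉ D} ⟨fun e he => he.1, fun hsub => ?_⟩
    fun p => ?_
  · obtain ⟨-, v', w', he, hv', hw'⟩ := hsub h
    rcases Sym2.eq_iff.1 he with ⟨rfl, rfl⟩ | ⟨rfl, rfl⟩ <;> tauto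
  · obtain ⟨e, he, h1, h2⟩ := p.exists_boundary_dart D hx hb
    exact ⟨e.edge, List.mem_map_of_mem he, hD _ _ e.adj h1 h2, _, _, rfl, h1, h2⟩

/-- This identifies a minimal cutset with the full edge boundary of the component of `x`, so that
`Γ` can be replaced by that vertex set. -/
theorem mem_MCut_iff (hΓ : Γ ∈ MCut G x b) {v w : V} :
    s(v, w) ∈ Γ ↔ G.Adj v w ∧ (v ∈ comp G Γ x ↔ w ∉ comp G Γ x) := by
  constructor
  · refine fun h => ⟨hΓ.1 h, crosses_of_mem_MCut hΓ (self_mem_comp x) hΓ.2.1.notMem_comp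
      (fun v w hvw hv hw => ?_) h⟩
    by_contra h'
    exact hw (mem_comp_of_adj hv hvw h')
  · rintro ⟨h, h'⟩
    by_contra hΓ'
    by_cases hv : v ∈ comp G Γ x
    · exact h'.1 hv (mem_comp_of_adj hv h hΓ')
    · exact hv (mem_comp_of_adj (not_not.1 fun hw => hv (h'.2 hw)) h.symm
        (by rwa [Sym2.eq_swap]))

/-- A minimal cutset of a connected graph has only two sides. -/
theorem compl_comp_of_mem_MCut (hG : G.Preconnected) (hΓ : Γ ∈ MCut G x b) {v : V} :
    v ∉ comp G Γ x ↔ v ∈ comp G Γ b := by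
  have hdisj : ∀ {v}, v ∈ comp G Γ b → v ∉ comp G Γ x := fun h h' =>
    hΓ.2.1.notMem_comp (SimpleGraph.Reachable.trans h' (SimpleGraph.Reachable.symm h))
  -- Every edge of `Γ` crosses both components. A path leaving their union would do so through an
  -- edge of `Γ` that misses one of them.
  have hcb : ∀ {v w}, s(v, w) ∈ Γ → (v ∈ (comp G Γ b)ᶜ ↔ w ∉ (comp G Γ b)ᶜ) := fun h =>
    crosses_of_mem_MCut (D := (comp G Γ b)ᶜ) hΓ (fun hx => hdisj hx (self_mem_comp x)) (fun hb => hb (self_mem_comp b))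
      (fun v w hvw hv hw => by
        by_contra h'
        exact hv (mem_comp_of_adj (not_not.1 hw) hvw.symm (by rwa [Sym2.eq_swap]))) h
  refine ⟨fun hv => ?_, hdisj⟩
  by_contra hv'
  obtain ⟨p⟩ := hG x v
  obtain ⟨e, -, h1, h2⟩ := p.exists_boundary_dart (comp G Γ x ∪ comp G Γ b)
    (Or.inl (self_mem_comp x)) (by rintro (h | h); exacts [hv h, hv' h])
  have h2x := fun h => h2 (Or.inl h)
  have h2b := fun h => h2 (Or.inr h)
  rcases h1 with h1 | h1
  · have he : s(e.toProd.1, e.toProd.2) ∈ Γ := by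
      by_contra h'
      exact h2x (mem_comp_of_adj h1 e.adj h')
    exact (hcb he).1 (fun h => hdisj h h1) h2b
  · have he : s(e.toProd.1, e.toProd.2) ∈ Γ := by
      by_contra h'
      exact h2b (mem_comp_of_adj h1 e.adj h')
    exact hdisj h1 (((mem_MCut_iff hΓ).1 he).2.2 h2x)

end Cut

/-! ### Translation from cutsets to odd sets. -/

section CayleyCut

set_option linter.unusedSectionVars false

variable {V : Type*} [Fintype V] {G : SimpleGraph V} {Γ : Set (Sym2 V)} {x b : V}

open Classical in
/-- The component of `x` as a finite set. -/
noncomputable def side (G : SimpleGraph V) (Γ : Set (Sym2 V)) (x : V) : Finset V :=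
  (comp G Γ x).toFinset

theorem mem_side {v : V} : v ∈ side G Γ x ↔ v ∈ comp G Γ x := by simp [side]

variable [AddCommGroup V] [DecidableEq V] {S : Finset V}

theorem side_connected (hG : ∀ v w, G.Adj v w ↔ w - v ∈ S)
    (D : V → Prop)
    (hD : ∀ v ∈ side G Γ x, ∀ s ∈ S, v + s ∈ side G Γ x → (D v ↔ D (v + s))) :
    ∀ v ∈ side G Γ x, ∀ v' ∈ side G Γ x, (D v ↔ D v') := fun v hv v' hv' => by
  refine iff_of_mem_comp (fun u hu w hw huw => ?_) (mem_side.1 hv) (mem_side.1 hv')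
  have := hD u (mem_side.2 hu) (w - u) ((hG u w).1 huw) (by simpa using mem_side.2 hw)
  simpa using this

theorem compl_side_connected (hG : ∀ v w, G.Adj v w ↔ w - v ∈ S)
    (hconn : G.Preconnected) (hΓ : Γ ∈ MCut G x b) (D : V → Prop)
    (hD : ∀ v ∉ side G Γ x, ∀ s ∈ S, v + s ∉ side G Γ x → (D v ↔ D (v + s))) :
    ∀ v ∉ side G Γ x, ∀ v' ∉ side G Γ x, (D v ↔ D v') := by
  have h : ∀ {v}, v ∉ side G Γ x ↔ v ∈ side G Γ b := fun {v} => by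
    rw [mem_side, mem_side, compl_comp_of_mem_MCut hconn hΓ]
  simp only [h] at hD ⊢
  exact side_connected hG D hD

theorem mem_MCut_iff_bdry (hG : ∀ v w, G.Adj v w ↔ w - v ∈ S) (hΓ : Γ ∈ MCut G x b) {v s : V}
    (hv : v ∈ side G Γ x) : s(v, v + s) ∈ Γ ↔ s ∈ S ∧ v + s ∉ side G Γ x := by
  rw [mem_MCut_iff hΓ, hG, add_sub_cancel_left, mem_side]
  simp [mem_side.1 hv]

theorem add_notMem_side (hΓ : Γ ∈ MCut G x b) {v w : V} (h : s(v, w) ∈ Γ) (hv : v ∉ side G Γ x) :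
    w ∈ side G Γ x := by
  rw [mem_side] at hv ⊢
  exact not_not.1 fun hw => hv (((mem_MCut_iff hΓ).1 h).2.2 hw)

/-- Each edge of the cutset has exactly one endpoint in the side of `x`, so orienting it outwards is
a bijection with `bdry`. -/
theorem ncard_eq_card_bdry (hG : ∀ v w, G.Adj v w ↔ w - v ∈ S) (hΓ : Γ ∈ MCut G x b) :
    Γ.ncard = (bdry S (side G Γ x)).card := by
  have h1 : Γ = (fun p : V × V => s(p.1, p.1 + p.2)) '' (bdry S (side G Γ x) : Set (V × V)) := by
    ext e
    simp only [Set.mem_image, Finset.mem_coe, mem_bdry]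
    constructor
    · induction e using Sym2.inductionOn with
      | hf v w =>
        intro h
        by_cases hv : v ∈ side G Γ x
        · have h' := (mem_MCut_iff_bdry hG hΓ (s := w - v) hv).1 (by simpa using h)
          exact ⟨(v, w - v), ⟨hv, h'.1, h'.2⟩, by simp⟩
        · have hw := add_notMem_side hΓ h hv
          have h' := (mem_MCut_iff_bdry hG hΓ (s := v - w) hw).1 (by simpa [Sym2.eq_swap] using h)
          exact ⟨(w, v - w), ⟨hw, h'.1, h'.2⟩, by simp [Sym2.eq_swap]⟩
    · rintro ⟨⟨v, s⟩, ⟨h1, h2, h3⟩, rfl⟩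
      exact (mem_MCut_iff_bdry hG hΓ h1).2 ⟨h2, h3⟩
  conv_lhs => rw [h1]
  rw [Set.InjOn.ncard_image, Set.ncard_coe_finset]
  rintro ⟨v, s⟩ hp ⟨v', s'⟩ hp' heq
  rw [Finset.mem_coe, mem_bdry] at hp hp'
  rcases Sym2.eq_iff.1 heq with ⟨h1, h2⟩ | ⟨h1, h2⟩
  · dsimp only at h1 h2
    rw [h1] at h2
    rw [h1, add_left_cancel h2]
  · dsimp only at h1 h2 hp hp'
    exact absurd hp.1 (h1 ▸ hp'.2.2)

theorem plaquettes_eq_outDeg (hG : ∀ v w, G.Adj v w ↔ w - v ∈ S) (hΓ : Γ ∈ MCut G x b) {v : V}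
    (hv : v ∈ side G Γ x) : plaquettes Γ v = outDeg S (side G Γ x) v := by
  have h1 : {e ∈ Γ | v ∈ e}
      = (fun s => s(v, v + s)) '' (S.filter fun s => v + s ∉ side G Γ x : Finset V) := by
    ext e
    simp only [Set.mem_image, Finset.mem_coe, Finset.mem_filter, Set.mem_ofPred_eq]
    constructor
    · rintro ⟨he, w, rfl⟩
      exact ⟨w - v, (mem_MCut_iff_bdry hG hΓ hv).1 (by simpa using he), by simp⟩
    · rintro ⟨s, hs, rfl⟩
      exact ⟨(mem_MCut_iff_bdry hG hΓ hv).2 hs, Sym2.mem_mk_left _ _⟩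
  rw [plaquettes, h1, Set.InjOn.ncard_image, Set.ncard_coe_finset, outDeg]
  intro s _ s' _ h
  exact add_left_cancel (Sym2.congr_right.1 h)

theorem mem_innerBoundary_iff (hG : ∀ v w, G.Adj v w ↔ w - v ∈ S) (hΓ : Γ ∈ MCut G x b) {v : V} :
    v ∈ innerBoundary G Γ x ↔ v ∈ side G Γ x ∧ 0 < outDeg S (side G Γ x) v := by
  constructor
  · rintro ⟨h1, h2⟩
    have h1' := mem_side.2 h1
    exact ⟨h1', by rwa [← plaquettes_eq_outDeg hG hΓ h1']⟩
  · rintro ⟨h1, h2⟩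
    exact ⟨mem_side.1 h1, by rwa [plaquettes_eq_outDeg hG hΓ h1]⟩

theorem ncard_neighborSet (hG : ∀ v w, G.Adj v w ↔ w - v ∈ S) (v : V) :
    (G.neighborSet v).ncard = S.card := by
  have h1 : G.neighborSet v = (fun s => v + s) '' (S : Set V) := by
    ext w
    simp only [SimpleGraph.mem_neighborSet, hG, Set.mem_image, Finset.mem_coe]
    exact ⟨fun h => ⟨_, h, by simp⟩, by rintro ⟨s, hs, rfl⟩; simpa using hs⟩
  rw [h1, Set.InjOn.ncard_image (add_right_injective v).injOn, Set.ncard_coe_finset]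

/-- The side of an odd cutset is an odd set. -/
theorem isOddSet_side (hG : ∀ v w, G.Adj v w ↔ w - v ∈ S) (hS : ∀ s ∈ S, -s ∈ S)
    {Veven Vodd : Set V} (hbip : G.IsBipartiteWith Veven Vodd) (hΓ : Γ ∈ OMCut G Vodd x b) :
    IsOddSet S (side G Γ x) (· ∈ Veven) where
  neg_mem := hS
  flip v s hs := by
    have hdis := Set.disjoint_left.1 hbip.disjoint
    have := hbip.mem_of_adj ((hG v (v + s)).2 (by simpa using hs))
    constructor
    · rintro h1 h2
      rcases this with h | h
      · exact hdis h1 h.2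
      · exact hdis h2 h.1
    · intro h1
      rcases this with h | h
      · exact absurd h.1 h1
      · exact h.2
  inner v hv he s hs := by
    by_contra h
    refine Set.disjoint_left.1 hbip.disjoint he (hΓ.2 ((mem_innerBoundary_iff hG hΓ.1).2 ⟨hv, ?_⟩))
    exact Finset.card_pos.2 ⟨s, Finset.mem_filter.2 ⟨hs, h⟩⟩

/-- A set which contains the odd vertices of the side of an odd cutset with many neighbours in it is
an interior approximation. -/
theorem isInteriorApproximation_of_inDeg (hG : ∀ v w, G.Adj v w ↔ w - v ∈ S)
    {Veven Vodd : Set V} (hbip : G.IsBipartiteWith Veven Vodd) (hΓ : Γ ∈ OMCut G Vodd x b) (d : ℕ)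
    {E : Set V} (hE : E ⊆ side G Γ x)
    (hE' : ∀ v ∈ side G Γ x, v ∉ Veven → 0 < outDeg S (side G Γ x) v →
      √(d : ℝ) < inDeg S (side G Γ x) v → v ∈ E) :
    IsInteriorApproximation G d Γ x E := by
  refine ⟨fun v hv => ?_, fun v hv => mem_side.1 (hE hv)⟩
  obtain ⟨h1, h2⟩ := hv
  obtain ⟨h3, h4⟩ := (mem_innerBoundary_iff hG hΓ.1).1 h1
  refine hE' v h3 (fun h => Set.disjoint_left.1 hbip.disjoint h (hΓ.2 h1)) h4 ?_
  -- As the in- and out-degrees sum to the degree, having at most `√d` neighbours in the side means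
  -- being exposed.
  by_contra! h5
  refine h2 ⟨h1, ?_⟩
  rw [ncard_neighborSet hG, plaquettes_eq_outDeg hG hΓ.1 h3,
    ← inDeg_add_outDeg (A := side G Γ x) (S := S) v]
  push_cast
  linarith

end CayleyCut

section IsolatedSide

variable {V : Type*} [AddCommGroup V] {S : Finset V}

/-- A connected set with two elements contains a neighbour of each of its elements. -/
theorem exists_add_of_connected {P : V → Prop}
    (hP : ∀ D : V → Prop, (∀ v, P v → ∀ s ∈ S, P (v + s) → (D v ↔ D (v + s))) →
      ∀ v, P v → ∀ v', P v' → (D v ↔ D v'))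
    (hS : ∀ s ∈ S, -s ∈ S) {x v : V} (hx : P x) (hne : ∃ y, P y ∧ y ≠ x) (hv : P v) :
    ∃ s ∈ S, P (v + s) := by
  by_contra! h
  have key : ∀ y, P y → y = v := fun y hy => (hP (· = v) (fun u hu s hs hus => by
    constructor
    · rintro rfl
      exact absurd hus (h s hs)
    · rintro rfl
      exact absurd (by simpa using hu) (h (-s) (hS s hs))) v hv y hy).1 rfl
  obtain ⟨y, hy, hyx⟩ := hne
  exact hyx ((key y hy).trans (key x hx).symm)

end IsolatedSide

theorem torus_preconnected {d : ℕ} {n : Fin d → ℕ} [∀ i, NeZero (n i)] (hn : ∀ i, 2 ≤ n i) :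
    (torus n).Preconnected := fun u v =>
  (gens_connected (fun z => (torus n).Reachable u z) (fun z s hs => by
    have : (torus n).Adj z (z + s) := (torus_adj hn).2 (by simpa using hs)
    exact ⟨fun h => h.trans this.reachable, fun h => h.trans this.symm.reachable⟩) u v).1 (.refl u)

/-! ### The Hamming syndromes on the torus. -/

section Parity

/-- Reduction modulo two of the residues modulo an even number. -/
def parity {m : ℕ} [NeZero m] (hm : Even m) : Fin m →+ ZMod 2 where
  toFun t := ((t : ℕ) : ZMod 2)
  map_zero' := by simp
  map_add' s t := by
    have h2 : ((m : ℕ) : ZMod 2) = 0 := (ZMod.natCast_eq_zero_iff _ _).2 hm.two_dvd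
    have h := congrArg (Nat.cast : ℕ → ZMod 2) (Nat.div_add_mod ((s : ℕ) + t) m)
    push_cast at h
    rw [h2, zero_mul, zero_add] at h
    rw [Fin.val_add, h]

theorem parity_one {m : ℕ} [NeZero m] (hm : Even m) : parity hm 1 = 1 := by
  have h0 : m ≠ 0 := NeZero.ne m
  have h2 : 2 ≤ m := by
    obtain ⟨r, rfl⟩ := hm
    omega
  have : ((1 : Fin m) : ℕ) = 1 := by
    rw [Fin.val_one']
    exact Nat.mod_eq_of_lt h2
  change (((1 : Fin m) : ℕ) : ZMod 2) = 1
  rw [this, Nat.cast_one]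

variable {d : ℕ} {n : Fin d → ℕ} [∀ i, NeZero (n i)]

/-- The syndromes of the blocks, for a labelling of coordinates by pairs of a block and a value. -/
def syndromeHom (hn : ∀ i, Even (n i)) {m : ℕ} (ι : Fin 3 × (Fin m → ZMod 2) ↪ Fin d) :
    TorusVertex n →+ (Fin 3 → Fin m → ZMod 2) where
  toFun z b := ∑ a, parity (hn (ι (b, a))) (z (ι (b, a))) • a
  map_zero' := by
    funext b
    simp
  map_add' z z' := by
    funext b
    simp [add_smul, Finset.sum_add_distrib]

theorem syndromeHom_unit_label (hn : ∀ i, Even (n i)) {m : ℕ}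
    (ι : Fin 3 × (Fin m → ZMod 2) ↪ Fin d) (b : Fin 3) (a : Fin m → ZMod 2) :
    syndromeHom hn ι (unit n (ι (b, a))) = Pi.single b a := by
  funext b'
  change ∑ a', parity (hn (ι (b', a'))) (unit n (ι (b, a)) (ι (b', a'))) • a' = _
  by_cases hb : b' = b
  · subst hb
    rw [Finset.sum_eq_single a, unit_apply_self, parity_one, one_smul, Pi.single_eq_same]
    · intro a' _ ha'
      rw [unit_apply_of_ne fun h => ha' (congrArg Prod.snd (ι.injective h)), map_zero, zero_smul]
    · simp
  · rw [Pi.single_eq_of_ne hb]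
    refine Finset.sum_eq_zero fun a' _ => ?_
    rw [unit_apply_of_ne fun h => hb (congrArg Prod.fst (ι.injective h)), map_zero, zero_smul]

theorem syndromeHom_unit (hn : ∀ i, Even (n i)) {m : ℕ} (ι : Fin 3 × (Fin m → ZMod 2) ↪ Fin d)
    (i : Fin d) : ∃ b c, syndromeHom hn ι (unit n i) = Pi.single b c := by
  by_cases h : ∃ p, ι p = i
  · obtain ⟨⟨b, a⟩, rfl⟩ := h
    exact ⟨b, a, syndromeHom_unit_label hn ι b a⟩
  · refine ⟨0, 0, ?_⟩
    funext b'
    rw [Pi.single_zero]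
    refine Finset.sum_eq_zero fun a' _ => ?_
    rw [unit_apply_of_ne fun h' => h ⟨_, h'⟩, map_zero, zero_smul]

/-- The syndrome of three Hamming codes on the torus. -/
def torusSyndrome (hn : ∀ i, Even (n i)) {m : ℕ} (ι : Fin 3 × (Fin m → ZMod 2) ↪ Fin d) :
    Syndrome (gens n) (Fin m → ZMod 2) where
  Φ := syndromeHom hn ι
  -- The coordinate labelled by the value zero does not contribute to the syndrome; correcting by
  -- zero means staying in place.
  g b a := if a = 0 then 0 else unit n (ι (b, a))
  g_zero b := if_pos rfl
  g_mem b a ha := by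
    rw [if_neg ha]
    exact unit_mem_gens _
  Φ_g b a := by
    by_cases ha : a = 0
    · rw [if_pos ha, ha, map_zero, Pi.single_zero]
    · rw [if_neg ha, syndromeHom_unit_label]
  Φ_mem s hs := by
    obtain ⟨i, rfl | rfl⟩ := mem_gens.1 hs
    · exact syndromeHom_unit hn ι i
    · obtain ⟨b, c, h⟩ := syndromeHom_unit hn ι i
      exact ⟨b, -c, by rw [map_neg, h, Pi.single_neg]⟩
  add_self a := funext fun _ => CharTwo.add_self_eq_zero _

end Parity

/-! ### Counting the possible roots. -/

section RootCandidates

variable {d : ℕ} {n : Fin d → ℕ} [∀ i, NeZero (n i)]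

theorem mod_nsmul_unit (i : Fin d) (k : ℕ) : (k % n i) • unit n i = k • unit n i := by
  conv_rhs => rw [← Nat.mod_add_div k (n i), add_nsmul, mul_nsmul, card_nsmul_unit, nsmul_zero,
    add_zero]

theorem innerBdry_of_mem_bdry {A : Finset (TorusVertex n)} {p : TorusVertex n × TorusVertex n}
    (hp : p ∈ bdry (gens n) A) : p.1 ∈ innerBdry (gens n) A := by
  obtain ⟨h1, h2, h3⟩ := mem_bdry.1 hp
  exact mem_innerBdry.2 ⟨h1, p.2, h2, h3⟩

variable [NeZero d]

/-- A small set of candidates for the roots of the boundaries of size `L`. -/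
theorem exists_root_candidates (hmono : Monotone n) (L : ℕ) (x b : TorusVertex n) :
    ∃ (k : ℕ) (P : Finset (TorusVertex n)), k ≤ L / sectionSize n ∧
      P.card ^ (k + 1) ≤
        2 * d * (L + 1) * (sectionSize n ^ (L / sectionSize n) * n ⊤ ^ (L / sectionSize n)) ∧
      ∀ A : Finset (TorusVertex n), x ∈ A → b ∉ A →
        (∀ D : TorusVertex n → Prop, (∀ v ∈ A, ∀ s ∈ gens n, v + s ∈ A → (D v ↔ D (v + s))) →
          ∀ v ∈ A, ∀ v' ∈ A, (D v ↔ D v')) →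
        (∀ D : TorusVertex n → Prop, (∀ v ∉ A, ∀ s ∈ gens n, v + s ∉ A → (D v ↔ D (v + s))) →
          ∀ v ∉ A, ∀ v' ∉ A, (D v ↔ D v')) →
        (bdry (gens n) A).card = L →
        ∃ r : Fin (k + 1) → TorusVertex n, (∀ i, r i ∈ P ∧ r i ∈ innerBdry (gens n) A) ∧
          IsRootSet (gens n) A (Set.range r) := by
  classical
  have hd : 0 < d := Nat.pos_of_ne_zero (NeZero.ne d)
  have hα : 0 < sectionSize n := Finset.prod_pos fun i _ => Nat.pos_of_ne_zero (NeZero.ne (n i))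
  have hline : ∀ A : Finset (TorusVertex n), x ∈ A → b ∉ A → ¬ (x ∈ A ↔ b ∈ A) :=
    fun A hx hb h => hb (h.1 hx)
  -- For `L ≥ α`, at most `L / α` components occur and every vertex of the torus is allowed as a
  -- root. Setting `k + 1 = L / α` makes the power of `n ⊤` exactly the permitted one.
  rcases le_or_gt (sectionSize n) L with hL | hL
  · obtain ⟨k, hk⟩ : ∃ k, L / sectionSize n = k + 1 :=
      Nat.exists_eq_add_of_lt (Nat.div_pos hL hα) |>.imp fun k h => by omega
    refine ⟨k, Finset.univ, by omega, ?_, fun A hx hb hA hA' hcard => ?_⟩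
    · rw [Finset.card_univ, card_torus, ← hk, mul_pow]
      exact Nat.le_mul_of_pos_left _ (by positivity)
    · obtain ⟨r, hr, hroot⟩ := exists_isRootSet (a := sectionSize n) (k := k) neg_mem_gens (by
        rw [hcard]
        have := Nat.lt_mul_div_succ L hα
        rw [hk, mul_comm] at this
        exact this) (by
        obtain ⟨p, hp, -⟩ := exists_bdry_line (hline A hx hb)
        exact ⟨_, innerBdry_of_mem_bdry hp⟩)
        fun T hTI hT hne hne' => sectionSize_le_card_component hmono hA hA' hTI hT hne hne'
      exact ⟨r, fun i => ⟨Finset.mem_univ _, hr i⟩, hroot⟩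
  · have h0 : L / sectionSize n = 0 := Nat.div_eq_of_lt hL
    rw [h0]
    have hsingle : ∀ A : Finset (TorusVertex n),
        (∀ D : TorusVertex n → Prop, (∀ v ∈ A, ∀ s ∈ gens n, v + s ∈ A → (D v ↔ D (v + s))) →
          ∀ v ∈ A, ∀ v' ∈ A, (D v ↔ D v')) →
        (∀ D : TorusVertex n → Prop, (∀ v ∉ A, ∀ s ∈ gens n, v + s ∉ A → (D v ↔ D (v + s))) →
          ∀ v ∉ A, ∀ v' ∉ A, (D v ↔ D v')) →
        (bdry (gens n) A).card = L → ∀ v, IsRootSet (gens n) A (Set.range fun _ : Fin (0 + 1) => v) := by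
      intro A hA hA' hcard v
      rw [Set.range_const]
      exact isRootSet_singleton (hcard ▸ hL)
        (fun T hTI hT hne hne' => sectionSize_le_card_component hmono hA hA' hTI hT hne hne') v
    -- Now one root suffices and no factor `n ⊤` is available. If `n ⊤ ≤ L`, the lines of the hybrid
    -- path from `x` to `b` have at most `d * L` vertices; otherwise the segments of
    -- `exists_innerBdry_segment` have `2 * (L + 1)`.
    rcases le_or_gt (n ⊤) L with hn | hn
    · refine ⟨0, ((Finset.univ : Finset (Fin d)) ×ˢ Finset.range (n ⊤)).image fun p =>
        hybrid x b p.1 + p.2 • unit n p.1, le_rfl, ?_, fun A hx hb hA hA' hcard => ?_⟩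
      · rw [zero_add, pow_one, pow_zero, pow_zero, mul_one, mul_one]
        refine Finset.card_image_le.trans ?_
        rw [Finset.card_product, Finset.card_univ, Fintype.card_fin, Finset.card_range]
        exact Nat.mul_le_mul (by omega) (by omega)
      · obtain ⟨p, hp, i, -, k, hk⟩ := exists_bdry_line (hline A hx hb)
        refine ⟨fun _ => p.1, fun _ => ⟨Finset.mem_image.2 ⟨(i, k % n i), ?_, ?_⟩,
          innerBdry_of_mem_bdry hp⟩, hsingle A hA hA' hcard _⟩
        · exact Finset.mem_product.2 ⟨Finset.mem_univ _, Finset.mem_range.2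
            ((Nat.mod_lt _ (Nat.pos_of_ne_zero (NeZero.ne (n i)))).trans_le (hmono le_top))⟩
        · rw [hk, ← mod_nsmul_unit i k]
    · refine ⟨0, (Finset.range (L + 1)).image (fun j => x + j • unit n ⊤) ∪
        (Finset.range (L + 1)).image (fun j => b + j • unit n ⊤), le_rfl, ?_,
        fun A hx hb hA hA' hcard => ?_⟩
      · rw [zero_add, pow_one, pow_zero, pow_zero, mul_one, mul_one]
        refine (Finset.card_union_le _ _).trans ((Nat.add_le_add Finset.card_image_le
          Finset.card_image_le).trans ?_)
        rw [Finset.card_range]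
        nlinarith
      · obtain ⟨j, hj, h⟩ := exists_innerBdry_segment hmono hx hb (hcard ▸ hL) (hcard ▸ hn)
        have hj' : j ∈ Finset.range (L + 1) := Finset.mem_range.2 (by omega)
        rcases h with h | h
        · exact ⟨fun _ => _, fun _ => ⟨Finset.mem_union_left _ (Finset.mem_image_of_mem _ hj'), h⟩,
            hsingle A hA hA' hcard _⟩
        · exact ⟨fun _ => _, fun _ => ⟨Finset.mem_union_right _ (Finset.mem_image_of_mem _ hj'), h⟩,
            hsingle A hA hA' hcard _⟩

end RootCandidates

/-! ### Estimates. -/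

section Numerics

/-- This is where the threshold `12` is sharp: `12 ^ 3 ≤ 2 ^ 11`, whereas `11 ^ 3 > 2 ^ 10`. -/
theorem cube_le_two_pow {d : ℕ} (hd : 12 ≤ d) : d ^ 3 ≤ 2 ^ (d - 1) := by
  induction d, hd using Nat.le_induction with
  | base => norm_num
  | succ d hd ih =>
    have h1 := Nat.mul_le_mul_left (d ^ 2) hd
    have h2 := Nat.mul_le_mul_left d hd
    rw [show d + 1 - 1 = d - 1 + 1 by omega, pow_succ 2]
    calc (d + 1) ^ 3 = d ^ 3 + 3 * d ^ 2 + 3 * d + 1 := by ring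
      _ ≤ d ^ 3 * 2 := by linarith [pow_succ d 2, pow_two d]
      _ ≤ _ := Nat.mul_le_mul_right 2 ih

theorem cube_le_sectionSize {d : ℕ} [NeZero d] {n : Fin d → ℕ} (hn : ∀ i, 2 ≤ n i) (hd : 12 ≤ d) :
    d ^ 3 ≤ sectionSize n := by
  refine (cube_le_two_pow hd).trans ?_
  have h := Finset.pow_card_le_prod (Finset.Iio (⊤ : Fin d)) n 2 fun i _ => hn i
  have h1 : (Finset.Iio (⊤ : Fin d)).card = d - 1 := by
    rw [Fin.card_Iio]
    have h2 : ((⊤ : Fin d) : ℕ) + 1 = d := by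
      obtain ⟨e, rfl⟩ := Nat.exists_eq_succ_of_ne_zero (NeZero.ne d)
      rfl
    omega
  rwa [h1] at h

/-- The relations between the dimension `d`, its square root `s`, its logarithm `l`, and the length
`L = u d ^ (3 / 2)`. -/
structure Scale (d s l L u : ℝ) : Prop where
  le_d : 12 ≤ d
  s_pos : 0 < s
  sq_s : s ^ 2 = d
  l_eq : l = Real.log d
  L_eq : L = u * (d * s)
  sq_le : d ^ 2 ≤ 4 * L

namespace Scale

variable {d s l L u : ℝ}

theorem one_le_l (h : Scale d s l L u) : 1 ≤ l := by
  rw [h.l_eq, Real.le_log_iff_exp_le (by linarith [h.le_d])]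
  linarith [Real.exp_one_lt_d9, h.le_d]

theorem one_le_s (h : Scale d s l L u) : 1 ≤ s := by
  nlinarith [h.le_d, h.sq_s, h.s_pos]

theorem L_nonneg (h : Scale d s l L u) : 0 ≤ L := by
  nlinarith [sq_nonneg d, h.sq_le]

theorem ds_pos (h : Scale d s l L u) : 0 < d * s :=
  mul_pos (by linarith [h.le_d]) h.s_pos

theorem ds_le (h : Scale d s l L u) : d * s ≤ d ^ 2 := by
  have : s ≤ d := by nlinarith [h.one_le_s, h.sq_s]
  nlinarith [h.le_d]

theorem u_nonneg (h : Scale d s l L u) : 0 ≤ u := by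
  by_contra! hu
  nlinarith [h.L_nonneg, h.L_eq, h.ds_pos]

theorem div_sq_le (h : Scale d s l L u) : L / d ^ 2 ≤ u := by
  have hd := h.le_d
  rw [div_le_iff₀ (by positivity), h.L_eq]
  exact mul_le_mul_of_nonneg_left h.ds_le h.u_nonneg

theorem one_le_u (h : Scale d s l L u) : 1 ≤ 4 * u := by
  have hd := h.le_d
  have h1 := h.div_sq_le
  have h2 : 1 ≤ 4 * (L / d ^ 2) := by
    rw [← mul_div_assoc, one_le_div (by positivity)]
    exact h.sq_le
  linarith

theorem u_le_mul (h : Scale d s l L u) : u ≤ u * l :=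
  le_mul_of_one_le_right h.u_nonneg h.one_le_l

theorem div_cube_le (h : Scale d s l L u) {a : ℝ} (ha : d ^ 3 ≤ a) : L / a ≤ u := by
  have hd := h.le_d
  refine le_trans ?_ h.div_sq_le
  refine div_le_div_of_nonneg_left h.L_nonneg (by positivity) (le_trans ?_ ha)
  exact pow_le_pow_right₀ (by linarith) (by norm_num)

/-- The number of letters needed. -/
theorem letters_le (h : Scale d s l L u) {Δ N k a : ℝ} (hΔ : d ≤ Δ) (hΔ' : Δ ≤ 2 * d)
    (hN : d / 6 ≤ N) (hN' : N ≤ d) (ha : d ^ 3 ≤ a) (hk : k ≤ L / a) :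
    4 * L / Δ ^ 2 + (k + 1) + 12 * (2 * Δ + N) * L / N ^ 3 + 12 * L / N / (s / 2) +
      (12 * L / N / (s / 2) * (Real.log Δ + 1) + 1) ≤ 14000 * (u * l) := by
  have hd := h.le_d
  have hL := h.L_nonneg
  have hs := h.s_pos
  have hl := h.one_le_l
  have hu := h.u_nonneg
  have h1 : 4 * L / Δ ^ 2 ≤ 4 * u := by
    calc 4 * L / Δ ^ 2 ≤ 4 * L / d ^ 2 := by gcongr
      _ = 4 * (L / d ^ 2) := by ring
      _ ≤ _ := by linarith [h.div_sq_le]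
  have h2 : k ≤ u := hk.trans (h.div_cube_le ha)
  have h3 : 12 * (2 * Δ + N) * L / N ^ 3 ≤ 12960 * u := by
    calc 12 * (2 * Δ + N) * L / N ^ 3 ≤ 12 * (2 * (2 * d) + d) * L / (d / 6) ^ 3 := by gcongr
      _ = 12960 * (L / d ^ 2) := by field_simp; ring
      _ ≤ _ := by linarith [h.div_sq_le]
  have h4 : 12 * L / N / (s / 2) ≤ 144 * u := by
    calc 12 * L / N / (s / 2) ≤ 12 * L / (d / 6) / (s / 2) := by gcongr
      _ = 144 * u := by rw [h.L_eq]; field_simp; ring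
  have h5 : Real.log Δ + 1 ≤ 3 * l := by
    have := Real.log_le_log (by linarith) hΔ'
    rw [Real.log_mul (by norm_num) (by linarith), ← h.l_eq] at this
    linarith [Real.log_two_lt_d9]
  have h6 : 12 * L / N / (s / 2) * (Real.log Δ + 1) ≤ 144 * u * (3 * l) :=
    mul_le_mul h4 h5 (by linarith [Real.log_nonneg (show 1 ≤ Δ by linarith)]) (by positivity)
  linarith [h.one_le_u, h.u_le_mul]

theorem pow_eq_exp (h : Scale d s l L u) (j : ℕ) : d ^ j = Real.exp (j * l) := by
  rw [h.l_eq, ← Real.log_pow, Real.exp_log (pow_pos (by linarith [h.le_d]) j)]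

theorem alphabet_le (h : Scale d s l L u) {Δ : ℝ} (hΔ : 0 ≤ Δ) (hΔ' : Δ ≤ 2 * d) :
    ((Δ + 1) ^ 18 + 1) * 16 ≤ Real.exp (40 * l) := by
  have hd := h.le_d
  have h1 : Δ + 1 ≤ d ^ 2 := by nlinarith
  have h2 : (Δ + 1) ^ 18 ≤ (d ^ 2) ^ 18 := by gcongr
  have h3 : (1 : ℝ) ≤ (d ^ 2) ^ 18 := one_le_pow₀ (one_le_pow₀ (by linarith))
  have h4 : (32 : ℝ) ≤ d ^ 4 := le_trans (by norm_num) (pow_le_pow_left₀ (by norm_num) hd 4)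
  calc ((Δ + 1) ^ 18 + 1) * 16 ≤ 32 * (d ^ 2) ^ 18 := by linarith
    _ ≤ d ^ 4 * (d ^ 2) ^ 18 := by gcongr
    _ = d ^ 40 := by ring
    _ = _ := by rw [h.pow_eq_exp]; norm_num

/-- The exponent is `40 * 28013 = 1120520`: the logarithm of the alphabet size times the length of
the words. -/
theorem words_le (h : Scale d s l L u) {B : ℝ} (hB : 0 ≤ B) (hB' : B ≤ Real.exp (40 * l)) {W : ℕ}
    (hW : (W : ℝ) ≤ 28013 * (u * l)) : B ^ W ≤ Real.exp (1120520 * (u * l ^ 2)) := by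
  refine (pow_le_pow_left₀ hB hB' W).trans ?_
  rw [← Real.exp_nat_mul, Real.exp_le_exp]
  have hl := h.one_le_l
  nlinarith

theorem values_le (h : Scale d s l L u) {N : ℝ} (hN : 0 ≤ N) (hN' : N ≤ d) :
    N ^ 3 * 2 ≤ Real.exp (16 * (u * l ^ 2)) := by
  have hd := h.le_d
  have hl := h.one_le_l
  calc N ^ 3 * 2 ≤ d ^ 3 * d := by gcongr; linarith
    _ = d ^ 4 := by ring
    _ = Real.exp (4 * l) := by rw [h.pow_eq_exp]; norm_num
    _ ≤ _ := by
      rw [Real.exp_le_exp]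
      have h1 := mul_le_mul_of_nonneg_right h.one_le_u (by linarith : 0 ≤ l)
      have h2 := mul_le_mul_of_nonneg_left hl (mul_nonneg h.u_nonneg (by linarith : 0 ≤ l))
      nlinarith

/-- The left side is at most `L ^ 3`, and `log L ≤ u + 2 * l`; a term linear in `l` is absorbed
through `1 ≤ 4 * u`. -/
theorem roots_le (h : Scale d s l L u) :
    2 * d * (L + 1) ≤ Real.exp (27 * (u * l ^ 2)) := by
  have hd := h.le_d
  have hl := h.one_le_l
  have hLd : d ≤ L := by nlinarith [h.sq_le]
  have hL0 : 0 < L := by linarith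
  have h1 : 2 * d * (L + 1) ≤ L ^ 3 := by
    calc 2 * d * (L + 1) ≤ 2 * L * (L + L) := by gcongr; linarith
      _ = 4 * L ^ 2 := by ring
      _ ≤ L * L ^ 2 := by gcongr; linarith
      _ = L ^ 3 := by ring
  refine h1.trans ?_
  rw [← Real.log_le_iff_le_exp (by positivity), Real.log_pow]
  have h2 : Real.log L = Real.log (L / d ^ 2) + 2 * l := by
    rw [Real.log_div hL0.ne' (by positivity), Real.log_pow, h.l_eq]
    push_cast; ring
  have h3 := Real.log_le_sub_one_of_pos (show 0 < L / d ^ 2 by positivity)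
  have h4 := h.div_sq_le
  have h5 := mul_le_mul_of_nonneg_right h.one_le_u (by linarith : 0 ≤ l)
  have h6 := mul_le_mul_of_nonneg_left hl (mul_nonneg h.u_nonneg (by linarith : 0 ≤ l))
  have h7 := h.u_le_mul
  push_cast
  nlinarith

/-- The roots cost an extra `α ^ (L / α)`. As `log α ≤ 2 * √α` and `√α ≥ d ^ (3 / 2)`, its logarithm
is at most `2 * u`. -/
theorem section_pow_le (h : Scale d s l L u) {a : ℝ} (ha : d ^ 3 ≤ a) {j : ℕ}
    (hj : (j : ℝ) ≤ L / a) : a ^ j ≤ Real.exp (2 * (u * l ^ 2)) := by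
  have hd := h.le_d
  have hl := h.one_le_l
  have ha0 : 0 < a := lt_of_lt_of_le (by positivity) ha
  have hs := Real.sqrt_pos.2 ha0
  have h1 : d * s ≤ √a := by
    refine Real.le_sqrt_of_sq_le ?_
    calc (d * s) ^ 2 = d ^ 3 := by rw [mul_pow, h.sq_s]; ring
      _ ≤ a := ha
  have h2 : Real.log a ≤ 2 * √a := by
    have h3 : Real.log a = 2 * Real.log √a := by
      rw [Real.log_sqrt ha0.le]; ring
    linarith [Real.log_le_sub_one_of_pos hs]
  have hlog : 0 ≤ Real.log a := Real.log_nonneg (le_trans (one_le_pow₀ (by linarith)) ha)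
  rw [← Real.log_le_iff_le_exp (by positivity), Real.log_pow]
  calc (j : ℝ) * Real.log a ≤ L / a * (2 * √a) := mul_le_mul hj h2 hlog (by
        have := h.L_nonneg; positivity)
    _ = 2 * (L / √a) := by
      have : √a * √a = a := Real.mul_self_sqrt ha0.le
      field_simp
      rw [sq, this]
    _ ≤ 2 * (L / (d * s)) := by
      have := h.L_nonneg
      have := h.ds_pos
      gcongr
    _ = 2 * u := by rw [h.L_eq, mul_div_cancel_right₀ _ h.ds_pos.ne']
    _ ≤ _ := by
      have := mul_le_mul_of_nonneg_left hl (mul_nonneg h.u_nonneg (by linarith : 0 ≤ l))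
      nlinarith [h.u_le_mul]

end Scale

theorem scale_of_nat {d L : ℕ} (hd : 12 ≤ d) (hL : d ^ 2 ≤ 4 * L) :
    Scale d (√d) (Real.log d) L (L / (d * √d)) := by
  have hd' : (12 : ℝ) ≤ d := by exact_mod_cast hd
  have hs : 0 < √(d : ℝ) := Real.sqrt_pos.2 (by linarith)
  refine ⟨hd', hs, Real.sq_sqrt (by linarith), rfl, ?_, by exact_mod_cast hL⟩
  rw [div_mul_cancel₀]
  exact (mul_pos (by linarith) hs).ne'

/-- Three disjoint blocks of `2 ^ m` coordinates must fit into `d`, with `2 ^ m` still of order `d`.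
-/
theorem exists_two_pow {d : ℕ} (hd : 12 ≤ d) : ∃ m : ℕ, 3 * 2 ^ m ≤ d ∧ d < 6 * 2 ^ m := by
  refine ⟨Nat.log 2 (d / 3), ?_, ?_⟩
  · have := Nat.pow_log_le_self 2 (x := d / 3) (by omega)
    omega
  · have := Nat.lt_pow_succ_log_self (b := 2) (by norm_num) (d / 3)
    rw [pow_succ] at this
    omega

end Numerics

/-! ### Assembly. -/

section Torus

variable {d : ℕ} [NeZero d] {n : Fin d → ℕ} [∀ i, NeZero (n i)]

/-- The family for the cutsets both of whose sides have at least two vertices. -/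
theorem exists_torus_family (hn : IsSideLengths n) (hd : 12 ≤ d) (Ev : TorusVertex n → Prop)
    {L : ℕ} (hL : d ^ 2 ≤ 4 * L) (x b : TorusVertex n) :
    ∃ 𝓔 : Finset (Set (TorusVertex n)),
      (𝓔.card : ℝ) ≤ (n ⊤ : ℝ) ^ (L / sectionSize n) *
        Real.exp (1120565 * (L / (d * √d) * Real.log d ^ 2)) ∧
      ∀ A : Finset (TorusVertex n), IsOddSet (gens n) A Ev → x ∈ A → b ∉ A →
        (∀ D : TorusVertex n → Prop, (∀ v ∈ A, ∀ s ∈ gens n, v + s ∈ A → (D v ↔ D (v + s))) →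
          ∀ v ∈ A, ∀ v' ∈ A, (D v ↔ D v')) →
        (∀ D : TorusVertex n → Prop, (∀ v ∉ A, ∀ s ∈ gens n, v + s ∉ A → (D v ↔ D (v + s))) →
          ∀ v ∉ A, ∀ v' ∉ A, (D v ↔ D v')) →
        (∀ v ∈ A, ∃ s ∈ gens n, v + s ∈ A) → (∀ v ∉ A, ∃ s ∈ gens n, v + s ∉ A) →
        (bdry (gens n) A).card = L →
        ∃ E ∈ 𝓔, E ⊆ A ∧ ∀ v ∈ A, ¬ Ev v → √d < inDeg (gens n) A v → v ∈ E := by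
  have hsc := scale_of_nat hd hL
  obtain ⟨m, hm, hm'⟩ := exists_two_pow hd
  obtain ⟨ι⟩ : Nonempty (Fin 3 × (Fin m → ZMod 2) ↪ Fin d) :=
    Function.Embedding.nonempty_of_card_le (by simpa [ZMod.card] using hm)
  have hK : Fintype.card (Fin m → ZMod 2) = 2 ^ m := by simp [ZMod.card]
  have hΔ : d ≤ (gens n).card := le_card_gens hn.two_le
  have hΔ' : (gens n).card ≤ 2 * d := card_gens_le
  have hα : d ^ 3 ≤ sectionSize n := cube_le_sectionSize hn.two_le hd
  obtain ⟨k, P, hk, hP, hroot⟩ := exists_root_candidates hn.mono L x b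
  have hdΔ : (d : ℝ) ≤ (gens n).card := by exact_mod_cast hΔ
  have hdΔ' : ((gens n).card : ℝ) ≤ 2 * d := by exact_mod_cast hΔ'
  have hαR : (d : ℝ) ^ 3 ≤ sectionSize n := by exact_mod_cast hα
  have hN : (d : ℝ) / 6 ≤ (2 ^ m : ℕ) := by
    have : (d : ℝ) < 6 * (2 ^ m : ℕ) := by exact_mod_cast hm'
    linarith
  have hN' : ((2 ^ m : ℕ) : ℝ) ≤ d := by
    exact_mod_cast (Nat.le_mul_of_pos_left _ (by norm_num)).trans hm
  have hj : ((L / sectionSize n : ℕ) : ℝ) ≤ (L : ℝ) / sectionSize n := Nat.cast_div_le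
  have hkR : (k : ℝ) ≤ (L : ℝ) / sectionSize n := le_trans (by exact_mod_cast hk) hj
  have hlet := hsc.letters_le hdΔ hdΔ' hN hN' hαR hkR
  set X : ℝ := 4 * (L : ℝ) / ((gens n).card : ℝ) ^ 2 + (k + 1) +
      12 * (2 * ((gens n).card : ℝ) + (2 ^ m : ℕ)) * L / ((2 ^ m : ℕ) : ℝ) ^ 3 +
      12 * L / ((2 ^ m : ℕ) : ℝ) / (√d / 2) +
      (12 * L / ((2 ^ m : ℕ) : ℝ) / (√d / 2) * (Real.log (gens n).card + 1) + 1) with hX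
  have hX0 : 0 ≤ X := by
    have h1 : 0 ≤ Real.log (gens n).card := Real.log_natCast_nonneg _
    positivity
  -- With `t = √d / 2`, the requirement of more than `2 * t` neighbours in `A` is exactly
  -- non-exposure.
  obtain ⟨𝓔, hcard, h𝓔⟩ := exists_family (gens n) Ev gens_connected (torusSyndrome hn.even ι)
    (t := √d / 2) (half_pos hsc.s_pos) (by omega) k ⌈X⌉₊ L P (by
      rw [hK]; exact Nat.le_ceil X)
  refine ⟨𝓔, ?_, fun A hodd hx hb hA hA' hin hout hAL => ?_⟩
  · set q := ⌈X⌉₊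
    rw [hK] at hcard
    have hq : (q : ℝ) ≤ X + 1 := (Nat.ceil_lt_add_one hX0).le
    have hu := hsc.u_le_mul
    have h1u := hsc.one_le_u
    have hW : ((k + 1 + 2 * q : ℕ) : ℝ) ≤ 28013 * (L / (d * √d) * Real.log d) := by
      have := hsc.div_cube_le hαR
      push_cast
      linarith
    have h1 := hsc.roots_le
    have h2 := hsc.section_pow_le hαR hj
    have h3 := hsc.words_le (by positivity) (hsc.alphabet_le (Nat.cast_nonneg _) hdΔ') hW
    have h4 := hsc.values_le (Nat.cast_nonneg (2 ^ m)) hN'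
    have hPR : ((P.card ^ (k + 1) : ℕ) : ℝ) ≤ 2 * d * (L + 1) *
        ((sectionSize n : ℝ) ^ (L / sectionSize n) * (n ⊤ : ℝ) ^ (L / sectionSize n)) := by
      exact_mod_cast hP
    set u : ℝ := L / (d * √d)
    set l := Real.log (d : ℝ)
    set N : ℝ := (n ⊤ : ℝ) ^ (L / sectionSize n) with hNdef
    have hN0 : 0 ≤ N := by positivity
    calc (𝓔.card : ℝ) ≤ ((P.card ^ (k + 1) : ℕ) : ℝ) *
          (((((gens n).card : ℝ) + 1) ^ 18 + 1) * 16) ^ (k + 1 + 2 * q) *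
          (((2 ^ m : ℕ) : ℝ) ^ 3 * 2) := by exact_mod_cast hcard
      _ ≤ Real.exp (27 * (u * l ^ 2)) * (Real.exp (2 * (u * l ^ 2)) * N) *
          Real.exp (1120520 * (u * l ^ 2)) * Real.exp (16 * (u * l ^ 2)) := by
        have h5 : ((P.card ^ (k + 1) : ℕ) : ℝ) ≤
            Real.exp (27 * (u * l ^ 2)) * (Real.exp (2 * (u * l ^ 2)) * N) := by
          refine hPR.trans ?_
          gcongr
        gcongr
      _ = _ := by
        rw [show 1120565 * (u * l ^ 2) = 27 * (u * l ^ 2) + 2 * (u * l ^ 2) +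
          1120520 * (u * l ^ 2) + 16 * (u * l ^ 2) by ring, Real.exp_add, Real.exp_add,
          Real.exp_add]
        ring
  · obtain ⟨E, hE, h1, h2⟩ := h𝓔 A hodd hin hout hAL (hroot A hx hb hA hA' hAL)
    exact ⟨E, hE, h1, fun v hv hev hdeg => h2 v hv hev (by linarith)⟩

end Torus

theorem rpow_three_halves {x : ℝ} (hx : 0 < x) : x ^ (3 / 2 : ℝ) = x * √x := by
  rw [Real.sqrt_eq_rpow, show (3 / 2 : ℝ) = 1 + 1 / 2 by norm_num, Real.rpow_add hx, Real.rpow_one]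

theorem inDeg_eq_zero {d : ℕ} {n : Fin d → ℕ} [∀ i, NeZero (n i)] (hn : ∀ i, 2 ≤ n i)
    {A : Finset (TorusVertex n)} {x : TorusVertex n} (h : ∀ y ∈ A, y = x) : inDeg (gens n) A x = 0 := by
  rw [inDeg, Finset.card_eq_zero, Finset.filter_eq_empty_iff]
  intro s hs hxs
  have hadj : (torus n).Adj x (x + s) := (torus_adj hn).2 (by simpa using hs)
  exact hadj.ne (h _ hxs).symm

/-- The odd cutsets of size `L` have few interior approximations. -/
theorem exists_approximations {d : ℕ} [NeZero d] (hd : 12 ≤ d) {n : Fin d → ℕ}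
    (hn : IsSideLengths n) {Veven Vodd : Set (TorusVertex n)}
    (hbip : (torus n).IsBipartiteWith Veven Vodd) (L : ℕ) (x b : TorusVertex n) :
    ∃ 𝓔 : Finset (Set (TorusVertex n)),
      (𝓔.card : ℝ) ≤ 2 * (n ⊤ : ℝ) ^ (L / sectionSize n) *
        Real.exp (2000000 * (L / (d * √d) * Real.log d ^ 2)) ∧
      ∀ Γ ∈ OMCut (torus n) Vodd x b, Γ.ncard = L →
        ∃ E ∈ 𝓔, IsInteriorApproximation (torus n) d Γ x E := by
  classical
  have : ∀ i, NeZero (n i) := fun i => ⟨by have := hn.two_le i; omega⟩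
  have hG : ∀ v w, (torus n).Adj v w ↔ w - v ∈ gens n := fun v w => torus_adj hn.two_le
  have hn1 : (1 : ℝ) ≤ (n ⊤ : ℝ) ^ (L / sectionSize n) :=
    one_le_pow₀ (by exact_mod_cast (by norm_num : 1 ≤ 2).trans (hn.two_le ⊤))
  have hexp : (1 : ℝ) ≤ Real.exp (2000000 * (L / (d * √d) * Real.log d ^ 2)) :=
    Real.one_le_exp (by positivity)
  have hx : ∀ Γ, x ∈ side (torus n) Γ x := fun Γ => mem_side.2 (self_mem_comp x)
  have hb : ∀ Γ ∈ MCut (torus n) x b, b ∉ side (torus n) Γ x := fun Γ hΓ h =>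
    hΓ.2.1.notMem_comp (mem_side.1 h)
  have hinner : ∀ Γ ∈ OMCut (torus n) Vodd x b, (∀ y ∈ side (torus n) Γ x, y = x) →
      IsInteriorApproximation (torus n) d Γ x ∅ := fun Γ hΓ h => by
    refine isInteriorApproximation_of_inDeg hG hbip hΓ d (Set.empty_subset _)
      fun v hv _ _ hdeg => ?_
    rw [h v hv, inDeg_eq_zero hn.two_le h, Nat.cast_zero] at hdeg
    exact absurd hdeg (Real.sqrt_nonneg _).not_gt
  have houter : ∀ Γ ∈ OMCut (torus n) Vodd x b, (∀ y ∉ side (torus n) Γ x, y = b) →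
      IsInteriorApproximation (torus n) d Γ x {b}ᶜ := fun Γ hΓ h => by
    refine isInteriorApproximation_of_inDeg hG hbip hΓ d (fun v hv => ?_) fun v hv _ _ _ => ?_
    · by_contra hv'
      exact hv (h v hv')
    · rintro rfl
      exact hb Γ hΓ.1 hv
  have hmain : ∀ Γ ∈ OMCut (torus n) Vodd x b, ¬ (∀ y ∈ side (torus n) Γ x, y = x) →
      ¬ (∀ y ∉ side (torus n) Γ x, y = b) →
      (∀ v ∈ side (torus n) Γ x, ∃ s ∈ gens n, v + s ∈ side (torus n) Γ x) ∧
      ∀ v ∉ side (torus n) Γ x, ∃ s ∈ gens n, v + s ∉ side (torus n) Γ x := by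
    intro Γ hΓ h1 h2
    push Not at h1 h2
    exact ⟨fun v hv => exists_add_of_connected (side_connected hG) neg_mem_gens (hx Γ) h1 hv,
      fun v hv => exists_add_of_connected (P := (· ∉ side (torus n) Γ x))
        (compl_side_connected hG (torus_preconnected hn.two_le) hΓ.1) neg_mem_gens (hb Γ hΓ.1) h2 hv⟩
  -- Unless one side is a single vertex, `sq_card_le` gives `d ^ 2 ≤ 4 * L`; for smaller `L` only
  -- the two degenerate approximations are needed.
  by_cases hL : d ^ 2 ≤ 4 * L
  · obtain ⟨𝓔, hcard, h𝓔⟩ := exists_torus_family hn hd (· ∈ Veven) hL x b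
    refine ⟨insert ∅ (insert {b}ᶜ 𝓔), ?_, fun Γ hΓ hΓL => ?_⟩
    · have h1 : (insert ∅ (insert {b}ᶜ 𝓔)).card ≤ 𝓔.card + 1 + 1 :=
        (Finset.card_insert_le _ _).trans (Nat.add_le_add_right (Finset.card_insert_le _ _) 1)
      have h2 : ((insert ∅ (insert {b}ᶜ 𝓔)).card : ℝ) ≤ 𝓔.card + 1 + 1 := by exact_mod_cast h1
      have hsc := scale_of_nat hd hL
      have hl := hsc.one_le_l
      have h3 : 1 ≤ 4 * (L / (d * √d) * Real.log d ^ 2) := by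
        nlinarith [hsc.one_le_u, hsc.u_nonneg, one_le_pow₀ hl (n := 2)]
      set M : ℝ := L / (d * √d) * Real.log d ^ 2
      set N : ℝ := (n ⊤ : ℝ) ^ (L / sectionSize n)
      -- As `M ≥ 1 / 4`, the slack in the constant absorbs the two additional sets, using the factor
      -- `2`.
      have h4 : Real.exp (1120565 * M) + 1 ≤ Real.exp (2000000 * M) := by
        have h5 : 2000000 * M = 1120565 * M + 879435 * M := by ring
        have h6 := Real.add_one_le_exp (879435 * M)
        have h7 : 1 ≤ Real.exp (1120565 * M) := Real.one_le_exp (by linarith)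
        rw [h5, Real.exp_add]
        nlinarith
      nlinarith
    · by_cases h1 : ∀ y ∈ side (torus n) Γ x, y = x
      · exact ⟨∅, by simp, hinner Γ hΓ h1⟩
      by_cases h2 : ∀ y ∉ side (torus n) Γ x, y = b
      · exact ⟨{b}ᶜ, by simp, houter Γ hΓ h2⟩
      obtain ⟨hin, hout⟩ := hmain Γ hΓ h1 h2
      obtain ⟨E, hE, hEA, hEv⟩ := h𝓔 _ (isOddSet_side hG neg_mem_gens hbip hΓ) (hx Γ) (hb Γ hΓ.1)
        (side_connected hG) (compl_side_connected hG (torus_preconnected hn.two_le) hΓ.1) hin hout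
        (by rw [← ncard_eq_card_bdry hG hΓ.1, hΓL])
      exact ⟨E, Finset.mem_insert_of_mem (Finset.mem_insert_of_mem hE),
        isInteriorApproximation_of_inDeg hG hbip hΓ d hEA fun v hv hev _ hdeg => hEv v hv hev hdeg⟩
  · refine ⟨{∅, {b}ᶜ}, ?_, fun Γ hΓ hΓL => ?_⟩
    · have h1 : ((({∅, {b}ᶜ} : Finset (Set (TorusVertex n))).card : ℕ) : ℝ) ≤ 2 := by
        exact_mod_cast Finset.card_le_two
      nlinarith
    · by_cases h1 : ∀ y ∈ side (torus n) Γ x, y = x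
      · exact ⟨∅, by simp, hinner Γ hΓ h1⟩
      by_cases h2 : ∀ y ∉ side (torus n) Γ x, y = b
      · exact ⟨{b}ᶜ, by simp, houter Γ hΓ h2⟩
      obtain ⟨hin, hout⟩ := hmain Γ hΓ h1 h2
      obtain ⟨p, hp, -⟩ := exists_bdry_line (A := side (torus n) Γ x) (x := x) (y := b)
        fun h => hb Γ hΓ.1 (h.1 (hx Γ))
      obtain ⟨hp1, hp2, hp3⟩ := mem_bdry.1 hp
      have h3 := (isOddSet_side hG neg_mem_gens hbip hΓ).sq_card_le hin hout hp1 hp2 hp3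
      have h4 : (bdryNear (gens n) (side (torus n) Γ x) 4 p.1).card ≤ L := by
        rw [← hΓL, ncard_eq_card_bdry hG hΓ.1]
        exact Finset.card_filter_le _ _
      have h5 := Nat.pow_le_pow_left (le_card_gens (n := n) hn.two_le) 2
      exact absurd (h5.trans (h3.trans (Nat.mul_le_mul_left 4 h4))) hL

end OddCutset

theorem theorem3p13 :
    ∃ (d₀ : ℕ) (C : ℝ), 0 < d₀ ∧ 0 < C ∧
      ∀ (d : ℕ) [NeZero d], d₀ ≤ d →
      ∀ (n : Fin d → ℕ), OddCutset.IsSideLengths n →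
      ∀ (Veven Vodd : Set (OddCutset.TorusVertex n)),
        (OddCutset.torus n).IsBipartiteWith Veven Vodd →
      ∀ (L : ℕ) (x b : OddCutset.TorusVertex n),
      ∃ 𝓔 : Finset (Set (OddCutset.TorusVertex n)),
        (𝓔.card : ℝ) ≤ 2 * (n ⊤ : ℝ) ^ (L / OddCutset.sectionSize n) *
            Real.exp (C * Real.log (d : ℝ) ^ 2 / (d : ℝ) ^ (3 / 2 : ℝ) * (L : ℝ)) ∧
        ∀ Γ ∈ OddCutset.OMCut (OddCutset.torus n) Vodd x b, Γ.ncard = L →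
          ∃ E ∈ 𝓔, OddCutset.IsInteriorApproximation (OddCutset.torus n) d Γ x E := by
  refine ⟨12, 2000000, by norm_num, by norm_num, ?_⟩
  intro d _ hd n hn Veven Vodd hbip L x b
  obtain ⟨𝓔, hcard, h𝓔⟩ := OddCutset.exists_approximations hd hn hbip L x b
  refine ⟨𝓔, hcard.trans_eq ?_, h𝓔⟩
  have hd0 : (0 : ℝ) < d := by exact_mod_cast (by omega : 0 < d)
  rw [OddCutset.rpow_three_halves hd0]
  congr 2
  ring
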